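/- Let $d>0$ be fixed. Let $X^{sc}$ be a finite simplicial complex with vertex set $\{0,\dots,n-1\}$ in which the vertices of every simplex are ordered, compatibly with faces (for instance by a total order of all vertices), and let $T$ be a spanning tree of its $1$-skeleton. Let $X^{ss}$ be the simplicial set whose $r$-simplices are the nondecreasing sequences $(V_0,\dots,V_r)$ of vertices that span a simplex of $X^{sc}$, let $X:=X^{ss}/T$ be the quotient in which, in every dimension, all simplices lying in $T$ are identified, and let $p:X^{ss}\to X$ be the projection. Let $\Sigma$ be a finite simplicial complex with vertex set $\{0,\dots,m-1\}$ and of dimension at most $d$, also with face-compatible orderings of the vertices of its simplices, let $\Sigma^{ss}$ be the induced simplicial set, and let $f:\Sigma^{ss}\to X$ be a simplicial map. For $k\ge 1$ let $\mathrm{Esd}_k(\Sigma)$ be the edgewise subdivision: its vertices are the functions $x$ from the vertices of $\Sigma$ to $\mathbb{N}$ with $\sum_v x_v=k$ whose support is a simplex of $\Sigma$; finitely many vertices span a simplex if the union of their supports is a simplex $v_0<\dots<v_s$ of $\Sigma$ and, for any two of them $x,y$, the numbers $\sum_{j\le i}(y_{v_j}-x_{v_j})$, $0\le i\le s$, are either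 all in $\{0,1\}$ or all in $\{0,-1\}$. Then there are $k\ge 1$ and a simplicial map $f':\mathrm{Esd}_k(\Sigma)\to X^{sc}$ of simplicial complexes (not necessarily order-preserving) such that the map $|\mathrm{Esd}_k(\Sigma)|\to|\Sigma|$ which sends a vertex $x$ to the point with barycentric coordinates $x/k$ and is affine on simplices is a homeomorphism, and, with $|\Sigma|=|\mathrm{Esd}_k(\Sigma)|$ identified through it, $|\Sigma|=|\Sigma^{ss}|$ and $|X^{sc}|=|X^{ss}|$, the composition $$|\Sigma|=|\mathrm{Esd}_k(\Sigma)|\xrightarrow{|f'|}|X^{sc}|\xrightarrow{|p|}|X|$$ is homotopic to $|f|:|\Sigma|\to|X|$. Moreover, for each fixed $d$ there is an algorithm which, from an encoding of $X^{sc}$, $T$, $\Sigma$ and $f$ (the lists of simplices, of tree edges and of the values of $f$, where a simplex of $X$ is represented by its vertex sequence in $X^{ss}$, or by a symbol for the degenerate base-points), computes such $k$ and $f'$ (that is, $k$, the list of simplices of $\mathrm{Esd}_k(\Sigma)$ and the table of the values of $f'$ on vertices) in time polynomial in the size of the encoding. -/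

import Mathlib

open CategoryTheory

/-! ### Ordered simplicial complexes and the simplicial sets they induce -/

/-- A simplicial complex with vertex set `V`, together with an ordering of the vertices of every
simplex, the orderings being compatible with passing to faces.  (The relation `le` matters only
between vertices of a common simplex.  A total order on `V` is a special case.) -/
structure OrderedComplex (V : Type) [DecidableEq V] extends AbstractSimplicialComplex V where
  le : V → V → Prop
  le_total : ∀ v w, {v, w} ∈ faces → le v w ∨ le w v
  le_antisymm : ∀ v w, {v, w} ∈ faces → le v w → le w v → v = w
  le_trans : ∀ u v w, {u, v, w} ∈ faces → le u v → le v w → le u w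

namespace OrderedComplex

variable {V : Type} [DecidableEq V]

/-- The complex has dimension at most `d`. -/
def DimLE (K : OrderedComplex V) (d : ℕ) : Prop :=
  ∀ s ∈ K.faces, s.card ≤ d + 1

/-- The `n`-simplices of the induced simplicial set: the nondecreasing sequences
`(V_0, …, V_n)` of vertices that span a simplex. -/
def IsSeq (K : OrderedComplex V) {n : ℕ} (σ : Fin (n + 1) → V) : Prop :=
  Finset.univ.image σ ∈ K.faces ∧ ∀ i j, i ≤ j → K.le (σ i) (σ j)

theorem IsSeq.comp {K : OrderedComplex V} {n m : ℕ} {σ : Fin (n + 1) → V} (h : K.IsSeq σ)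
    (g : Fin (m + 1) →o Fin (n + 1)) : K.IsSeq (σ ∘ g) := by
  refine ⟨(K.isRelLowerSet_faces h.1).2 ?_ (Finset.univ_nonempty.image _), fun i j hij =>
    h.2 _ _ (g.monotone hij)⟩
  intro v hv
  simp only [Finset.mem_image, Finset.mem_univ, true_and, Function.comp] at hv ⊢
  obtain ⟨i, rfl⟩ := hv
  exact ⟨_, rfl⟩

/-- The simplicial set `K^ss` induced by an ordered simplicial complex `K`: faces omit entries of
a sequence, degeneracies repeat them. -/
def ss (K : OrderedComplex V) : SSet.{0} where
  obj n := {σ : Fin (n.unop.len + 1) → V // K.IsSeq σ}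
  map g := ↾fun σ => ⟨σ.1 ∘ g.unop.toOrderHom, σ.2.comp g.unop.toOrderHom⟩

/-- `T` is a spanning tree in the `1`-skeleton of `K`. -/
def IsSpanningTree (K : OrderedComplex V) (T : SimpleGraph V) : Prop :=
  T.IsTree ∧ ∀ v w, T.Adj v w → {v, w} ∈ K.faces

end OrderedComplex

/-- All entries of the sequence lie in one vertex or in one edge of `T`. -/
def InTree {V : Type} (T : SimpleGraph V) {n : ℕ} (σ : Fin (n + 1) → V) : Prop :=
  ∃ v w, (v = w ∨ T.Adj v w) ∧ ∀ i, σ i = v ∨ σ i = w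

namespace OrderedComplex

variable {V : Type} [DecidableEq V]

/-- Two simplices of `K^ss` are identified in `K^ss / T` if they are equal or both in `T`. -/
def collapseRel (K : OrderedComplex V) (T : SimpleGraph V) (n : ℕ)
    (σ τ : {σ : Fin (n + 1) → V // K.IsSeq σ}) : Prop :=
  σ = τ ∨ (InTree T σ.1 ∧ InTree T τ.1)

theorem collapseRel.comp {K : OrderedComplex V} {T : SimpleGraph V} {n m : ℕ}
    {σ τ : {σ : Fin (n + 1) → V // K.IsSeq σ}} (h : K.collapseRel T n σ τ)
    (g : Fin (m + 1) →o Fin (n + 1)) :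
    K.collapseRel T m ⟨σ.1 ∘ g, σ.2.comp g⟩ ⟨τ.1 ∘ g, τ.2.comp g⟩ := by
  rcases h with rfl | ⟨⟨v, w, h, h'⟩, ⟨v₁, w₁, h₁, h₁'⟩⟩
  · exact Or.inl rfl
  · exact Or.inr ⟨⟨v, w, h, fun i => h' _⟩, ⟨v₁, w₁, h₁, fun i => h₁' _⟩⟩

/-- The simplicial set `K^ss / T`. -/
def collapse (K : OrderedComplex V) (T : SimpleGraph V) : SSet.{0} where
  obj n := Quot (K.collapseRel T n.unop.len)
  map g := ↾Quot.map (fun σ => ⟨σ.1 ∘ g.unop.toOrderHom, σ.2.comp g.unop.toOrderHom⟩)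
    (fun _ _ h => h.comp g.unop.toOrderHom)
  map_id _ := by ext x; induction x using Quot.ind; rfl
  map_comp _ _ := by ext x; induction x using Quot.ind; rfl

/-- The projection `p : K^ss → K^ss / T`. -/
def proj (K : OrderedComplex V) (T : SimpleGraph V) : K.ss ⟶ K.collapse T where
  app n := ↾Quot.mk (K.collapseRel T n.unop.len)

end OrderedComplex

/-! ### Geometric realizations -/

/-- The geometric realization of a finite simplicial complex, in barycentric coordinates. -/
abbrev Realization {V : Type} [Fintype V] (K : AbstractSimplicialComplex V) : Type :=
  {y : V → ℝ // (∀ v, 0 ≤ y v) ∧ ∑ v, y v = 1 ∧ Finset.univ.filter (fun v => y v ≠ 0) ∈ K.faces}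

/-- Homotopy of maps into a space.  (The existence of `H` forces `g` and `h` to be continuous.) -/
def AreHomotopic {A B : Type} [TopologicalSpace A] [TopologicalSpace B] (g h : A → B) : Prop :=
  ∃ H : C(unitInterval × A, B), (∀ a, H (0, a) = g a) ∧ (∀ a, H (1, a) = h a)

/-- A map of vertices is simplicial if it takes simplices onto simplices. -/
def IsSimplicialMap {V W : Type} [DecidableEq W] (K : AbstractSimplicialComplex V)
    (L : AbstractSimplicialComplex W) (g : V → W) : Prop :=
  ∀ s ∈ K.faces, s.image g ∈ L.faces

/-- The map `|g| : |K| → |L|` that a simplicial map induces: the affine extension of `g`. -/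
noncomputable def Realization.map {V W : Type} [Fintype V] [Fintype W] [DecidableEq W]
    {K : AbstractSimplicialComplex V} {L : AbstractSimplicialComplex W} {g : V → W}
    (hg : IsSimplicialMap K L g) (y : Realization K) : Realization L :=
  ⟨fun w => ∑ v, if g v = w then y.1 v else 0, by
    have hnn : ∀ w v, 0 ≤ (if g v = w then y.1 v else 0) := fun w v => by
      split_ifs
      · exact y.2.1 v
      · exact le_rfl
    refine ⟨fun w => Finset.sum_nonneg fun v _ => hnn w v, ?_, ?_⟩
    · rw [Finset.sum_comm]
      simpa using y.2.2.1
    · convert hg _ y.2.2.2 using 1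
      ext w
      simp only [Finset.mem_filter, Finset.mem_univ, true_and, Finset.mem_image, ne_eq,
        Finset.sum_eq_zero_iff_of_nonneg (fun v _ => hnn w v)]
      push Not
      constructor
      · rintro ⟨v, _, hv⟩
        by_cases h : g v = w
        · exact ⟨v, by simpa [h] using hv, h⟩
        · simp [h] at hv
      · rintro ⟨v, hv, h⟩
        exact ⟨v, trivial, by simpa [h] using hv⟩⟩

/-- The point with barycentric coordinates `t` in the cell of `|S|` that belongs to the
`n`-simplex `σ` of the simplicial set `S`. -/
noncomputable def cellPoint {S : SSet.{0}} {n : ℕ} (σ : S.obj (Opposite.op (SimplexCategory.mk n)))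
    (t : stdSimplex ℝ (Fin (n + 1))) : SSet.toTop.obj S :=
  SSet.toTop.map (SSet.yonedaEquiv.symm σ)
    (SSet.toTopSimplex.inv.app (SimplexCategory.mk n) (ULift.up t))

namespace OrderedComplex

variable {V : Type} [DecidableEq V]

/-- The vertices of a simplex can be listed in increasing order. -/
theorem exists_enum (K : OrderedComplex V) {s : Finset V} (hs : s ∈ K.faces) :
    ∃ (n : ℕ) (σ : Fin (n + 1) → V),
      K.IsSeq σ ∧ Function.Injective σ ∧ Finset.univ.image σ = s := by
  classical
  have sub : ∀ t ⊆ s, t.Nonempty → t ∈ K.faces :=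
    fun t ht hne => (K.isRelLowerSet_faces hs).2 ht hne
  let lo : LinearOrder {v // v ∈ s} :=
    { le := fun v w => K.le v.1 w.1
      le_refl := fun v => by
        rcases K.le_total v.1 v.1 (sub _ (by simp) (by simp)) with h | h <;> exact h
      le_trans := fun u v w h h' => K.le_trans u.1 v.1 w.1
        (sub _ (by simp [Finset.insert_subset_iff]) (by simp)) h h'
      le_antisymm := fun v w h h' => Subtype.ext (K.le_antisymm v.1 w.1
        (sub _ (by simp [Finset.insert_subset_iff]) (by simp)) h h')
      le_total := fun v w => K.le_total v.1 w.1
        (sub _ (by simp [Finset.insert_subset_iff]) (by simp))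
      toDecidableLE := Classical.decRel _ }
  have hne : s.Nonempty := (K.isRelLowerSet_faces hs).1
  have hc : Fintype.card {v // v ∈ s} = (s.card - 1) + 1 := by
    have := hne.card_pos
    simp only [Fintype.card_coe]
    omega
  let e := Fintype.orderIsoFinOfCardEq {v // v ∈ s} hc
  have him : Finset.univ.image (fun i => (e i).1) = s := by
    ext v
    simp only [Finset.mem_image, Finset.mem_univ, true_and]
    constructor
    · rintro ⟨i, rfl⟩
      exact (e i).2
    · intro hv
      exact ⟨e.symm ⟨v, hv⟩, by simp⟩
  refine ⟨s.card - 1, fun i => (e i).1, ⟨by rw [him]; exact hs, ?_⟩, ?_, him⟩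
  · intro i j hij
    exact e.monotone hij
  · exact Subtype.val_injective.comp e.injective

/-- The identification `|K| = |K^ss|`: a point of `|K|` whose support is the simplex with vertices
`V_0 < … < V_n` goes to the point with the same barycentric coordinates in the cell of
`(V_0, …, V_n)`. -/
noncomputable def toSS [Fintype V] (K : OrderedComplex V)
    (y : Realization K.toAbstractSimplicialComplex) : SSet.toTop.obj K.ss :=
  let h := K.exists_enum y.2.2.2
  cellPoint (S := K.ss) (n := h.choose) ⟨h.choose_spec.choose, h.choose_spec.choose_spec.1⟩
    ⟨fun i => y.1 (h.choose_spec.choose i), fun i => y.2.1 _, by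
      have h2 := h.choose_spec.choose_spec.2
      rw [← Finset.sum_image (s := Finset.univ) (f := y.1) (fun i _ j _ hij => h2.1 hij), h2.2,
        Finset.sum_filter_ne_zero]
      exact y.2.2.1⟩

end OrderedComplex

/-! ### Edgewise subdivision -/

namespace OrderedComplex

variable {V : Type} [DecidableEq V] [Fintype V]

/-- The vertices of `Esd_k(K)`: nonnegative integer coordinates with sum `k`, supported on a
simplex of `K`. -/
abbrev EsdVertex (K : OrderedComplex V) (k : ℕ) : Type :=
  {x : V → ℕ // ∑ v, x v = k ∧ Finset.univ.filter (fun v => x v ≠ 0) ∈ K.faces}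

instance (K : OrderedComplex V) (k : ℕ) : Finite (K.EsdVertex k) := by
  have hb : ∀ (x : K.EsdVertex k) (v : V), x.1 v < k + 1 := fun x v => by
    have h := Finset.single_le_sum (f := x.1) (fun _ _ => Nat.zero_le _) (Finset.mem_univ v)
    have := x.2.1
    omega
  refine Finite.of_injective (β := V → Fin (k + 1)) (fun x v => ⟨x.1 v, hb x v⟩) ?_
  intro x y h
  refine Subtype.ext (funext fun v => ?_)
  simpa using congrFun h v

noncomputable instance (K : OrderedComplex V) (k : ℕ) : Fintype (K.EsdVertex k) :=
  Fintype.ofFinite _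

open Classical in
/-- The sum of the coordinates of `x` at the vertices up to `v`. -/
noncomputable def cumSum (K : OrderedComplex V) (x : V → ℕ) (v : V) : ℕ :=
  ∑ w, if K.le w v then x w else 0

/-- The vertices of `K` at which some element of `F` has a nonzero coordinate. -/
def carrier (K : OrderedComplex V) {k : ℕ} (F : Finset (K.EsdVertex k)) : Finset V :=
  F.biUnion fun x => Finset.univ.filter fun v => x.1 v ≠ 0

/-- The edgewise subdivision `Esd_k(K)`: vertices span a simplex if they lie in a common simplex
`v_0 < … < v_m` of `K` and for any two of them, `x` and `y`, the differences
`(y_0 + … + y_i) - (x_0 + … + x_i)` of the partial sums of the coordinates are either all in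
`{0, 1}` or all in `{0, -1}`. -/
noncomputable def esd (K : OrderedComplex V) (k : ℕ) :
    AbstractSimplicialComplex (K.EsdVertex k) where
  faces := {F | F.Nonempty ∧ K.carrier F ∈ K.faces ∧ ∀ x ∈ F, ∀ y ∈ F,
    (∀ v ∈ K.carrier F, K.cumSum x.1 v ≤ K.cumSum y.1 v ∧ K.cumSum y.1 v ≤ K.cumSum x.1 v + 1) ∨
    (∀ v ∈ K.carrier F, K.cumSum y.1 v ≤ K.cumSum x.1 v ∧ K.cumSum x.1 v ≤ K.cumSum y.1 v + 1)}
  isRelLowerSet_faces := by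
    rintro F ⟨hne, hF, hadj⟩
    refine ⟨hne, fun G hGF hG => ?_⟩
    have hsub : K.carrier G ⊆ K.carrier F := Finset.biUnion_subset_biUnion_of_subset_left _ hGF
    obtain ⟨x, hx⟩ := hG
    refine ⟨⟨x, hx⟩, (K.isRelLowerSet_faces hF).2 hsub ?_, fun x hx y hy => ?_⟩
    · obtain ⟨v, hv⟩ := (K.isRelLowerSet_faces x.2.2).1
      exact ⟨v, Finset.mem_biUnion.2 ⟨x, hx, hv⟩⟩
    · exact (hadj x (hGF hx) y (hGF hy)).imp (fun h v hv => h v (hsub hv))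
        (fun h v hv => h v (hsub hv))
  singleton_mem x := by
    refine ⟨Finset.singleton_nonempty x, ?_, ?_⟩
    · simpa [carrier] using x.2.2
    · intro y hy z hz
      rw [Finset.mem_singleton] at hy hz
      subst hy hz
      exact Or.inl fun v _ => ⟨le_rfl, Nat.le_succ _⟩

/-- The map `|Esd_k(K)| → |K|` that takes the vertex `x` to the point with barycentric coordinates
`x / k` and is affine on every simplex. -/
noncomputable def esdMap (K : OrderedComplex V) (k : ℕ) (y : Realization (K.esd k)) :
    Realization K.toAbstractSimplicialComplex :=
  ⟨fun v => ∑ x, y.1 x * ((x.1 v : ℝ) / k), by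
    have hnn : ∀ v, ∀ x : K.EsdVertex k, 0 ≤ y.1 x * ((x.1 v : ℝ) / k) := fun v x =>
      mul_nonneg (y.2.1 x) (by positivity)
    have hk : ∀ _ : K.EsdVertex k, (k : ℝ) ≠ 0 := fun x => by
      obtain ⟨v, hv⟩ := (K.isRelLowerSet_faces x.2.2).1
      have hv' : x.1 v ≠ 0 := (Finset.mem_filter.1 hv).2
      have h := Finset.single_le_sum (f := x.1) (fun _ _ => Nat.zero_le _) (Finset.mem_univ v)
      have h2 := x.2.1
      have : k ≠ 0 := by omega
      exact_mod_cast this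
    refine ⟨fun v => Finset.sum_nonneg fun x _ => hnn v x, ?_, ?_⟩
    · rw [Finset.sum_comm]
      refine Eq.trans (Finset.sum_congr rfl fun x _ => ?_) y.2.2.1
      rw [← Finset.mul_sum, ← Finset.sum_div, ← Nat.cast_sum, x.2.1, div_self (hk x), mul_one]
    · convert y.2.2.2.2.1 using 1
      ext v
      simp only [Finset.mem_filter, Finset.mem_univ, true_and, ne_eq, carrier, Finset.mem_biUnion,
        Finset.sum_eq_zero_iff_of_nonneg (fun x _ => hnn v x)]
      push Not
      refine exists_congr fun x => ?_
      have := hk x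
      simp [this]⟩

end OrderedComplex

/-! ### A machine model with a step count -/

/-- The data that programs work on: binary trees. -/
inductive Data : Type
  | nil : Data
  | cons : Data → Data → Data

namespace Data

/-- The number of nodes. -/
def size : Data → ℕ
  | nil => 1
  | cons a b => 1 + size a + size b

/-- Head and tail (`nil` has head and tail `nil`). -/
def hd : Data → Data
  | nil => nil
  | cons a _ => a

def tl : Data → Data
  | nil => nil
  | cons _ b => b

/-- Natural numbers in unary. -/
def ofNat : ℕ → Data
  | 0 => nil
  | n + 1 => cons nil (ofNat n)

/-- Lists, given a code for their entries. -/
def ofList {α : Type} (c : α → Data) : List α → Data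
  | [] => nil
  | a :: l => cons (c a) (ofList c l)

def ofPair {α β : Type} (c : α → Data) (c' : β → Data) (p : α × β) : Data :=
  cons (c p.1) (c' p.2)

def ofOption {α : Type} (c : α → Data) : Option α → Data
  | none => nil
  | some a => cons (c a) nil

/-- A vertex of a complex with vertices `0, …, n - 1`. -/
def ofFin {n : ℕ} (v : Fin n) : Data :=
  ofNat v.1

end Data

/-- Expressions over program variables `X_0, X_1, …`. -/
inductive Expr : Type
  | var : ℕ → Expr
  | nil : Expr
  | cons : Expr → Expr → Expr
  | hd : Expr → Expr
  | tl : Expr → Expr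

/-- Imperative programs: assignments, composition, conditionals and loops (`nil` is "false"). -/
inductive Prog : Type
  | assign : ℕ → Expr → Prog
  | seq : Prog → Prog → Prog
  | cond : ℕ → Prog → Prog → Prog
  | loop : ℕ → Prog → Prog

/-- The values of the program variables. -/
abbrev Store : Type := ℕ → Data

def Expr.eval (s : Store) : Expr → Data
  | var i => s i
  | nil => Data.nil
  | cons a b => Data.cons (a.eval s) (b.eval s)
  | hd a => (a.eval s).hd
  | tl a => (a.eval s).tl

/-- `Prog.Runs P s t s'`: started in the store `s`, the program `P` halts in the store `s'` after
`t` steps.  An assignment is charged for copying the whole value that it stores, a test counts as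
one step. -/
inductive Prog.Runs : Prog → Store → ℕ → Store → Prop
  | assign (i : ℕ) (e : Expr) (s : Store) :
      Runs (Prog.assign i e) s (1 + (e.eval s).size) (Function.update s i (e.eval s))
  | seq {P Q : Prog} {s s' s'' : Store} {t t' : ℕ} (h : Runs P s t s') (h' : Runs Q s' t' s'') :
      Runs (Prog.seq P Q) s (t + t') s''
  | cond_true {i : ℕ} {P Q : Prog} {s s' : Store} {t : ℕ} (hi : s i ≠ Data.nil)
      (h : Runs P s t s') : Runs (Prog.cond i P Q) s (1 + t) s'
  | cond_false {i : ℕ} {P Q : Prog} {s s' : Store} {t : ℕ} (hi : s i = Data.nil)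
      (h : Runs Q s t s') : Runs (Prog.cond i P Q) s (1 + t) s'
  | loop_true {i : ℕ} {P : Prog} {s s' s'' : Store} {t t' : ℕ} (hi : s i ≠ Data.nil)
      (h : Runs P s t s') (h' : Runs (Prog.loop i P) s' t' s'') :
      Runs (Prog.loop i P) s (1 + t + t') s''
  | loop_false {i : ℕ} {P : Prog} {s : Store} (hi : s i = Data.nil) :
      Runs (Prog.loop i P) s 1 s

/-- On the input `a`, the program halts with output `b` after at most `t` steps.  Input and output
are the value of `X_0`; all other variables are `nil` at the start. -/
def Prog.ComputesWithin (P : Prog) (a b : Data) (t : ℕ) : Prop :=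
  ∃ (t' : ℕ) (s : Store), t' ≤ t ∧
    P.Runs (Function.update (fun _ => Data.nil) 0 a) t' s ∧ s 0 = b

/-! ### Encodings of complexes, trees and maps -/

namespace OrderedComplex

/-- The list consists of the simplices of `K`, each as the list of its vertices in increasing
order. -/
def ListsSimplices {n : ℕ} (K : OrderedComplex (Fin n)) (L : List (List (Fin n))) : Prop :=
  ∀ l, l ∈ L ↔ ∃ (r : ℕ) (σ : Fin (r + 1) → Fin n),
    K.IsSeq σ ∧ Function.Injective σ ∧ l = List.ofFn σ

/-- The list consists of the edges of `T`, each in at least one direction. -/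
def ListsEdges {n : ℕ} (T : SimpleGraph (Fin n)) (L : List (Fin n × Fin n)) : Prop :=
  ∀ v w, T.Adj v w ↔ (v, w) ∈ L ∨ (w, v) ∈ L

open Classical in
/-- Representation of a simplex of `K^ss / T`: the degenerate base-points are represented by
`none`, any other simplex by the sequence of vertices of its lift to `K^ss`. -/
noncomputable def repr {n : ℕ} (K : OrderedComplex (Fin n)) (T : SimpleGraph (Fin n)) {r : ℕ}
    (x : (K.collapse T).obj (Opposite.op (SimplexCategory.mk r))) : Option (List (Fin n)) :=
  Quot.lift (r := K.collapseRel T r)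
    (fun σ => if InTree T σ.1 then none else some (List.ofFn σ.1))
    (by
      rintro σ τ (rfl | ⟨h, h'⟩)
      · rfl
      · simp [h, h']) x

/-- The list is the table of the values of `f` on the simplices of `S`. -/
def ListsMap {n m : ℕ} (K : OrderedComplex (Fin n)) (T : SimpleGraph (Fin n))
    (S : OrderedComplex (Fin m)) (f : S.ss ⟶ K.collapse T)
    (L : List (List (Fin m) × Option (List (Fin n)))) : Prop :=
  ∀ q, q ∈ L ↔ ∃ (r : ℕ) (σ : Fin (r + 1) → Fin m) (hσ : S.IsSeq σ), Function.Injective σ ∧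
    q = (List.ofFn σ,
      K.repr T (f.app (Opposite.op (SimplexCategory.mk r)) ⟨σ, hσ⟩))

/-- `a` is an encoding of the input: the complex `K` with vertices `0, …, n - 1`, the tree `T`, the
complex `S` with vertices `0, …, m - 1` and the map `f : S^ss → K^ss / T`. -/
def EncodesInput {n m : ℕ} (K : OrderedComplex (Fin n)) (T : SimpleGraph (Fin n))
    (S : OrderedComplex (Fin m)) (f : S.ss ⟶ K.collapse T) (a : Data) : Prop :=
  ∃ (LK : List (List (Fin n))) (LT : List (Fin n × Fin n)) (LS : List (List (Fin m)))
    (Lf : List (List (Fin m) × Option (List (Fin n)))),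
    K.ListsSimplices LK ∧ ListsEdges T LT ∧ S.ListsSimplices LS ∧ ListsMap K T S f Lf ∧
    a = .cons (.cons (.ofNat n) (.ofList (.ofList .ofFin) LK))
      (.cons (.ofList (.ofPair .ofFin .ofFin) LT)
        (.cons (.cons (.ofNat m) (.ofList (.ofList .ofFin) LS))
          (.ofList (.ofPair (.ofList .ofFin) (.ofOption (.ofList .ofFin))) Lf)))

/-- A vertex of the edgewise subdivision is encoded as the vector of its coordinates. -/
def EsdVertex.code {m k : ℕ} {S : OrderedComplex (Fin m)} (x : S.EsdVertex k) : Data :=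
  .ofList .ofNat (List.ofFn x.1)

/-- `b` is an encoding of the map `f'` from the vertices of `Esd_k(S)`: it consists of `k`, of the
list of all simplices of `Esd_k(S)`, and of the table of the values of `f'`. -/
def EncodesOutput {n m : ℕ} (S : OrderedComplex (Fin m)) (k : ℕ) (f' : S.EsdVertex k → Fin n)
    (b : Data) : Prop :=
  ∃ (LE : List (List (S.EsdVertex k))) (Lf : List (S.EsdVertex k × Fin n)),
    (∀ l ∈ LE, l.Nodup) ∧ (∀ F, F ∈ (S.esd k).faces ↔ ∃ l ∈ LE, l.toFinset = F) ∧
    (∀ x v, (x, v) ∈ Lf ↔ f' x = v) ∧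
    b = .cons (.ofNat k)
      (.cons (.ofList (.ofList EsdVertex.code) LE) (.ofList (.ofPair EsdVertex.code .ofFin) Lf))

end OrderedComplex

/-! ### Polynomial-time functions in the machine model -/

/-! The map `f'` is a simplicial approximation of `f` that also lifts values from `X` to `X^sc`. For
a vertex `x` of the subdivision let `j x` be a vertex of `Σ` at which `x` is maximal. It lies in the
support of `x`, so the affine extension of `j` is homotopic to the identification `esdMap` along
straight segments (`slide`). Hence it suffices to find `f'` such that `p ∘ f'` and `f ∘ j` agree on
realizations. On a simplex `G` of the subdivision this asks for the following (`IsApprox`): if `f`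
does not send the simplex `j(G)` to the base-point, `f'` is given by the unique lift of its image;
otherwise `f'(G)` has to stay in one edge of the tree.

The lift of `f` on the support of `x`, evaluated at `j x`, is a natural candidate for `f' x`, but
there is no lift if `f` sends the support to the base-point. The passage between the two situations
is made gradually. The tree is rooted at `0`, and `f' x` is the ancestor of the candidate at depth
`height x`. The height keeps level `t < n` if `Σ` has a simplex not sent to the base-point on which
all coordinates of `x` are within `2 * (n - t)` of the maximum. Coordinates of vertices of `G`
differ by at most one (`coord_le_add_one`), so three things hold. Heights on `G` differ by at most
one (`height_le`), and then the ancestors of the ends of a tree edge stay in one edge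
(`anc_mem_edge`). If `j(G)` is not sent to the base-point, the height is `n` on `G` and nothing is
truncated (`height_eq_top`). If the support of `x` is sent to the base-point, the height is `0` and
the missing lift does not matter (`height_eq_zero`); this needs a coordinate of size at least `2 * n
+ 2`, which `k = (d + 1) * (2 * n + 2)` provides. These facts combine in `isApprox_val`.

The subdivision map is a continuous bijection of compact Hausdorff spaces. It is injective because
the mean of a partial sum that takes two consecutive values determines the weights of the values. It
is surjective because rounding the partial sums of `k z` with a common random phase gives a random
vertex with mean `k z`, whose values span one simplex.

For fixed `d` the subdivision is listed by enumerating tuples of bounded length. The running time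
follows from closure properties of polynomial-time functions, the essential one being folding over a
list with polynomially bounded intermediate values (`PolyTime.foldl`). -/

theorem Polynomial.eval_le_eval_nat (p : Polynomial ℕ) {x y : ℕ} (h : x ≤ y) :
    p.eval x ≤ p.eval y := by
  rw [Polynomial.eval_eq_sum_range, Polynomial.eval_eq_sum_range]
  gcongr

theorem Data.one_le_size (a : Data) : 1 ≤ a.size := by
  cases a <;> simp only [Data.size] <;> omega

theorem Data.size_hd_le (a : Data) : a.hd.size ≤ a.size := by
  cases a <;> simp only [Data.size, Data.hd] <;> omega

theorem Data.size_tl_le (a : Data) : a.tl.size ≤ a.size := by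
  cases a <;> simp only [Data.size, Data.tl] <;> omega

/-- An assignment is charged for the whole value stored. With unit cost, repeated doubling would
create values of exponential size in linear time. -/
theorem Prog.Runs.size_le {P : Prog} {s s' : Store} {t : ℕ} (h : P.Runs s t s') (i : ℕ) :
    (s' i).size ≤ (s i).size + t := by
  induction h with
  | assign j e s =>
    by_cases hij : i = j
    · subst hij; simp; omega
    · simp [hij]
  | seq _ _ ih ih' => omega
  | cond_true _ _ ih => omega
  | cond_false _ _ ih => omega
  | loop_true _ _ _ ih ih' => omega
  | loop_false _ => omega

/-- The expression with all variables shifted by `N`. -/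
def Expr.shift (N : ℕ) : Expr → Expr
  | var i => var (N + i)
  | nil => nil
  | cons a b => cons (a.shift N) (b.shift N)
  | hd a => hd (a.shift N)
  | tl a => tl (a.shift N)

theorem Expr.eval_shift (N : ℕ) (s : Store) (e : Expr) :
    (e.shift N).eval s = e.eval (fun i => s (N + i)) := by
  induction e with
  | var i => rfl
  | nil => rfl
  | cons a b ha hb => simp only [shift, eval, ha, hb]
  | hd a ha => simp only [shift, eval, ha]
  | tl a ha => simp only [shift, eval, ha]

/-- Types whose elements are coded by data. -/
class Enc (α : Type) where
  enc : α → Data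

open Enc (enc)

instance : Enc Unit := ⟨fun _ => Data.nil⟩
instance : Enc ℕ := ⟨Data.ofNat⟩
instance : Enc Bool := ⟨fun b => bif b then Data.cons Data.nil Data.nil else Data.nil⟩
instance {α : Type} [Enc α] : Enc (List α) := ⟨Data.ofList enc⟩
instance {α : Type} [Enc α] : Enc (Option α) := ⟨Data.ofOption enc⟩
instance {α β : Type} [Enc α] [Enc β] : Enc (α × β) := ⟨Data.ofPair enc enc⟩

/-- The size of the code of an element. -/
def Enc.sz {α : Type} [Enc α] (a : α) : ℕ := (enc a).size

open Enc (sz)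

/-- `f` is computed in polynomial time, by a program that works on the registers from `N` on. -/
def PolyTime {α β : Type} [Enc α] [Enc β] (f : α → β) : Prop :=
  ∃ (P : ℕ → Prog) (p : Polynomial ℕ), ∀ (a : α) (N : ℕ) (s : Store), s N = enc a →
    (∀ j, N < j → s j = Data.nil) →
    ∃ t, t ≤ p.eval (sz a) ∧ (P N).Runs s t (Function.update s N (enc (f a)))

namespace PolyTime

variable {α β γ δ : Type} [Enc α] [Enc β] [Enc γ] [Enc δ]

/-- Needed to bound the second stage of a composition in terms of the original input. -/
theorem size_le {f : α → β} (hf : PolyTime f) :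
    ∃ p : Polynomial ℕ, ∀ a, sz (f a) ≤ p.eval (sz a) := by
  obtain ⟨P, p, h⟩ := hf
  refine ⟨Polynomial.X + p, fun a => ?_⟩
  obtain ⟨t, ht, hr⟩ := h a 0 (Function.update (fun _ => Data.nil) 0 (enc a)) (by simp)
    (fun j hj => by simp [hj.ne'])
  have := hr.size_le 0
  simp only [Function.update_self] at this
  simp only [Polynomial.eval_add, Polynomial.eval_X, sz] at *
  omega

/-- Only the codes of the values matter. -/
theorem of_enc_eq {f : α → β} {g : α → γ} (hf : PolyTime f) (h : ∀ a, enc (g a) = enc (f a)) :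
    PolyTime g := by
  obtain ⟨P, p, hP⟩ := hf
  exact ⟨P, p, fun a N s => by rw [h]; exact hP a N s⟩

theorem of_expr {f : α → β} (e : Expr) (p : Polynomial ℕ) (hp : ∀ a, sz (f a) ≤ p.eval (sz a))
    (he : ∀ a s, s 0 = enc a → e.eval s = enc (f a)) : PolyTime f := by
  refine ⟨fun N => .assign N (e.shift N), 1 + p, fun a N s hN _ => ⟨1 + sz (f a), ?_, ?_⟩⟩
  · simpa using hp a
  · have := Prog.Runs.assign N (e.shift N) s
    rwa [Expr.eval_shift, he a _ (by simpa using hN)] at this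

theorem id' : PolyTime (fun a : α => a) :=
  of_expr (.var 0) Polynomial.X (fun a => by simp) (fun a s h => h)

theorem const (b : β) : PolyTime (fun _ : α => b) := by
  have : ∀ c : Data, ∃ e : Expr, ∀ s, e.eval s = c := fun c => by
    induction c with
    | nil => exact ⟨.nil, fun _ => rfl⟩
    | cons a b ha hb =>
      obtain ⟨e, he⟩ := ha
      obtain ⟨e', he'⟩ := hb
      exact ⟨.cons e e', fun s => by simp only [Expr.eval, he, he']⟩
  obtain ⟨e, he⟩ := this (enc b)
  exact of_expr e (Polynomial.C (sz b)) (fun a => by simp) (fun a s _ => he s)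

theorem comp {g : β → γ} {f : α → β} (hg : PolyTime g) (hf : PolyTime f) :
    PolyTime (fun a => g (f a)) := by
  obtain ⟨r, hr⟩ := hf.size_le
  obtain ⟨P, p, hP⟩ := hf
  obtain ⟨Q, q, hQ⟩ := hg
  refine ⟨fun N => .seq (P N) (Q N), p + q.comp r, fun a N s hN hs => ?_⟩
  obtain ⟨t, ht, h⟩ := hP a N s hN hs
  obtain ⟨t', ht', h'⟩ := hQ (f a) N (Function.update s N (enc (f a))) (by simp)
    (fun j hj => by simpa [hj.ne'] using hs j hj)
  refine ⟨t + t', ?_, ?_⟩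
  · have := q.eval_le_eval_nat (hr a)
    simp only [Polynomial.eval_add, Polynomial.eval_comp]
    omega
  · simpa using h.seq h'

theorem sz_pair (a : α) (b : β) : sz (a, b) = 1 + sz a + sz b := rfl

theorem one_le_sz (a : α) : 1 ≤ sz a := Data.one_le_size _

/-- `g` runs first, in register `N + 1`, because its result then lies below the registers that `f`,
run in `N + 2`, needs to find empty. Both scratch registers are cleared so that the final store
differs from `s` only at `N`. -/
theorem pair {f : α → β} {g : α → γ} (hf : PolyTime f) (hg : PolyTime g) :
    PolyTime (fun a => (f a, g a)) := by
  obtain ⟨p', hp'⟩ := hf.size_le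
  obtain ⟨q', hq'⟩ := hg.size_le
  obtain ⟨P, p, hP⟩ := hf
  obtain ⟨Q, q, hQ⟩ := hg
  refine ⟨fun N => .seq (.assign (N + 1) (.var N)) (.seq (Q (N + 1)) (.seq
    (.assign (N + 2) (.var N)) (.seq (P (N + 2)) (.seq
      (.assign N (.cons (.var (N + 2)) (.var (N + 1)))) (.seq (.assign (N + 1) .nil)
        (.assign (N + 2) .nil)))))),
    8 + p + q + p' + q' + 2 * Polynomial.X, fun a N s hN hs => ?_⟩
  let s1 := Function.update s (N + 1) (enc a)
  let s2 := Function.update s1 (N + 1) (enc (g a))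
  let s3 := Function.update s2 (N + 2) (enc a)
  let s4 := Function.update s3 (N + 2) (enc (f a))
  let s5 := Function.update s4 N (enc (f a, g a))
  let s6 := Function.update s5 (N + 1) Data.nil
  let s7 := Function.update s6 (N + 2) Data.nil
  have h1 : (Prog.assign (N + 1) (.var N)).Runs s (1 + sz a) s1 := by
    have := Prog.Runs.assign (N + 1) (.var N) s
    simp only [Expr.eval, hN] at this
    exact this
  obtain ⟨t2, ht2, h2⟩ := hQ a (N + 1) s1 (by simp [s1])
    (fun j hj => by
      have : j ≠ N + 1 := by omega
      simpa [s1, this] using hs j (by omega))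
  have h3 : (Prog.assign (N + 2) (.var N)).Runs s2 (1 + sz a) s3 := by
    have := Prog.Runs.assign (N + 2) (.var N) s2
    have hh : s2 N = enc a := by simp [s2, s1, hN]
    simp only [Expr.eval, hh] at this
    exact this
  obtain ⟨t4, ht4, h4⟩ := hP a (N + 2) s3 (by simp [s3])
    (fun j hj => by
      have h1 : j ≠ N + 1 := by omega
      have h2 : j ≠ N + 2 := by omega
      simpa [s3, s2, s1, h1, h2] using hs j (by omega))
  have h5 : (Prog.assign N (.cons (.var (N + 2)) (.var (N + 1)))).Runs s4 (1 + sz (f a, g a)) s5 := by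
    have := Prog.Runs.assign N (.cons (.var (N + 2)) (.var (N + 1))) s4
    have hh : s4 (N + 2) = enc (f a) := by simp [s4]
    have hh' : s4 (N + 1) = enc (g a) := by simp [s4, s3, s2]
    simp only [Expr.eval, hh, hh'] at this
    exact this
  have h6 : (Prog.assign (N + 1) .nil).Runs s5 2 s6 := Prog.Runs.assign (N + 1) .nil s5
  have h7 : (Prog.assign (N + 2) .nil).Runs s6 2 s7 := Prog.Runs.assign (N + 2) .nil s6
  have key := h1.seq (h2.seq (h3.seq (h4.seq (h5.seq (h6.seq h7)))))
  have hend : s7 = Function.update s N (enc (f a, g a)) := by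
    funext j
    by_cases e1 : j = N + 1
    · subst e1; simp [s7, s6, hs]
    by_cases e2 : j = N + 2
    · subst e2; simp [s7, hs]
    by_cases e0 : j = N
    · subst e0; simp [s7, s6, s5]
    simp [s7, s6, s5, s4, s3, s2, s1, e0, e1, e2]
  rw [hend] at key
  refine ⟨_, ?_, key⟩
  have a1 := hp' a
  have a2 := hq' a
  rw [sz_pair]
  simp only [Polynomial.eval_add, Polynomial.eval_mul, Polynomial.eval_X, Polynomial.eval_ofNat]
  omega

theorem ite_nil {c : α → γ} {f g : α → β} (hc : PolyTime c) (hf : PolyTime f) (hg : PolyTime g)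
    [∀ a, Decidable (enc (c a) = Data.nil)] :
    PolyTime (fun a => if enc (c a) = Data.nil then f a else g a) := by
  obtain ⟨P, p, hP⟩ := hf
  obtain ⟨Q, q, hQ⟩ := hg
  obtain ⟨R, r, hR⟩ := hc
  refine ⟨fun N => .seq (.assign (N + 1) (.var N)) (.seq (R (N + 1))
    (.cond (N + 1) (.seq (.assign (N + 1) .nil) (Q N)) (.seq (.assign (N + 1) .nil) (P N)))),
    4 + p + q + r + Polynomial.X, fun a N s hN hs => ?_⟩
  let s1 := Function.update s (N + 1) (enc a)
  let s2 := Function.update s1 (N + 1) (enc (c a))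
  have h1 : (Prog.assign (N + 1) (.var N)).Runs s (1 + sz a) s1 := by
    have := Prog.Runs.assign (N + 1) (.var N) s
    simp only [Expr.eval, hN] at this
    exact this
  obtain ⟨t2, ht2, h2⟩ := hR a (N + 1) s1 (by simp [s1])
    (fun j hj => by
      have : j ≠ N + 1 := by omega
      simpa [s1, this] using hs j (by omega))
  -- The tested register is cleared inside the branches, since the branch programs expect everything
  -- beyond `N` to be `nil`.
  have h3 : (Prog.assign (N + 1) .nil).Runs s2 2 s := by
    have := Prog.Runs.assign (N + 1) .nil s2
    have hh : Function.update s2 (N + 1) (Expr.nil.eval s2) = s := by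
      funext j
      by_cases e1 : j = N + 1
      · subst e1; simp [Expr.eval, hs]
      simp [s2, s1, e1]
    rwa [hh] at this
  have hs2 : s2 (N + 1) = enc (c a) := by simp [s2]
  simp only [Polynomial.eval_add, Polynomial.eval_X, Polynomial.eval_ofNat]
  by_cases hn : enc (c a) = Data.nil
  · obtain ⟨t, ht, h4⟩ := hP a N s hN hs
    refine ⟨_, ?_, h1.seq (h2.seq (Prog.Runs.cond_false (t := 2 + t) (hs2.trans hn) (h3.seq ?_)))⟩
    · omega
    · simpa [hn] using h4
  · obtain ⟨t, ht, h4⟩ := hQ a N s hN hs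
    refine ⟨_, ?_, h1.seq (h2.seq (Prog.Runs.cond_true (t := 2 + t)
      (fun h => hn (hs2.symm.trans h)) (h3.seq ?_)))⟩
    · omega
    · simpa [hn] using h4

theorem sz_cons (a : α) (l : List α) : sz (a :: l) = 1 + sz a + sz l := rfl

theorem sz_nil : sz ([] : List α) = 1 := rfl

/-- Loops over a list whose accumulated values stay polynomially bounded. -/
theorem foldl_aux {g : β × γ × δ → γ} (hg : PolyTime g)
    (b : Polynomial ℕ) :
    ∃ (P : ℕ → Prog) (p : Polynomial ℕ), ∀ (l : List β) (c : γ) (x : δ) (N : ℕ) (s : Store),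
      s N = enc (l, c, x) → (∀ j, N < j → s j = Data.nil) →
      (∀ l' : List β, l' <+: l →
        sz (l'.foldl (fun c b => g (b, c, x)) c) ≤ b.eval (sz (l, c, x))) →
      ∃ t, t ≤ p.eval (sz (l, c, x)) ∧
        (P N).Runs s t (Function.update s N (enc (l.foldl (fun c b => g (b, c, x)) c))) := by
  obtain ⟨Q, q, hQ⟩ := hg
  let body : ℕ → Prog := fun N =>
    .seq (.assign (N + 3) (.cons (.hd (.var N)) (.cons (.var (N + 1)) (.var (N + 2)))))
      (.seq (Q (N + 3)) (.seq (.assign (N + 1) (.var (N + 3)))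
        (.seq (.assign (N + 3) .nil) (.assign N (.tl (.var N))))))
  -- Register `N` holds the rest of the list, `N + 1` the accumulator, `N + 2` the parameter, and `N
  -- + 3` is scratch. `M` bounds the list and the parameter together, `B` every accumulated value;
  -- the factor of `l.length` bounds one pass.
  have loop : ∀ (x : δ) (N M B : ℕ) (l : List β) (c : γ) (s : Store),
      s N = enc l → s (N + 1) = enc c → s (N + 2) = enc x → (∀ j, N + 2 < j → s j = Data.nil) →
      sz l + sz x ≤ M →
      (∀ l' : List β, l' <+: l → sz (l'.foldl (fun c b => g (b, c, x)) c) ≤ B) →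
      ∃ t, t ≤ 1 + l.length * (8 + 2 * M + 2 * B + q.eval (2 + M + B)) ∧
        (Prog.loop N (body N)).Runs s t (Function.update (Function.update s (N + 1)
          (enc (l.foldl (fun c b => g (b, c, x)) c))) N Data.nil) := by
    intro x N M B l
    induction l with
    | nil =>
      intro c s h0 h1 h2 h3 hM hB
      refine ⟨1, by simp, ?_⟩
      have : Function.update (Function.update s (N + 1)
          (enc (([] : List β).foldl (fun c b => g (b, c, x)) c))) N Data.nil = s := by
        have h0' : s N = Data.nil := h0
        funext j
        by_cases e0 : j = N
        · subst e0; simp [h0']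
        by_cases e1 : j = N + 1
        · subst e1; simp [h1]
        simp [e0, e1]
      rw [this]
      exact Prog.Runs.loop_false h0
    | cons y l ih =>
      intro c s h0 h1 h2 h3 hM hB
      have h0' : s N = Data.cons (enc y) (enc l) := h0
      let s1 := Function.update s (N + 3) (enc (y, c, x))
      let c' := g (y, c, x)
      let s2 := Function.update s1 (N + 3) (enc c')
      let s3 := Function.update s2 (N + 1) (enc c')
      let s4 := Function.update s3 (N + 3) Data.nil
      let s5 := Function.update s4 N (enc l)
      have hc : sz c ≤ B := hB [] List.nil_prefix
      have hc' : sz c' ≤ B := hB [y] (by simp)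
      have r1 : (Prog.assign (N + 3) (.cons (.hd (.var N)) (.cons (.var (N + 1))
          (.var (N + 2))))).Runs s (1 + sz (y, c, x)) s1 := by
        have := Prog.Runs.assign (N + 3) (.cons (.hd (.var N)) (.cons (.var (N + 1))
          (.var (N + 2)))) s
        simp only [Expr.eval, h0', h1, h2, Data.hd] at this
        exact this
      obtain ⟨t2, ht2, r2⟩ := hQ (y, c, x) (N + 3) s1 (by simp [s1]) (fun j hj => by
        have : j ≠ N + 3 := by omega
        simpa [s1, this] using h3 j (by omega))
      have r3 : (Prog.assign (N + 1) (.var (N + 3))).Runs s2 (1 + sz c') s3 := by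
        have := Prog.Runs.assign (N + 1) (.var (N + 3)) s2
        have hh : s2 (N + 3) = enc c' := by simp [s2]
        simp only [Expr.eval, hh] at this
        exact this
      have r4 : (Prog.assign (N + 3) .nil).Runs s3 2 s4 := Prog.Runs.assign (N + 3) .nil s3
      have r5 : (Prog.assign N (.tl (.var N))).Runs s4 (1 + sz l) s5 := by
        have := Prog.Runs.assign N (.tl (.var N)) s4
        have hh : s4 N = Data.cons (enc y) (enc l) := by simp [s4, s3, s2, s1, h0']
        simp only [Expr.eval, hh, Data.tl] at this
        exact this
      rw [sz_cons] at hM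
      obtain ⟨t6, ht6, r6⟩ := ih c' s5 (by simp [s5]) (by simp [s5, s4, s3])
        (by simp [s5, s4, s3, s2, s1, h2])
        (fun j hj => by
          by_cases e3 : j = N + 3
          · subst e3; simp [s5, s4]
          have e0 : j ≠ N := by omega
          have e1 : j ≠ N + 1 := by omega
          simpa [s5, s4, s3, s2, s1, e0, e1, e3] using h3 j hj)
        (by omega)
        (fun l' hl' => by simpa using hB (y :: l') (by simpa using hl'))
      have key := Prog.Runs.loop_true (P := body N) (by simp [h0'] : s N ≠ Data.nil)
        (r1.seq (r2.seq (r3.seq (r4.seq r5)))) r6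
      have hend : Function.update (Function.update s5 (N + 1)
          (enc (l.foldl (fun c b => g (b, c, x)) c'))) N Data.nil =
          Function.update (Function.update s (N + 1)
          (enc ((y :: l).foldl (fun c b => g (b, c, x)) c))) N Data.nil := by
        funext j
        by_cases e0 : j = N
        · subst e0; simp
        by_cases e1 : j = N + 1
        · subst e1; simp [c']
        by_cases e3 : j = N + 3
        · subst e3; simp [s5, s4, h3]
        simp [e0, e1, e3, s5, s4, s3, s2, s1]
      rw [hend] at key
      refine ⟨_, ?_, key⟩
      have e1 : q.eval (sz (y, c, x)) ≤ q.eval (2 + M + B) :=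
        q.eval_le_eval_nat (by simp only [sz_pair]; omega)
      simp only [sz_pair, List.length_cons, Nat.add_mul, Nat.one_mul] at *
      omega
  refine ⟨fun N => .seq (.assign (N + 2) (.tl (.tl (.var N)))) (.seq
    (.assign (N + 1) (.hd (.tl (.var N)))) (.seq (.assign N (.hd (.var N))) (.seq
    (.loop N (body N)) (.seq (.assign N (.var (N + 1))) (.seq (.assign (N + 1) .nil)
      (.assign (N + 2) .nil)))))),
    9 + 3 * Polynomial.X + b + Polynomial.X * (8 + 2 * Polynomial.X + 2 * b +
      q.comp (2 + Polynomial.X + b)), fun l c x N s hN hs hb => ?_⟩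
  have hN' : s N = Data.cons (enc l) (Data.cons (enc c) (enc x)) := hN
  let s1 := Function.update s (N + 2) (enc x)
  let s2 := Function.update s1 (N + 1) (enc c)
  let s3 := Function.update s2 N (enc l)
  have r1 : (Prog.assign (N + 2) (.tl (.tl (.var N)))).Runs s (1 + sz x) s1 := by
    have := Prog.Runs.assign (N + 2) (.tl (.tl (.var N))) s
    simp only [Expr.eval, hN', Data.tl] at this
    exact this
  have r2 : (Prog.assign (N + 1) (.hd (.tl (.var N)))).Runs s1 (1 + sz c) s2 := by
    have := Prog.Runs.assign (N + 1) (.hd (.tl (.var N))) s1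
    have hh : s1 N = Data.cons (enc l) (Data.cons (enc c) (enc x)) := by simp [s1, hN']
    simp only [Expr.eval, hh, Data.tl, Data.hd] at this
    exact this
  have r3 : (Prog.assign N (.hd (.var N))).Runs s2 (1 + sz l) s3 := by
    have := Prog.Runs.assign N (.hd (.var N)) s2
    have hh : s2 N = Data.cons (enc l) (Data.cons (enc c) (enc x)) := by simp [s2, s1, hN']
    simp only [Expr.eval, hh, Data.hd] at this
    exact this
  obtain ⟨t4, ht4, r4⟩ := loop x N (sz l + sz x) (b.eval (sz (l, c, x))) l c s3 (by simp [s3])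
    (by simp [s3, s2]) (by simp [s3, s2, s1])
    (fun j hj => by
      have e0 : j ≠ N := by omega
      have e1 : j ≠ N + 1 := by omega
      have e2 : j ≠ N + 2 := by omega
      simpa [s3, s2, s1, e0, e1, e2] using hs j (by omega)) le_rfl hb
  set r := l.foldl (fun c b => g (b, c, x)) c with hr
  let s4 := Function.update (Function.update s3 (N + 1) (enc r)) N Data.nil
  let s5 := Function.update s4 N (enc r)
  let s6 := Function.update s5 (N + 1) Data.nil
  let s7 := Function.update s6 (N + 2) Data.nil
  have r5 : (Prog.assign N (.var (N + 1))).Runs s4 (1 + sz r) s5 := by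
    have := Prog.Runs.assign N (.var (N + 1)) s4
    have hh : s4 (N + 1) = enc r := by simp [s4]
    simp only [Expr.eval, hh] at this
    exact this
  have r6 : (Prog.assign (N + 1) .nil).Runs s5 2 s6 := Prog.Runs.assign (N + 1) .nil s5
  have r7 : (Prog.assign (N + 2) .nil).Runs s6 2 s7 := Prog.Runs.assign (N + 2) .nil s6
  have key := r1.seq (r2.seq (r3.seq (r4.seq (r5.seq (r6.seq r7)))))
  have hend : s7 = Function.update s N (enc r) := by
    funext j
    by_cases e1 : j = N + 1
    · subst e1; simp [s7, s6, hs]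
    by_cases e2 : j = N + 2
    · subst e2; simp [s7, hs]
    by_cases e0 : j = N
    · subst e0; simp [s7, s6, s5]
    simp [s7, s6, s5, s4, s3, s2, s1, e0, e1, e2]
  rw [hend] at key
  refine ⟨_, ?_, key⟩
  have hsr : sz r ≤ b.eval (sz (l, c, x)) := hb l List.prefix_rfl
  have hlen : ∀ l : List β, l.length ≤ sz l := fun l => by
    induction l with
    | nil => simp
    | cons a l ih => rw [sz_cons, List.length_cons]; omega
  have hle : sz l + sz x ≤ sz (l, c, x) := by simp only [sz_pair]; omega
  have hc : sz c ≤ sz (l, c, x) := by simp only [sz_pair]; omega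
  have hm : l.length * (8 + 2 * (sz l + sz x) + 2 * b.eval (sz (l, c, x)) +
      q.eval (2 + (sz l + sz x) + b.eval (sz (l, c, x)))) ≤
      sz (l, c, x) * (8 + 2 * sz (l, c, x) + 2 * b.eval (sz (l, c, x)) +
      q.eval (2 + sz (l, c, x) + b.eval (sz (l, c, x)))) := by
    apply Nat.mul_le_mul ((hlen l).trans (by omega))
    have := q.eval_le_eval_nat (show 2 + (sz l + sz x) + b.eval (sz (l, c, x)) ≤
      2 + sz (l, c, x) + b.eval (sz (l, c, x)) by omega)
    omega
  simp only [Polynomial.eval_add, Polynomial.eval_mul, Polynomial.eval_X, Polynomial.eval_ofNat,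
    Polynomial.eval_comp]
  omega

end PolyTime

/-! ### Polynomial-time list operations and unary arithmetic -/

namespace PolyTime

variable {α β γ δ : Type} [Enc α] [Enc β] [Enc γ] [Enc δ]

theorem length_le_sz (l : List β) : l.length ≤ sz l := by
  induction l with
  | nil => simp
  | cons a l ih => rw [sz_cons, List.length_cons]; omega

/-- The summand `1` accounts for the terminal `nil` of `l`, which concatenation removes. -/
theorem sz_append (l l' : List β) : sz (l ++ l') + 1 = sz l + sz l' := by
  induction l with
  | nil => simp [sz_nil]; omega
  | cons a l ih => rw [List.cons_append, sz_cons, sz_cons]; omega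

theorem sz_reverse (l : List β) : sz l.reverse = sz l := by
  induction l with
  | nil => rfl
  | cons a l ih =>
    have := sz_append l.reverse [a]
    rw [List.reverse_cons, sz_cons]
    rw [sz_cons, sz_nil] at this
    omega

theorem sz_le_of_mem {l : List β} {b : β} (h : b ∈ l) : sz b ≤ sz l := by
  induction l with
  | nil => simp at h
  | cons a l ih =>
    rw [sz_cons]
    rcases List.mem_cons.1 h with rfl | h
    · omega
    · have := ih h; omega

theorem sz_le_of_prefix {l l' : List β} (h : l' <+: l) : sz l' ≤ sz l := by
  obtain ⟨r, rfl⟩ := h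
  have := sz_append l' r
  have := one_le_sz r
  omega

theorem sz_le_of_forall {l : List β} {M : ℕ} (h : ∀ b ∈ l, sz b ≤ M) :
    sz l ≤ 1 + l.length * (1 + M) := by
  induction l with
  | nil => simp [sz_nil]
  | cons a l ih =>
    have h1 := ih fun b hb => h b (List.mem_cons_of_mem _ hb)
    have h2 := h a List.mem_cons_self
    rw [sz_cons, List.length_cons, Nat.succ_mul]
    omega

theorem sz_nat (n : ℕ) : sz n = 2 * n + 1 := by
  induction n with
  | zero => rfl
  | succ n ih =>
    have : sz (n + 1) = 1 + 1 + sz n := rfl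
    omega

theorem fst {f : α → β × γ} (hf : PolyTime f) : PolyTime (fun a => (f a).1) :=
  comp (g := Prod.fst) (of_expr (.hd (.var 0)) Polynomial.X
    (fun a => by rw [Polynomial.eval_X]; exact Data.size_hd_le (enc a))
    (fun a s h => by simp only [Expr.eval, h]; rfl)) hf

theorem snd {f : α → β × γ} (hf : PolyTime f) : PolyTime (fun a => (f a).2) :=
  comp (g := Prod.snd) (of_expr (.tl (.var 0)) Polynomial.X
    (fun a => by rw [Polynomial.eval_X]; exact Data.size_tl_le (enc a))
    (fun a s h => by simp only [Expr.eval, h]; rfl)) hf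

theorem cons {f : α → β} {g : α → List β} (hf : PolyTime f) (hg : PolyTime g) :
    PolyTime (fun a => f a :: g a) :=
  (hf.pair hg).of_enc_eq fun _ => rfl

theorem tail {f : α → List β} (hf : PolyTime f) : PolyTime (fun a => (f a).tail) :=
  comp (of_expr (.tl (.var 0)) Polynomial.X
    (fun a => by
      rw [Polynomial.eval_X]
      cases a with
      | nil => exact le_rfl
      | cons a l => rw [sz_cons, List.tail_cons]; omega)
    (fun a s h => by simp only [Expr.eval, h]; cases a <;> rfl)) hf

/-- `Data.hd` returns `nil` on `nil`, so only a default value with code `nil` comes for free. -/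
theorem headD {f : α → List β} (hf : PolyTime f) {b : β} (hb : enc b = Data.nil) :
    PolyTime (fun a => (f a).headD b) :=
  comp (g := fun l : List β => l.headD b) (of_expr (.hd (.var 0)) Polynomial.X
    (fun a => by
      rw [Polynomial.eval_X]
      cases a with
      | nil => exact (congrArg Data.size hb).le
      | cons a l => rw [sz_cons, List.headD_cons]; omega)
    (fun a s h => by
      simp only [Expr.eval, h]
      cases a with
      | nil => exact hb.symm
      | cons a l => rfl)) hf

theorem getDOption {f : α → Option β} (hf : PolyTime f) {b : β} (hb : enc b = Data.nil) :
    PolyTime (fun a => (f a).getD b) :=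
  comp (g := fun o : Option β => o.getD b) (of_expr (.hd (.var 0)) Polynomial.X
    (fun a => by
      rw [Polynomial.eval_X]
      cases a with
      | none => exact (congrArg Data.size hb).le
      | some a => exact Data.size_hd_le (Data.cons (enc a) Data.nil))
    (fun a s h => by
      simp only [Expr.eval, h]
      cases a with
      | none => exact hb.symm
      | some a => rfl)) hf

theorem cond {c : α → Bool} {f g : α → β} (hc : PolyTime c) (hf : PolyTime f) (hg : PolyTime g) :
    PolyTime (fun a => if c a then f a else g a) := by
  classical
  -- `false` is coded by `nil`, hence the exchange of the branches.
  refine (ite_nil hc hg hf).of_enc_eq fun a => ?_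
  cases h : c a <;> simp [enc]

theorem isSome {f : α → Option β} (hf : PolyTime f) : PolyTime (fun a => (f a).isSome) := by
  classical
  refine (ite_nil hf (const false) (const true)).of_enc_eq fun a => ?_
  cases h : f a <;> simp [enc, Data.ofOption]

theorem isEmpty {f : α → List β} (hf : PolyTime f) : PolyTime (fun a => (f a).isEmpty) := by
  classical
  refine (ite_nil hf (const true) (const false)).of_enc_eq fun a => ?_
  cases h : f a <;> simp [enc, Data.ofList]

theorem not {f : α → Bool} (hf : PolyTime f) : PolyTime (fun a => !(f a)) :=
  (cond hf (const false) (const true)).of_enc_eq fun a => by cases f a <;> rfl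

theorem and {f g : α → Bool} (hf : PolyTime f) (hg : PolyTime g) :
    PolyTime (fun a => f a && g a) :=
  (cond hf hg (const false)).of_enc_eq fun a => by cases f a <;> rfl

theorem or {f g : α → Bool} (hf : PolyTime f) (hg : PolyTime g) :
    PolyTime (fun a => f a || g a) :=
  (cond hf (const true) hg).of_enc_eq fun a => by cases f a <;> rfl

/-- The bound at every prefix is essential: a polynomial-time step may double the size of the
accumulator, which would grow exponentially along the list. -/
theorem foldl {l : α → List β} {c : α → γ} {g : α → γ → β → γ} (hl : PolyTime l)
    (hc : PolyTime c) (hg : PolyTime fun p : α × γ × β => g p.1 p.2.1 p.2.2)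
    (hb : ∃ b : Polynomial ℕ, ∀ a, ∀ l' : List β, l' <+: l a →
      sz (l'.foldl (g a) (c a)) ≤ b.eval (sz a)) :
    PolyTime (fun a => (l a).foldl (g a) (c a)) := by
  obtain ⟨b, hb⟩ := hb
  have hg' : PolyTime fun p : β × γ × α => g p.2.2 p.2.1 p.1 :=
    hg.comp ((id'.snd.snd).pair ((id'.snd.fst).pair id'.fst))
  have hin : PolyTime fun a => (l a, c a, a) := hl.pair (hc.pair id')
  obtain ⟨P, p, hP⟩ := foldl_aux hg' b
  obtain ⟨r, hr⟩ := hin.size_le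
  obtain ⟨Q, q, hQ⟩ := hin
  refine ⟨fun N => .seq (Q N) (P N), q + p.comp r, fun a N s hN hs => ?_⟩
  obtain ⟨t, ht, h⟩ := hQ a N s hN hs
  obtain ⟨t', ht', h'⟩ := hP (l a) (c a) a N (Function.update s N (enc (l a, c a, a))) (by simp)
    (fun j hj => by simpa [hj.ne'] using hs j hj)
    (fun l' hl' => (hb a l' hl').trans (b.eval_le_eval_nat (by simp only [sz_pair]; omega)))
  refine ⟨t + t', ?_, ?_⟩
  · have := p.eval_le_eval_nat (hr a)
    simp only [Polynomial.eval_add, Polynomial.eval_comp]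
    omega
  · simpa using h.seq h'

/-- Pushing entries one by one reverses a list; reversal and concatenation are both obtained from
this single fold. -/
theorem reverseAppend {f g : α → List β} (hf : PolyTime f) (hg : PolyTime g) :
    PolyTime (fun a => (f a).reverse ++ g a) := by
  have key : ∀ (l m : List β), l.foldl (fun acc b => b :: acc) m = l.reverse ++ m := fun l => by
    induction l with
    | nil => simp
    | cons a l ih => simp [ih]
  have h : PolyTime (fun p : List β × List β => p.1.foldl (fun acc b => b :: acc) p.2) := by
    refine foldl (g := fun _ acc b => b :: acc) id'.fst id'.snd
      (cons id'.snd.snd id'.snd.fst) ⟨Polynomial.X, fun p l' hl' => ?_⟩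
    rw [key, Polynomial.eval_X]
    have h1 := sz_append l'.reverse p.2
    rw [sz_reverse] at h1
    have h2 := sz_le_of_prefix hl'
    have h3 := sz_pair p.1 p.2
    simp only [Prod.mk.eta] at h3
    omega
  exact (h.comp (hf.pair hg)).of_enc_eq fun a => by rw [key]

theorem reverse {f : α → List β} (hf : PolyTime f) : PolyTime (fun a => (f a).reverse) :=
  (reverseAppend hf (const [])).of_enc_eq fun a => by rw [List.append_nil]

theorem append {f g : α → List β} (hf : PolyTime f) (hg : PolyTime g) :
    PolyTime (fun a => f a ++ g a) :=
  (reverseAppend hf.reverse hg).of_enc_eq fun a => by rw [List.reverse_reverse]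

theorem flatMap {l : α → List β} {f : α → β → List γ} (hl : PolyTime l)
    (hf : PolyTime fun p : α × β => f p.1 p.2) : PolyTime (fun a => (l a).flatMap (f a)) := by
  have key : ∀ a (l : List β) (acc : List γ),
      l.foldl (fun acc b => acc ++ f a b) acc = acc ++ l.flatMap (f a) := fun a l => by
    induction l with
    | nil => simp
    | cons b l ih => simp [ih]
  obtain ⟨q, hq⟩ := hl.size_le
  obtain ⟨r, hr⟩ := hf.size_le
  have h : PolyTime (fun a => (l a).foldl (fun acc b => acc ++ f a b) []) := by
    -- At most `q` pieces are concatenated, and each has size at most `r` evaluated at a bound for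
    -- the size of a pair `(a, b)`.
    refine foldl (g := fun a acc b => acc ++ f a b) hl (const [])
      (append id'.snd.fst (hf.comp (id'.fst.pair id'.snd.snd)))
      ⟨1 + q * r.comp (1 + Polynomial.X + q), fun a l' hl' => ?_⟩
    rw [key, List.nil_append]
    have h1 : ∀ l' : List β, (∀ b ∈ l', b ∈ l a) →
        sz (l'.flatMap (f a)) ≤ 1 + l'.length * r.eval (1 + sz a + q.eval (sz a)) := fun l' => by
      induction l' with
      | nil => intro _; simp [sz_nil]
      | cons b l' ih =>
        intro hm
        have e1 := ih fun b hb => hm b (List.mem_cons_of_mem _ hb)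
        have e2 := hr (a, b)
        have e3 := sz_append (f a b) (l'.flatMap (f a))
        have e4 := (sz_le_of_mem (hm b List.mem_cons_self)).trans (hq a)
        have e5 := r.eval_le_eval_nat
          (show sz (a, b) ≤ 1 + sz a + q.eval (sz a) by rw [sz_pair]; omega)
        simp only [List.flatMap_cons, List.length_cons, Nat.succ_mul] at *
        omega
    refine (h1 l' fun b hb => hl'.subset hb).trans ?_
    simp only [Polynomial.eval_add, Polynomial.eval_mul, Polynomial.eval_comp, Polynomial.eval_X,
      Polynomial.eval_one]
    have := ((length_le_sz l').trans (sz_le_of_prefix hl')).trans (hq a)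
    gcongr
  exact h.of_enc_eq fun a => by rw [key, List.nil_append]

theorem map {l : α → List β} {f : α → β → γ} (hl : PolyTime l)
    (hf : PolyTime fun p : α × β => f p.1 p.2) : PolyTime (fun a => (l a).map (f a)) :=
  (flatMap hl (f := fun a b => [f a b]) (cons hf (const []))).of_enc_eq fun a => by
    rw [List.map_eq_flatMap]

theorem filter {l : α → List β} {f : α → β → Bool} (hl : PolyTime l)
    (hf : PolyTime fun p : α × β => f p.1 p.2) : PolyTime (fun a => (l a).filter (f a)) :=
  (flatMap hl (f := fun a b => if f a b then [b] else [])
    (cond hf (cons id'.snd (const [])) (const []))).of_enc_eq fun a => by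
    congr 1
    induction l a with
    | nil => rfl
    | cons b l ih => cases h : f a b <;> simp [h, ih]

theorem any {l : α → List β} {f : α → β → Bool} (hl : PolyTime l)
    (hf : PolyTime fun p : α × β => f p.1 p.2) : PolyTime (fun a => (l a).any (f a)) :=
  (isEmpty (filter hl hf)).not.of_enc_eq fun a => by
    congr 1
    induction l a with
    | nil => rfl
    | cons b l ih => cases h : f a b <;> simp [h, ih]

theorem all {l : α → List β} {f : α → β → Bool} (hl : PolyTime l)
    (hf : PolyTime fun p : α × β => f p.1 p.2) : PolyTime (fun a => (l a).all (f a)) :=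
  (any hl hf.not).not.of_enc_eq fun a => by rw [List.all_eq_not_any_not]

/-- Unary numbers and lists of units have the same codes. Arithmetic thereby becomes list
processing: addition is concatenation, truncated subtraction is `drop`. -/
theorem enc_replicate (n : ℕ) : enc (List.replicate n ()) = enc n := by
  induction n with
  | zero => rfl
  | succ n ih =>
    have : enc (n + 1) = Data.cons Data.nil (enc n) := rfl
    rw [this, ← ih]
    rfl

theorem replicate {f : α → ℕ} (hf : PolyTime f) : PolyTime (fun a => List.replicate (f a) ()) :=
  hf.of_enc_eq fun _ => enc_replicate _

theorem of_replicate {f : α → ℕ} (hf : PolyTime (fun a => List.replicate (f a) ())) :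
    PolyTime f :=
  hf.of_enc_eq fun _ => (enc_replicate _).symm

theorem add {f g : α → ℕ} (hf : PolyTime f) (hg : PolyTime g) : PolyTime (fun a => f a + g a) :=
  of_replicate ((append hf.replicate hg.replicate).of_enc_eq fun a => by
    rw [List.replicate_add])

theorem length {l : α → List β} (hl : PolyTime l) : PolyTime (fun a => (l a).length) :=
  of_replicate ((map hl (f := fun _ _ => ()) (const ())).of_enc_eq fun a => by
    rw [List.map_const'])

theorem sum {l : α → List ℕ} (hl : PolyTime l) : PolyTime (fun a => (l a).sum) :=
  of_replicate ((flatMap hl (f := fun _ n => List.replicate n ()) id'.snd.replicate).of_enc_eq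
    fun a => by
      congr 1
      induction l a with
      | nil => rfl
      | cons n l ih => rw [List.sum_cons, List.replicate_add, ih, List.flatMap_cons])

theorem mul {f g : α → ℕ} (hf : PolyTime f) (hg : PolyTime g) : PolyTime (fun a => f a * g a) :=
  (sum (map hf.replicate (f := fun a _ => g a) (hg.comp id'.fst))).of_enc_eq fun a => by
    rw [List.map_const', List.sum_replicate, List.length_replicate, smul_eq_mul]

theorem iterate {n : α → ℕ} {c : α → γ} {g : α → γ → γ} (hn : PolyTime n) (hc : PolyTime c)
    (hg : PolyTime fun p : α × γ => g p.1 p.2)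
    (hb : ∃ b : Polynomial ℕ, ∀ a i, i ≤ n a → sz ((g a)^[i] (c a)) ≤ b.eval (sz a)) :
    PolyTime (fun a => (g a)^[n a] (c a)) := by
  have key : ∀ a (l : List Unit) c, l.foldl (fun acc _ => g a acc) c = (g a)^[l.length] c :=
    fun a l => by
      induction l with
      | nil => intro c; rfl
      | cons b l ih => intro c; rw [List.foldl_cons, ih, List.length_cons, Function.iterate_succ_apply]
  obtain ⟨b, hb⟩ := hb
  refine (foldl (g := fun a acc _ => g a acc) hn.replicate hc
    (hg.comp (id'.fst.pair id'.snd.fst)) ⟨b, fun a l' hl' => ?_⟩).of_enc_eq fun a => ?_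
  · rw [key]
    exact hb a _ (by simpa using hl'.length_le)
  · rw [key, List.length_replicate]

theorem drop {n : α → ℕ} {l : α → List β} (hn : PolyTime n) (hl : PolyTime l) :
    PolyTime (fun a => (l a).drop (n a)) := by
  have key : ∀ i (l : List β), List.tail^[i] l = l.drop i := fun i => by
    induction i with
    | zero => intro l; rfl
    | succ i ih => intro l; rw [Function.iterate_succ_apply, ih, List.drop_tail]
  obtain ⟨q, hq⟩ := hl.size_le
  refine (iterate hn hl (g := fun _ l => l.tail) id'.snd.tail ⟨q, fun a i _ => ?_⟩).of_enc_eq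
    fun a => ?_
  · refine le_trans ?_ (hq a)
    rw [key]
    have h1 := sz_append ((l a).take i) ((l a).drop i)
    have h2 := one_le_sz ((l a).take i)
    rw [List.take_append_drop] at h1
    omega
  · rw [key]

theorem getD {n : α → ℕ} {l : α → List β} (hl : PolyTime l) (hn : PolyTime n) {b : β}
    (hb : enc b = Data.nil) : PolyTime (fun a => (l a).getD (n a) b) :=
  (headD (drop hn hl) hb).of_enc_eq fun a => by
    rw [List.headD_eq_head?_getD, List.head?_drop, List.getD_eq_getElem?_getD]

theorem sub {f g : α → ℕ} (hf : PolyTime f) (hg : PolyTime g) : PolyTime (fun a => f a - g a) :=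
  of_replicate ((drop hg hf.replicate).of_enc_eq fun a => by rw [List.drop_replicate])

theorem decide_le {f g : α → ℕ} (hf : PolyTime f) (hg : PolyTime g) :
    PolyTime (fun a => decide (f a ≤ g a)) :=
  (isEmpty (sub hf hg).replicate).of_enc_eq fun a => by
    congr 1
    rw [Bool.eq_iff_iff]
    simp [Nat.sub_eq_zero_iff_le]

theorem decide_eq {f g : α → ℕ} (hf : PolyTime f) (hg : PolyTime g) :
    PolyTime (fun a => decide (f a = g a)) :=
  (and (decide_le hf hg) (decide_le hg hf)).of_enc_eq fun a => by
    congr 1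
    rw [Bool.eq_iff_iff]
    simp [le_antisymm_iff]

theorem range {f : α → ℕ} (hf : PolyTime f) : PolyTime (fun a => List.range (f a)) := by
  have key : ∀ i, (fun l : List ℕ => l ++ [l.length])^[i] [] = List.range i := fun i => by
    induction i with
    | zero => rfl
    | succ i ih => rw [Function.iterate_succ_apply', ih, List.length_range, List.range_succ]
  obtain ⟨q, hq⟩ := hf.size_le
  refine (iterate hf (const []) (g := fun _ l => l ++ [l.length])
    (append id'.snd (cons (length id'.snd) (const []))) ⟨1 + q * (1 + q), fun a i hi => ?_⟩).of_enc_eq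
    fun a => ?_
  · rw [key]
    have h1 := sz_nat (f a)
    have h2 := hq a
    refine (sz_le_of_forall (M := q.eval (sz a)) fun b hb => ?_).trans ?_
    · rw [List.mem_range] at hb
      rw [sz_nat]
      omega
    · simp only [Polynomial.eval_add, Polynomial.eval_mul, Polynomial.eval_one, List.length_range]
      gcongr
      omega
  · rw [key]

end PolyTime

/-! ### The algorithm, on lists of natural numbers -/

namespace Alg

/-- All lists of length at most `r` with entries in `l`. -/
def tuples {α : Type} : ℕ → List α → List (List α)
  | 0, _ => [[]]
  | r + 1, l => [] :: l.flatMap fun x => (tuples r l).map fun t => x :: t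

/-- A coordinate of a vector. -/
def coord (x : List ℕ) (v : ℕ) : ℕ := x.getD v 0

/-- The vector of length `m` that is the sum of the multiples `c` of unit vectors `e_v`, for the
entries `(v, c)` of a list. -/
def vec (m : ℕ) (p : List (ℕ × ℕ)) : List ℕ :=
  (List.range m).map fun v => ((p.filter fun q => decide (q.1 = v)).map fun q => q.2).sum

/-- The number of parts into which edges are divided. -/
def parts (d n : ℕ) : ℕ := (d + 1) * (2 * n + 2)

def has (l : List ℕ) (v : ℕ) : Bool := l.any fun w => decide (w = v)

def inCarrier (F : List (List ℕ)) (v : ℕ) : Bool := F.any fun x => !decide (coord x v = 0)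

/-- Some simplex in the list `LS` contains the carrier of `F`. -/
def carried (m : ℕ) (LS : List (List ℕ)) (F : List (List ℕ)) : Bool :=
  LS.any fun l => (List.range m).all fun v => !inCarrier F v || has l v

/-- The list of the vertices of the edgewise subdivision into `k` parts. -/
def verts (d m : ℕ) (LS : List (List ℕ)) (k : ℕ) : List (List ℕ) :=
  ((tuples (d + 1) ((List.range m).flatMap fun v => (List.range (k + 1)).map fun c => (v, c))).map
    (vec m)).filter fun x => decide (x.sum = k) && carried m LS [x]

/-- The order of the vertices of simplices. -/
def leq (LS : List (List ℕ)) (w v : ℕ) : Bool :=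
  decide (w = v) || LS.any fun l =>
    decide (l.length = 2) && (decide (l.getD 0 0 = w) && decide (l.getD 1 0 = v))

/-- Partial sums of coordinates. -/
def psum (m : ℕ) (LS : List (List ℕ)) (x : List ℕ) (v : ℕ) : ℕ :=
  ((List.range m).map fun w => if leq LS w v then coord x w else 0).sum

/-- One of the two alternatives in the adjacency condition of `esd`; `isFace` tries both directions.
-/
def below (m : ℕ) (LS : List (List ℕ)) (F : List (List ℕ)) (x y : List ℕ) : Bool :=
  (List.range m).all fun v => !inCarrier F v ||
    (decide (psum m LS x v ≤ psum m LS y v) && decide (psum m LS y v ≤ psum m LS x v + 1))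

def same (m : ℕ) (x y : List ℕ) : Bool :=
  (List.range m).all fun v => decide (coord x v = coord y v)

def nodup (m : ℕ) (F : List (List ℕ)) : Bool :=
  (List.range F.length).all fun i => (List.range F.length).all fun j =>
    decide (i = j) || !same m (F.getD i []) (F.getD j [])

def isFace (m : ℕ) (LS : List (List ℕ)) (F : List (List ℕ)) : Bool :=
  (!F.isEmpty && nodup m F) && (carried m LS F &&
    F.all fun x => F.all fun y => below m LS F x y || below m LS F y x)

/-- The first vertex at which the coordinate is maximal. -/
def amax (m : ℕ) (x : List ℕ) : ℕ :=
  ((List.range m).filter fun v => (List.range m).all fun w =>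
    decide (coord x w ≤ coord x v)).headD 0

/-- The level in the tree up to which values are kept at `x`. -/
def height (n m : ℕ) (Lf : List (List ℕ × Option (List ℕ))) (x : List ℕ) : ℕ :=
  -- On the simplex `q.1` the coordinates of `x` are at most `2 * (n - t)` below the maximum. The
  -- spacing `2` is the largest change of a difference of two coordinates between adjacent vertices.
  ((List.range n).filter fun t => Lf.any fun q => q.2.isSome && q.1.all fun v =>
    (List.range m).all fun w =>
      decide (coord x w + (2 * t + 2) ≤ coord x v + (2 * n + 2))).length

/-- The simplex with vertices `l` is the support of `x`. -/
def isSupp (m : ℕ) (x l : List ℕ) : Bool :=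
  (List.range m).all fun v => (decide (coord x v = 0) && !has l v) ||
    (!decide (coord x v = 0) && has l v)

/-- The vertex that the table `Lf` assigns to the vertex `j` of the support of `x`. -/
def lift (m : ℕ) (Lf : List (List ℕ × Option (List ℕ))) (x : List ℕ) (j : ℕ) : ℕ :=
  (Lf.flatMap fun q => if q.2.isSome && isSupp m x q.1 then
    ((List.range q.1.length).filter fun i => decide (q.1.getD i 0 = j)).map fun i =>
      (q.2.getD []).getD i 0
    else []).headD 0

/-- Both directions are tested because the list may contain an edge in only one of them. -/
def adj (LT : List (ℕ × ℕ)) (u v : ℕ) : Bool :=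
  LT.any fun e => (decide (e.1 = u) && decide (e.2 = v)) || (decide (e.1 = v) && decide (e.2 = u))

/-- The vertices adjacent or equal to one in `D`. -/
def nbhd (n : ℕ) (LT : List (ℕ × ℕ)) (D : List ℕ) : List ℕ :=
  (List.range n).filter fun v => D.any fun u => decide (u = v) || adj LT u v

/-- The vertices at distance at most `i` from the root `0`. -/
def reach (n : ℕ) (LT : List (ℕ × ℕ)) (i : ℕ) : List ℕ := (nbhd n LT)^[i] [0]

/-- A vertex at distance `D` from the root is missing from exactly the first `D` of the growing sets
`reach n LT i`. -/
def depth (n : ℕ) (LT : List (ℕ × ℕ)) (v : ℕ) : ℕ :=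
  ((List.range n).filter fun i => !has (reach n LT i) v).length

/-- The root has no candidate, and the default value makes it its own parent. -/
def par (n : ℕ) (LT : List (ℕ × ℕ)) (v : ℕ) : ℕ :=
  ((List.range n).filter fun u => adj LT u v &&
    decide (depth n LT u + 1 = depth n LT v)).headD 0

/-- The ancestor of `v` at depth `h`, or `v` if its depth is at most `h`. -/
def anc (n : ℕ) (LT : List (ℕ × ℕ)) (h v : ℕ) : ℕ := (par n LT)^[depth n LT v - h] v

/-- The value of the simplicial approximation at `x`. -/
def val (n m : ℕ) (LT : List (ℕ × ℕ)) (Lf : List (List ℕ × Option (List ℕ))) (x : List ℕ) : ℕ :=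
  anc n LT (height n m Lf x) (lift m Lf x (amax m x))

abbrev Input : Type :=
  (ℕ × List (List ℕ)) × List (ℕ × ℕ) × (ℕ × List (List ℕ)) × List (List ℕ × Option (List ℕ))

/-- A vertex of the subdivision has at most `d + 1` nonzero coordinates, and a simplex has at most
`d + 2` vertices by `card_le_of_mem_esd`. Tuples of these fixed lengths therefore suffice, and there
are only polynomially many. -/
def main (d : ℕ) (I : Input) : ℕ × List (List (List ℕ)) × List (List ℕ × ℕ) :=
  let n := I.1.1
  let LT := I.2.1
  let m := I.2.2.1.1
  let LS := I.2.2.1.2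
  let Lf := I.2.2.2
  let k := parts d n
  let E := verts d m LS k
  (k, (tuples (d + 2) E).filter (isFace m LS), E.map fun x => (x, val n m LT Lf x))

end Alg

/-! ### The algorithm runs in polynomial time -/

namespace PolyTime

variable {α β γ δ : Type} [Enc α] [Enc β] [Enc γ] [Enc δ]

theorem of_fst {f : α → γ} (hf : PolyTime f) : PolyTime (fun p : α × β => f p.1) :=
  hf.comp id'.fst

/-- The induction on `r` takes place outside the machine and the polynomial depends on `r`; it is
here that the dimension has to be fixed. -/
theorem tuples (r : ℕ) {l : α → List β} (hl : PolyTime l) :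
    PolyTime (fun a => Alg.tuples r (l a)) := by
  induction r with
  | zero => exact const [[]]
  | succ r ih =>
    exact cons (const []) (flatMap hl (f := fun a x => (Alg.tuples r (l a)).map fun t => x :: t)
      (map (ih.of_fst) (f := fun (p : α × β) t => p.2 :: t) (cons (id'.of_fst).snd id'.snd)))

theorem coord {x : α → List ℕ} {v : α → ℕ} (hx : PolyTime x) (hv : PolyTime v) :
    PolyTime (fun a => Alg.coord (x a) (v a)) :=
  getD hx hv rfl

theorem vec {m : α → ℕ} {p : α → List (ℕ × ℕ)} (hm : PolyTime m) (hp : PolyTime p) :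
    PolyTime (fun a => Alg.vec (m a) (p a)) :=
  map (range hm) (sum (map (filter hp.of_fst (decide_eq id'.snd.fst id'.of_fst.snd)) id'.snd.snd))

theorem has {l : α → List ℕ} {v : α → ℕ} (hl : PolyTime l) (hv : PolyTime v) :
    PolyTime (fun a => Alg.has (l a) (v a)) :=
  any hl (decide_eq id'.snd hv.of_fst)

theorem inCarrier {F : α → List (List ℕ)} {v : α → ℕ} (hF : PolyTime F) (hv : PolyTime v) :
    PolyTime (fun a => Alg.inCarrier (F a) (v a)) :=
  any hF (not (decide_eq (coord id'.snd hv.of_fst) (const 0)))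

theorem carried {m : α → ℕ} {LS F : α → List (List ℕ)} (hm : PolyTime m) (hS : PolyTime LS)
    (hF : PolyTime F) : PolyTime (fun a => Alg.carried (m a) (LS a) (F a)) :=
  any hS (all (range hm).of_fst (or (not (inCarrier hF.of_fst.of_fst id'.snd))
    (has id'.of_fst.snd id'.snd)))

theorem verts (d : ℕ) {m k : α → ℕ} {LS : α → List (List ℕ)} (hm : PolyTime m) (hS : PolyTime LS)
    (hk : PolyTime k) : PolyTime (fun a => Alg.verts d (m a) (LS a) (k a)) :=
  filter (map (tuples (d + 1) (flatMap (range hm)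
      (map (range (add hk.of_fst (const 1))) (pair id'.of_fst.snd id'.snd))))
      (vec hm.of_fst id'.snd))
    (and (decide_eq (sum id'.snd) hk.of_fst) (carried hm.of_fst hS.of_fst
      (cons id'.snd (const []))))

theorem leq {LS : α → List (List ℕ)} {w v : α → ℕ} (hS : PolyTime LS) (hw : PolyTime w)
    (hv : PolyTime v) : PolyTime (fun a => Alg.leq (LS a) (w a) (v a)) :=
  or (decide_eq hw hv) (any hS (and (decide_eq (length id'.snd) (const 2))
    (and (decide_eq (getD id'.snd (const 0) rfl) hw.of_fst)
      (decide_eq (getD id'.snd (const 1) rfl) hv.of_fst))))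

theorem psum {m : α → ℕ} {LS : α → List (List ℕ)} {x : α → List ℕ} {v : α → ℕ} (hm : PolyTime m)
    (hS : PolyTime LS) (hx : PolyTime x) (hv : PolyTime v) :
    PolyTime (fun a => Alg.psum (m a) (LS a) (x a) (v a)) :=
  sum (map (range hm) (cond (leq hS.of_fst id'.snd hv.of_fst) (coord hx.of_fst id'.snd) (const 0)))

theorem below {m : α → ℕ} {LS F : α → List (List ℕ)} {x y : α → List ℕ} (hm : PolyTime m)
    (hS : PolyTime LS) (hF : PolyTime F) (hx : PolyTime x) (hy : PolyTime y) :
    PolyTime (fun a => Alg.below (m a) (LS a) (F a) (x a) (y a)) :=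
  have h := fun {z : α → List ℕ} (hz : PolyTime z) =>
    psum (hm.of_fst (β := ℕ)) hS.of_fst hz.of_fst id'.snd
  all (range hm) (or (not (inCarrier hF.of_fst id'.snd))
    (and (decide_le (h hx) (h hy)) (decide_le (h hy) (add (h hx) (const 1)))))

theorem same {m : α → ℕ} {x y : α → List ℕ} (hm : PolyTime m) (hx : PolyTime x)
    (hy : PolyTime y) : PolyTime (fun a => Alg.same (m a) (x a) (y a)) :=
  all (range hm) (decide_eq (coord hx.of_fst id'.snd) (coord hy.of_fst id'.snd))

theorem nodup {m : α → ℕ} {F : α → List (List ℕ)} (hm : PolyTime m) (hF : PolyTime F) :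
    PolyTime (fun a => Alg.nodup (m a) (F a)) :=
  have h := range (length hF)
  all h (all h.of_fst (or (decide_eq id'.of_fst.snd id'.snd)
    (not (same hm.of_fst.of_fst (getD hF.of_fst.of_fst id'.of_fst.snd rfl)
      (getD hF.of_fst.of_fst id'.snd rfl)))))

theorem isFace {m : α → ℕ} {LS F : α → List (List ℕ)} (hm : PolyTime m) (hS : PolyTime LS)
    (hF : PolyTime F) : PolyTime (fun a => Alg.isFace (m a) (LS a) (F a)) :=
  and (and (not (isEmpty hF)) (nodup hm hF)) (and (carried hm hS hF) (all hF (all hF.of_fst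
    (or (below hm.of_fst.of_fst hS.of_fst.of_fst hF.of_fst.of_fst id'.of_fst.snd id'.snd)
      (below hm.of_fst.of_fst hS.of_fst.of_fst hF.of_fst.of_fst id'.snd id'.of_fst.snd)))))

theorem amax {m : α → ℕ} {x : α → List ℕ} (hm : PolyTime m) (hx : PolyTime x) :
    PolyTime (fun a => Alg.amax (m a) (x a)) :=
  headD (filter (range hm) (all (range hm).of_fst (decide_le (coord hx.of_fst.of_fst id'.snd)
    (coord hx.of_fst.of_fst id'.of_fst.snd)))) rfl

theorem height {n m : α → ℕ} {Lf : α → List (List ℕ × Option (List ℕ))} {x : α → List ℕ}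
    (hn : PolyTime n) (hm : PolyTime m) (hf : PolyTime Lf) (hx : PolyTime x) :
    PolyTime (fun a => Alg.height (n a) (m a) (Lf a) (x a)) :=
  length (filter (range hn) (any hf.of_fst (and (isSome id'.snd.snd) (all id'.snd.fst
    (all (range hm).of_fst.of_fst.of_fst
      (decide_le (add (coord hx.of_fst.of_fst.of_fst.of_fst id'.snd)
          (add (mul (const 2) id'.of_fst.of_fst.of_fst.snd) (const 2)))
        (add (coord hx.of_fst.of_fst.of_fst.of_fst id'.of_fst.snd)
          (add (mul (const 2) hn.of_fst.of_fst.of_fst.of_fst) (const 2)))))))))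

theorem isSupp {m : α → ℕ} {x l : α → List ℕ} (hm : PolyTime m) (hx : PolyTime x)
    (hl : PolyTime l) : PolyTime (fun a => Alg.isSupp (m a) (x a) (l a)) :=
  have h0 := decide_eq (coord (hx.of_fst (β := ℕ)) id'.snd) (const 0)
  have h1 := has (hl.of_fst (β := ℕ)) id'.snd
  all (range hm) (or (and h0 h1.not) (and h0.not h1))

theorem lift {m j : α → ℕ} {Lf : α → List (List ℕ × Option (List ℕ))} {x : α → List ℕ}
    (hm : PolyTime m) (hf : PolyTime Lf) (hx : PolyTime x) (hj : PolyTime j) :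
    PolyTime (fun a => Alg.lift (m a) (Lf a) (x a) (j a)) :=
  headD (flatMap hf (cond (and (isSome id'.snd.snd) (isSupp hm.of_fst hx.of_fst id'.snd.fst))
    (map (filter (range (length id'.snd.fst))
        (decide_eq (getD id'.of_fst.snd.fst id'.snd rfl) hj.of_fst.of_fst))
      (getD (getDOption id'.of_fst.snd.snd rfl) id'.snd rfl))
    (const []))) rfl

theorem adj {LT : α → List (ℕ × ℕ)} {u v : α → ℕ} (hT : PolyTime LT) (hu : PolyTime u)
    (hv : PolyTime v) : PolyTime (fun a => Alg.adj (LT a) (u a) (v a)) :=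
  any hT (or (and (decide_eq id'.snd.fst hu.of_fst) (decide_eq id'.snd.snd hv.of_fst))
    (and (decide_eq id'.snd.fst hv.of_fst) (decide_eq id'.snd.snd hu.of_fst)))

theorem nbhd {n : α → ℕ} {LT : α → List (ℕ × ℕ)} {D : α → List ℕ} (hn : PolyTime n)
    (hT : PolyTime LT) (hD : PolyTime D) : PolyTime (fun a => Alg.nbhd (n a) (LT a) (D a)) :=
  filter (range hn) (any hD.of_fst (or (decide_eq id'.snd id'.of_fst.snd)
    (adj hT.of_fst.of_fst id'.snd id'.of_fst.snd)))

theorem reach {n i : α → ℕ} {LT : α → List (ℕ × ℕ)} (hn : PolyTime n) (hT : PolyTime LT)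
    (hi : PolyTime i) : PolyTime (fun a => Alg.reach (n a) (LT a) (i a)) := by
  obtain ⟨q, hq⟩ := hn.size_le
  -- `3` is the size of `[0]`; every later iterate is filtered from `List.range (n a)`.
  refine iterate hi (const [0]) (nbhd hn.of_fst hT.of_fst id'.snd)
    ⟨3 + q * (1 + q), fun a i _ => ?_⟩
  have h2 := hq a
  rw [sz_nat] at h2
  simp only [Polynomial.eval_add, Polynomial.eval_mul, Polynomial.eval_ofNat, Polynomial.eval_one]
  cases i with
  | zero =>
    have : sz [0] = 3 := rfl
    rw [Function.iterate_zero_apply, this]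
    omega
  | succ i =>
    rw [Function.iterate_succ_apply']
    refine (sz_le_of_forall (M := q.eval (sz a)) fun b hb => ?_).trans ?_
    · have := List.mem_range.1 (List.mem_filter.1 hb).1
      rw [sz_nat]
      omega
    · have h3 := List.length_filter_le (fun v => ((Alg.nbhd (n a) (LT a))^[i] [0]).any fun u =>
        decide (u = v) || Alg.adj (LT a) u v) (List.range (n a))
      rw [List.length_range] at h3
      have h4 : (Alg.nbhd (n a) (LT a) ((Alg.nbhd (n a) (LT a))^[i] [0])).length ≤ q.eval (sz a) :=
        h3.trans (by omega)
      have := Nat.mul_le_mul_right (1 + q.eval (sz a)) h4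
      omega

theorem depth {n v : α → ℕ} {LT : α → List (ℕ × ℕ)} (hn : PolyTime n) (hT : PolyTime LT)
    (hv : PolyTime v) : PolyTime (fun a => Alg.depth (n a) (LT a) (v a)) :=
  length (filter (range hn) (not (has (reach hn.of_fst hT.of_fst id'.snd) hv.of_fst)))

theorem par {n v : α → ℕ} {LT : α → List (ℕ × ℕ)} (hn : PolyTime n) (hT : PolyTime LT)
    (hv : PolyTime v) : PolyTime (fun a => Alg.par (n a) (LT a) (v a)) :=
  headD (filter (range hn) (and (adj hT.of_fst id'.snd hv.of_fst)
    (decide_eq (add (depth hn.of_fst hT.of_fst id'.snd) (const 1))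
      (depth hn.of_fst hT.of_fst hv.of_fst)))) rfl

theorem anc {n h v : α → ℕ} {LT : α → List (ℕ × ℕ)} (hn : PolyTime n) (hT : PolyTime LT)
    (hh : PolyTime h) (hv : PolyTime v) : PolyTime (fun a => Alg.anc (n a) (LT a) (h a) (v a)) := by
  obtain ⟨q, hq⟩ := hn.size_le
  obtain ⟨r, hr⟩ := hv.size_le
  refine iterate (sub (depth hn hT hv) hh) hv (par hn.of_fst hT.of_fst id'.snd)
    ⟨1 + q + r, fun a i _ => ?_⟩
  have h1 := hq a
  have h2 := hr a
  simp only [Polynomial.eval_add, Polynomial.eval_one]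
  cases i with
  | zero => rw [Function.iterate_zero_apply]; omega
  | succ i =>
    rw [Function.iterate_succ_apply', sz_nat]
    rw [sz_nat] at h1
    -- The inequality is not strict because the default value `0` is returned if `n a = 0`.
    have key : ∀ w, Alg.par (n a) (LT a) w ≤ n a := fun w => by
      unfold Alg.par
      rw [List.headD_eq_head?_getD]
      cases h : (List.filter (fun u => Alg.adj (LT a) u w && decide (Alg.depth (n a) (LT a) u + 1 =
        Alg.depth (n a) (LT a) w)) (List.range (n a))).head? with
      | none => simp
      | some u =>
        have := List.mem_range.1 (List.mem_filter.1 (List.mem_of_head? h)).1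
        simpa using this.le
    have := key ((Alg.par (n a) (LT a))^[i] (v a))
    omega

theorem val {n m : α → ℕ} {LT : α → List (ℕ × ℕ)} {Lf : α → List (List ℕ × Option (List ℕ))}
    {x : α → List ℕ} (hn : PolyTime n) (hm : PolyTime m) (hT : PolyTime LT) (hf : PolyTime Lf)
    (hx : PolyTime x) : PolyTime (fun a => Alg.val (n a) (m a) (LT a) (Lf a) (x a)) :=
  anc hn hT (height hn hm hf hx) (lift hm hf hx (amax hm hx))

theorem main (d : ℕ) : PolyTime (Alg.main d) :=
  have n : PolyTime (fun I : Alg.Input => I.1.1) := id'.fst.fst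
  have k : PolyTime (fun I : Alg.Input => Alg.parts d I.1.1) :=
    mul (const (d + 1)) (add (mul (const 2) n) (const 2))
  have m : PolyTime (fun I : Alg.Input => I.2.2.1.1) := id'.snd.snd.fst.fst
  have S : PolyTime (fun I : Alg.Input => I.2.2.1.2) := id'.snd.snd.fst.snd
  have E := verts d m S k
  pair k (pair (filter (tuples (d + 2) E) (isFace m.of_fst S.of_fst id'.snd))
    (map E (pair id'.snd (val n.of_fst m.of_fst id'.of_fst.snd.fst
      id'.of_fst.snd.snd.snd id'.snd))))

end PolyTime

/-! ### Cells of geometric realizations -/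

theorem toTop_map_cellPoint {S S' : SSet.{0}} (φ : S ⟶ S') {n : ℕ}
    (σ : S.obj (Opposite.op (SimplexCategory.mk n))) (t : stdSimplex ℝ (Fin (n + 1))) :
    SSet.toTop.map φ (cellPoint σ t) = cellPoint (φ.app _ σ) t := by
  unfold cellPoint
  rw [← SSet.yonedaEquiv_symm_comp, Functor.map_comp]
  rfl

/-- The gluing relation of the realization. Together with continuity and naturality in `S` it is all
that the argument uses about cells. -/
theorem cellPoint_map {S : SSet.{0}} {n m : ℕ} (g : SimplexCategory.mk m ⟶ SimplexCategory.mk n)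
    (σ : S.obj (Opposite.op (SimplexCategory.mk n))) (t : stdSimplex ℝ (Fin (m + 1))) :
    cellPoint (S.map g.op σ) t = cellPoint σ (stdSimplex.map g.toOrderHom t) := by
  unfold cellPoint
  rw [← SSet.yonedaEquiv_symm_naturality_left, Functor.map_comp]
  have := ConcreteCategory.congr_hom (SSet.toTopSimplex.inv.naturality g) (ULift.up t)
  simp only [ConcreteCategory.comp_apply] at this ⊢
  exact congrArg _ this.symm

theorem continuous_cellPoint {S : SSet.{0}} {n : ℕ}
    (σ : S.obj (Opposite.op (SimplexCategory.mk n))) : Continuous (cellPoint σ) := by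
  unfold cellPoint
  exact (SSet.toTop.map (SSet.yonedaEquiv.symm σ)).hom.continuous.comp
    ((SSet.toTopSimplex.inv.app (SimplexCategory.mk n)).hom.continuous.comp continuous_uliftUp)

namespace OrderedComplex

variable {V : Type} [DecidableEq V]

theorem mem_faces_of_subset (K : OrderedComplex V) {s t : Finset V} (hs : s ∈ K.faces)
    (h : t ⊆ s) (ht : t.Nonempty) : t ∈ K.faces :=
  (K.isRelLowerSet_faces hs).2 h ht

/-- A sequence of vertices of a simplex factors through the increasing enumeration. -/
theorem IsSeq.exists_factor {K : OrderedComplex V} {n m : ℕ} {σ : Fin (m + 1) → V}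
    {e : Fin (n + 1) → V} (hσ : K.IsSeq σ) (he : K.IsSeq e) (hinj : Function.Injective e)
    (h : ∀ i, ∃ j, e j = σ i) : ∃ g : Fin (m + 1) →o Fin (n + 1), ∀ i, e (g i) = σ i := by
  choose g hg using h
  refine ⟨⟨g, fun i j hij => ?_⟩, hg⟩
  -- If `g` reversed the order of `i` and `j`, then `σ i` and `σ j` would be comparable both ways,
  -- hence equal, against the injectivity of `e`.
  by_contra hlt
  rw [not_le] at hlt
  have h1 := hσ.2 i j hij
  have h2 := he.2 _ _ hlt.le
  rw [hg, hg] at h2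
  have h3 : {σ i, σ j} ∈ K.faces := K.mem_faces_of_subset hσ.1
    (by intro v; simp only [Finset.mem_insert, Finset.mem_singleton]; rintro (rfl | rfl) <;> simp)
    (by simp)
  have h4 := K.le_antisymm _ _ h3 h1 h2
  rw [← hg i, ← hg j] at h4
  exact hlt.ne' (hinj h4)

theorem cellPoint_comp {K : OrderedComplex V} {n m : ℕ} {e : Fin (n + 1) → V} (he : K.IsSeq e)
    (g : Fin (m + 1) →o Fin (n + 1)) {σ : Fin (m + 1) → V} (hσ : K.IsSeq σ)
    (h : ∀ i, e (g i) = σ i) (t : stdSimplex ℝ (Fin (m + 1))) :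
    cellPoint (S := K.ss) (n := m) ⟨σ, hσ⟩ t =
      cellPoint (S := K.ss) (n := n) ⟨e, he⟩ (stdSimplex.map g t) := by
  obtain rfl : σ = e ∘ g := funext fun i => (h i).symm
  exact cellPoint_map (S := K.ss) (SimplexCategory.Hom.mk g) ⟨e, he⟩ t

/-- Two points of cells agree if they have the same barycentric coordinates. -/
theorem cellPoint_eq {K : OrderedComplex V} {n m : ℕ} {σ : Fin (n + 1) → V} {τ : Fin (m + 1) → V}
    (hσ : K.IsSeq σ) (hτ : K.IsSeq τ) (hsub : ∀ i, ∃ j, τ j = σ i)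
    {s : stdSimplex ℝ (Fin (n + 1))} {t : stdSimplex ℝ (Fin (m + 1))}
    (h : ∀ v, (∑ i, if σ i = v then s i else 0) = ∑ i, if τ i = v then t i else 0) :
    cellPoint (S := K.ss) (n := n) ⟨σ, hσ⟩ s = cellPoint (S := K.ss) (n := m) ⟨τ, hτ⟩ t := by
  -- Both sequences factor through the increasing enumeration `e` of the vertices of `τ`, so both
  -- points are moved to the cell of `e`, where their coordinates agree.
  obtain ⟨N, e, he, hinj, him⟩ := K.exists_enum hτ.1
  have hmem : ∀ j, ∃ l, e l = τ j := fun j => by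
    have : τ j ∈ Finset.univ.image e := him ▸ Finset.mem_image_of_mem _ (Finset.mem_univ j)
    simpa using this
  obtain ⟨g, hg⟩ := hτ.exists_factor he hinj hmem
  obtain ⟨g', hg'⟩ := hσ.exists_factor he hinj fun i => by
    obtain ⟨j, hj⟩ := hsub i
    rw [← hj]
    exact hmem j
  rw [cellPoint_comp he g hτ hg, cellPoint_comp he g' hσ hg']
  congr 1
  ext l
  have key : ∀ {r : ℕ} (g : Fin (r + 1) →o Fin (N + 1)) (σ : Fin (r + 1) → V)
      (_ : ∀ i, e (g i) = σ i) (s : stdSimplex ℝ (Fin (r + 1))),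
      (stdSimplex.map g s) l = ∑ i, if σ i = e l then s i else 0 := by
    intro r g σ hg s
    rw [stdSimplex.map_coe, FunOnFinite.linearMap_apply_apply, Finset.sum_filter]
    exact Finset.sum_congr rfl fun i _ => by simp only [← hg i, hinj.eq_iff]
  exact (key g' σ hg' s).trans ((h _).trans (key g τ hg t).symm)

/-- Isolates the choice of an enumeration made in `toSS`; later arguments use only the properties
listed here. -/
theorem toSS_spec [Fintype V] (K : OrderedComplex V)
    (y : Realization K.toAbstractSimplicialComplex) :
    ∃ (n : ℕ) (σ : Fin (n + 1) → V) (hσ : K.IsSeq σ) (t : stdSimplex ℝ (Fin (n + 1))),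
      K.toSS y = cellPoint (S := K.ss) (n := n) ⟨σ, hσ⟩ t ∧ Function.Injective σ ∧
      (∀ i, y.1 (σ i) ≠ 0) ∧ ∀ v, (∑ i, if σ i = v then t i else 0) = y.1 v := by
  let h := K.exists_enum y.2.2.2
  have hinj := h.choose_spec.choose_spec.2.1
  have him := h.choose_spec.choose_spec.2.2
  refine ⟨h.choose, h.choose_spec.choose, h.choose_spec.choose_spec.1, _, rfl, hinj, ?_, ?_⟩
  · intro i
    have : h.choose_spec.choose i ∈ Finset.univ.image h.choose_spec.choose :=
      Finset.mem_image_of_mem _ (Finset.mem_univ i)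
    rw [him] at this
    exact (Finset.mem_filter.1 this).2
  · intro v
    change (∑ i, if h.choose_spec.choose i = v then y.1 (h.choose_spec.choose i) else 0) = y.1 v
    by_cases hv : y.1 v = 0
    · rw [hv]
      refine Finset.sum_eq_zero fun i _ => ?_
      split_ifs with hi
      · rw [hi, hv]
      · rfl
    · have : v ∈ Finset.univ.image h.choose_spec.choose := by
        rw [him]
        exact Finset.mem_filter.2 ⟨Finset.mem_univ _, hv⟩
      obtain ⟨i, -, hi⟩ := Finset.mem_image.1 this
      rw [Finset.sum_eq_single i, if_pos hi, hi]
      · intro j _ hj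
        rw [if_neg]
        rintro rfl
        exact hj (hinj hi).symm
      · simp

/-- A point of `|K|` lies in the cell of every simplex that contains it. -/
theorem toSS_eq_cellPoint [Fintype V] (K : OrderedComplex V)
    (y : Realization K.toAbstractSimplicialComplex) {n : ℕ} {σ : Fin (n + 1) → V}
    (hσ : K.IsSeq σ) (t : stdSimplex ℝ (Fin (n + 1)))
    (h : ∀ v, (∑ i, if σ i = v then t i else 0) = y.1 v) :
    K.toSS y = cellPoint (S := K.ss) (n := n) ⟨σ, hσ⟩ t := by
  obtain ⟨m, τ, hτ, s, hs, -, hne, hτy⟩ := K.toSS_spec y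
  rw [hs]
  refine cellPoint_eq hτ hσ (fun i => ?_) fun v => (hτy v).trans (h v).symm
  by_contra hcon
  push Not at hcon
  refine hne i ?_
  rw [← h]
  exact Finset.sum_eq_zero fun j _ => if_neg (hcon j)

/-- The points supported in a given simplex form one of finitely many closed sets that cover the
space. On such a set the map is a single cell map in the coordinates, also at points with a smaller
support, because `toSS_eq_cellPoint` admits zero coordinates. -/
theorem continuous_toSS [Fintype V] (K : OrderedComplex V) : Continuous K.toSS := by
  let C : {s // s ∈ K.faces} → Set (Realization K.toAbstractSimplicialComplex) :=
    fun s => {y | ∀ v, v ∉ s.1 → y.1 v = 0}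
  refine (locallyFinite_of_finite C).continuous ?_ (fun s => ?_) fun s => ?_
  · refine Set.eq_univ_of_forall fun y => Set.mem_iUnion.2 ⟨⟨_, y.2.2.2⟩, fun v hv => ?_⟩
    simpa using hv
  · simp only [C, Set.ofPred_forall]
    exact isClosed_iInter fun v => isClosed_iInter fun _ =>
      isClosed_eq ((continuous_apply v).comp continuous_subtype_val) continuous_const
  · obtain ⟨n, e, he, hinj, him⟩ := K.exists_enum s.2
    have hsum : ∀ y : C s, ∀ v, (∑ i, if e i = v then y.1.1 (e i) else 0) = y.1.1 v := by
      intro y v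
      by_cases hv : v ∈ s.1
      · rw [← him] at hv
        obtain ⟨i, -, hi⟩ := Finset.mem_image.1 hv
        rw [Finset.sum_eq_single i, if_pos hi, hi]
        · intro j _ hj
          rw [if_neg]
          rintro rfl
          exact hj (hinj hi).symm
        · simp
      · rw [y.2 v hv]
        refine Finset.sum_eq_zero fun i _ => ?_
        split_ifs with hi
        · rw [hi, y.2 v hv]
        · rfl
    have hone : ∀ y : C s, ∑ i, y.1.1 (e i) = 1 := fun y => by
      refine Eq.trans ?_ y.1.2.2.1
      rw [← Finset.sum_congr rfl fun v _ => hsum y v, Finset.sum_comm]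
      simp
    rw [continuousOn_iff_continuous_domRestrict]
    have hval : Continuous fun y : C s => y.1.1 :=
      continuous_subtype_val.comp continuous_subtype_val
    have hc := (continuous_cellPoint (S := K.ss) (n := n) ⟨e, he⟩).comp
      (f := fun y : C s => (⟨fun i => y.1.1 (e i), fun i => y.1.2.1 _, hone y⟩ :
        stdSimplex ℝ (Fin (n + 1))))
      (Continuous.subtype_mk (continuous_pi fun i => (continuous_apply (e i)).comp hval) _)
    refine hc.congr fun y => ?_
    exact (K.toSS_eq_cellPoint y.1 he _ (hsum y)).symm

/-- All points of cells in the tree coincide in `|K^ss / T|`. -/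
theorem cellPoint_inTree {K : OrderedComplex V} {T : SimpleGraph V} {n m : ℕ}
    {σ : Fin (n + 1) → V} {τ : Fin (m + 1) → V} (hσ : K.IsSeq σ) (hτ : K.IsSeq τ)
    (hσT : InTree T σ) (hτT : InTree T τ) (s : stdSimplex ℝ (Fin (n + 1)))
    (t : stdSimplex ℝ (Fin (m + 1))) :
    cellPoint (S := K.collapse T) (n := n) (Quot.mk _ ⟨σ, hσ⟩) s =
      cellPoint (S := K.collapse T) (n := m) (Quot.mk _ ⟨τ, hτ⟩) t := by
  have hc : ∀ {r l : ℕ} {σ : Fin (r + 1) → V} (hσ : K.IsSeq σ),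
      K.IsSeq (σ ∘ ((OrderHom.const (Fin (l + 1)) (0 : Fin (r + 1))))) := fun hσ => hσ.comp _
  have hT : ∀ {r : ℕ} (l : ℕ) (σ : Fin (r + 1) → V),
      InTree T (σ ∘ ((OrderHom.const (Fin (l + 1)) (0 : Fin (r + 1))))) := fun l σ =>
    ⟨σ 0, σ 0, Or.inl rfl, fun i => Or.inl rfl⟩
  -- In the quotient a simplex in the tree equals a degeneracy of its first vertex, so its whole
  -- cell is mapped to one point. The vertices are in turn identified with one another.
  have key : ∀ {r : ℕ} {σ : Fin (r + 1) → V} (hσ : K.IsSeq σ) (_ : InTree T σ)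
      (s : stdSimplex ℝ (Fin (r + 1))),
      cellPoint (S := K.collapse T) (n := r) (Quot.mk _ ⟨σ, hσ⟩) s =
        cellPoint (S := K.collapse T) (n := 0) (Quot.mk _ ⟨_, hc (l := 0) hσ⟩) default := by
    intro r σ hσ hσT s
    have h1 : (Quot.mk (K.collapseRel T r) ⟨σ, hσ⟩) = Quot.mk (K.collapseRel T r) ⟨_, hc hσ⟩ :=
      Quot.sound (Or.inr ⟨hσT, hT _ σ⟩)
    rw [h1]
    refine (cellPoint_map (S := K.collapse T) (SimplexCategory.Hom.mk
      (OrderHom.const (Fin (r + 1)) (0 : Fin 1)))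
      (Quot.mk (K.collapseRel T 0) ⟨_, hc (l := 0) hσ⟩) s).trans ?_
    congr 1
    exact Subsingleton.elim _ _
  rw [key hσ hσT, key hτ hτT]
  congr 1
  exact Quot.sound (Or.inr ⟨hT 0 σ, hT 0 τ⟩)

end OrderedComplex

/-! ### From a combinatorial approximation to a homotopy -/

namespace OrderedComplex

variable {V W : Type} [DecidableEq V] [DecidableEq W] [Fintype W]

/-- `f'` approximates `f` on the simplex `G` of the subdivision: `f` maps a simplex `σ` that
contains the values of `j` on `G` to the class of a sequence `τ`, and `f'` is `τ ∘ j`, or both `f'`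
and `τ` lie in one edge of the tree. -/
def IsApprox {S : OrderedComplex W} {K : OrderedComplex V} {T : SimpleGraph V}
    (f : S.ss ⟶ K.collapse T) {k : ℕ} (j : S.EsdVertex k → W) (f' : S.EsdVertex k → V)
    (G : Finset (S.EsdVertex k)) : Prop :=
  ∃ (r : ℕ) (σ : Fin (r + 1) → W) (hσ : S.IsSeq σ) (τ : Fin (r + 1) → V) (hτ : K.IsSeq τ),
    f.app (Opposite.op (SimplexCategory.mk r)) ⟨σ, hσ⟩ = Quot.mk _ ⟨τ, hτ⟩ ∧
    ((∀ x ∈ G, ∃ i, σ i = j x ∧ τ i = f' x) ∨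
      (InTree T τ ∧ (∀ x ∈ G, ∃ i, σ i = j x) ∧
        ∃ v w, (v = w ∨ T.Adj v w) ∧ ∀ x ∈ G, f' x = v ∨ f' x = w))

theorem isSimplicialMap_of_isApprox {S : OrderedComplex W} {K : OrderedComplex V}
    {T : SimpleGraph V} (hT : K.IsSpanningTree T) {f : S.ss ⟶ K.collapse T} {k : ℕ}
    {j : S.EsdVertex k → W} {f' : S.EsdVertex k → V}
    (h : ∀ G ∈ (S.esd k).faces, IsApprox f j f' G) :
    IsSimplicialMap (S.esd k) K.toAbstractSimplicialComplex f' := by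
  intro G hG
  have hne : (G.image f').Nonempty := hG.1.image f'
  obtain ⟨r, σ, hσ, τ, hτ, -, h | ⟨-, -, v, w, hvw, h⟩⟩ := h G hG
  · refine K.mem_faces_of_subset hτ.1 (fun v hv => ?_) hne
    obtain ⟨x, hx, rfl⟩ := Finset.mem_image.1 hv
    obtain ⟨i, -, hi⟩ := h x hx
    exact Finset.mem_image.2 ⟨i, Finset.mem_univ _, hi⟩
  · have hf : ({v, w} : Finset V) ∈ K.faces := by
      rcases hvw with rfl | hvw
      · simpa using K.singleton_mem v
      · exact hT.2 v w hvw
    refine K.mem_faces_of_subset hf (fun u hu => ?_) hne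
    obtain ⟨x, hx, rfl⟩ := Finset.mem_image.1 hu
    simpa using h x hx

theorem mem_carrier {S : OrderedComplex W} {k : ℕ} {F : Finset (S.EsdVertex k)} {v : W} :
    v ∈ S.carrier F ↔ ∃ x ∈ F, x.1 v ≠ 0 := by
  simp [carrier]

/-- The convex combination of the affine extension of `j` and of the map `|Esd_k(S)| → |S|`. -/
noncomputable def slide {S : OrderedComplex W} {k : ℕ} (j : S.EsdVertex k → W)
    (hj : ∀ x : S.EsdVertex k, x.1 (j x) ≠ 0) (p : unitInterval × Realization (S.esd k)) :
    Realization S.toAbstractSimplicialComplex :=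
  ⟨fun v => (1 - p.1.1) * (∑ x, if j x = v then p.2.1 x else 0) + p.1.1 * (S.esdMap k p.2).1 v, by
    have h0 : ∀ v, 0 ≤ ∑ x, if j x = v then p.2.1 x else 0 := fun v =>
      Finset.sum_nonneg fun x _ => by
        split_ifs
        · exact p.2.2.1 x
        · exact le_rfl
    have h1 : ∑ v, ∑ x, (if j x = v then p.2.1 x else 0) = 1 := by
      rw [Finset.sum_comm]
      simpa using p.2.2.2.1
    have hsum : ∑ v, ((1 - p.1.1) * (∑ x, if j x = v then p.2.1 x else 0) +
        p.1.1 * (S.esdMap k p.2).1 v) = 1 := by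
      rw [Finset.sum_add_distrib, ← Finset.mul_sum, ← Finset.mul_sum, h1, (S.esdMap k p.2).2.2.1]
      ring
    refine ⟨fun v => add_nonneg (mul_nonneg (sub_nonneg.2 p.1.2.2) (h0 v))
      (mul_nonneg p.1.2.1 ((S.esdMap k p.2).2.1 v)), hsum, ?_⟩
    -- Both summands vanish outside the carrier of the support of `p.2`, because `j x` lies in the
    -- support of `x`; so the segment stays in one simplex of `S`.
    refine S.mem_faces_of_subset p.2.2.2.2.2.1 (fun v hv => ?_) ?_
    · rw [mem_carrier]
      by_contra hcon
      push Not at hcon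
      have hz : ∀ x, x.1 v ≠ 0 → p.2.1 x = 0 := fun x hx => by
        by_contra h
        exact hx (hcon x (by simpa using h))
      refine (Finset.mem_filter.1 hv).2 ?_
      have e1 : (∑ x, if j x = v then p.2.1 x else 0) = 0 := Finset.sum_eq_zero fun x _ => by
        split_ifs with h
        · exact hz x (h ▸ hj x)
        · rfl
      have e2 : (S.esdMap k p.2).1 v = 0 := Finset.sum_eq_zero fun x _ => by
        by_cases h : x.1 v = 0
        · simp [h]
        · simp [hz x h]
      change _ * _ + _ = (0 : ℝ)
      rw [e1, e2]
      ring
    · by_contra hcon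
      rw [Finset.not_nonempty_iff_eq_empty, Finset.filter_eq_empty_iff] at hcon
      rw [Finset.sum_eq_zero fun v hv => not_not.1 (hcon hv)] at hsum
      exact zero_ne_one hsum⟩

theorem continuous_slide {S : OrderedComplex W} {k : ℕ} (j : S.EsdVertex k → W)
    (hj : ∀ x : S.EsdVertex k, x.1 (j x) ≠ 0) : Continuous (slide j hj) := by
  have hx : ∀ x, Continuous fun p : unitInterval × Realization (S.esd k) => p.2.1 x := fun x =>
    (continuous_apply x).comp (continuous_subtype_val.comp continuous_snd)
  have ht : Continuous fun p : unitInterval × Realization (S.esd k) => p.1.1 :=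
    continuous_subtype_val.comp continuous_fst
  refine Continuous.subtype_mk (continuous_pi fun v => ?_) _
  refine ((continuous_const.sub ht).mul (continuous_finsetSum _ fun x _ => ?_)).add
    (ht.mul (continuous_finsetSum _ fun x _ => (hx x).mul continuous_const))
  split_ifs
  · exact hx x
  · exact continuous_const

/-- The homotopy is `f` applied to `slide`. At time `1` this is the map on the right by definition.
At time `0` it equals the map on the left exactly: either both points have the same coordinates in
the cells of `σ` and `τ`, which correspond under `f`, or both are the base-point. -/
theorem areHomotopic_of_isApprox [Fintype V] {S : OrderedComplex W} {K : OrderedComplex V}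
    {T : SimpleGraph V} {f : S.ss ⟶ K.collapse T} {k : ℕ}
    {j : S.EsdVertex k → W} (hj : ∀ x : S.EsdVertex k, x.1 (j x) ≠ 0) {f' : S.EsdVertex k → V}
    (hf' : IsSimplicialMap (S.esd k) K.toAbstractSimplicialComplex f')
    (h : ∀ G ∈ (S.esd k).faces, IsApprox f j f' G) :
    AreHomotopic
      (fun y : Realization (S.esd k) =>
        SSet.toTop.map (K.proj T) (K.toSS (Realization.map hf' y)))
      (fun y : Realization (S.esd k) => SSet.toTop.map f (S.toSS (S.esdMap k y))) := by
  refine ⟨⟨fun p => SSet.toTop.map f (S.toSS (slide j hj p)),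
    (SSet.toTop.map f).hom.continuous.comp (S.continuous_toSS.comp (continuous_slide j hj))⟩,
    fun y => ?_, fun y => ?_⟩
  · change SSet.toTop.map f (S.toSS (slide j hj (0, y))) =
      SSet.toTop.map (K.proj T) (K.toSS (Realization.map hf' y))
    have hval : ∀ v, (slide j hj (0, y)).1 v = ∑ x, if j x = v then y.1 x else 0 := fun v => by
      simp [slide]
    obtain ⟨r, σ, hσ, τ, hτ, hστ, h⟩ := h _ y.2.2.2
    have hidx : ∀ x, ∃ i, y.1 x ≠ 0 → σ i = j x := fun x => by
      by_cases hx : y.1 x = 0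
      · exact ⟨0, fun h => absurd hx h⟩
      · rcases h with h | ⟨-, h, -⟩
        · obtain ⟨i, hi, -⟩ := h x (by simpa using hx)
          exact ⟨i, fun _ => hi⟩
        · obtain ⟨i, hi⟩ := h x (by simpa using hx)
          exact ⟨i, fun _ => hi⟩
    -- Pushing the weights forward along `idx` and then along `ρ` amounts to pushing them along `g`;
    -- the value of `idx` matters only where the weight is nonzero.
    have hpush : ∀ {U : Type} [DecidableEq U] (idx : S.EsdVertex k → Fin (r + 1))
        (ρ : Fin (r + 1) → U) (g : S.EsdVertex k → U) (_ : ∀ x, y.1 x ≠ 0 → ρ (idx x) = g x)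
        (u : U), (∑ i, if ρ i = u then (∑ x, if idx x = i then y.1 x else 0) else 0) =
          ∑ x, if g x = u then y.1 x else 0 := by
      intro U _ idx ρ g hg u
      have : ∀ i, (if ρ i = u then (∑ x, if idx x = i then y.1 x else 0) else 0) =
          ∑ x, if idx x = i then (if ρ i = u then y.1 x else 0) else 0 := fun i => by
        split_ifs <;> simp
      rw [Finset.sum_congr rfl fun i _ => this i, Finset.sum_comm]
      refine Finset.sum_congr rfl fun x _ => ?_
      rw [Finset.sum_ite_eq, if_pos (Finset.mem_univ _)]
      by_cases hx : y.1 x = 0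
      · simp [hx]
      · rw [hg x hx]
    let pt : (S.EsdVertex k → Fin (r + 1)) → stdSimplex ℝ (Fin (r + 1)) := fun idx =>
      ⟨fun i => ∑ x, if idx x = i then y.1 x else 0, fun i => Finset.sum_nonneg fun x _ => by
        split_ifs
        · exact y.2.1 x
        · exact le_rfl, by
        rw [Finset.sum_comm]
        simpa using y.2.2.1⟩
    rcases h with h | ⟨hτT, -, v, w, hvw, h⟩
    · have hidx' : ∀ x, ∃ i, y.1 x ≠ 0 → σ i = j x ∧ τ i = f' x := fun x => by
        by_cases hx : y.1 x = 0
        · exact ⟨0, fun h => absurd hx h⟩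
        · obtain ⟨i, hi⟩ := h x (by simpa using hx)
          exact ⟨i, fun _ => hi⟩
      choose idx hi using hidx'
      have e1 := S.toSS_eq_cellPoint (slide j hj (0, y)) hσ (pt idx) fun v =>
          (hpush idx σ j (fun x hx => (hi x hx).1) v).trans (hval v).symm
      have e2 := K.toSS_eq_cellPoint (Realization.map hf' y) hτ (pt idx)
          (hpush idx τ f' fun x hx => (hi x hx).2)
      refine (congrArg _ e1).trans ((toTop_map_cellPoint f _ _).trans (Eq.trans ?_
        ((congrArg _ e2).trans (toTop_map_cellPoint (K.proj T) _ _)).symm))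
      rw [hστ]
      rfl
    · choose idx hi using hidx
      obtain ⟨r', τ', hτ', t', ht', -, hne, -⟩ := K.toSS_spec (Realization.map hf' y)
      have hT' : InTree T τ' := by
        refine ⟨v, w, hvw, fun i => ?_⟩
        by_contra hcon
        refine hne i (Finset.sum_eq_zero fun x _ => ?_)
        split_ifs with hx
        · by_contra hy
          exact hcon (hx ▸ h x (by simpa using hy))
        · rfl
      have e1 := S.toSS_eq_cellPoint (slide j hj (0, y)) hσ (pt idx) fun v =>
          (hpush idx σ j hi v).trans (hval v).symm
      refine (congrArg _ e1).trans ((toTop_map_cellPoint f _ _).trans (Eq.trans ?_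
        ((congrArg _ ht').trans (toTop_map_cellPoint (K.proj T) _ _)).symm))
      rw [hστ]
      exact cellPoint_inTree hτ hτ' hτT hT' _ _
  · change SSet.toTop.map f (S.toSS (slide j hj (1, y))) = _
    have : slide j hj (1, y) = S.esdMap k y := Subtype.ext (funext fun v => by simp [slide])
    rw [this]

end OrderedComplex

/-! ### The edgewise subdivision triangulates -/

/-- The realization is closed in the standard simplex, being cut out by finitely many coordinate
faces. -/
theorem compactSpace_realization {V : Type} [Fintype V] (K : AbstractSimplicialComplex V) :
    CompactSpace (Realization K) := by
  let D : Set (V → ℝ) :=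
    {y | (∀ v, 0 ≤ y v) ∧ ∑ v, y v = 1 ∧ Finset.univ.filter (fun v => y v ≠ 0) ∈ K.faces}
  have hD : D = stdSimplex ℝ V ∩ ⋃ s : {s // s ∈ K.faces}, {y | ∀ v, v ∉ s.1 → y v = 0} := by
    ext y
    constructor
    · rintro ⟨h1, h2, h3⟩
      exact ⟨⟨h1, h2⟩, Set.mem_iUnion.2 ⟨⟨_, h3⟩, fun v hv => by simpa using hv⟩⟩
    · rintro ⟨⟨h1, h2⟩, h3⟩
      obtain ⟨s, hs⟩ := Set.mem_iUnion.1 h3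
      refine ⟨h1, h2, (K.isRelLowerSet_faces s.2).2 (fun v hv => ?_) ?_⟩
      · by_contra hcon
        exact (Finset.mem_filter.1 hv).2 (hs v hcon)
      · by_contra hcon
        rw [Finset.not_nonempty_iff_eq_empty, Finset.filter_eq_empty_iff] at hcon
        rw [Finset.sum_eq_zero fun v hv => not_not.1 (hcon hv)] at h2
        exact zero_ne_one h2
  have hc : IsCompact D := by
    rw [hD]
    refine (isCompact_stdSimplex ℝ V).inter_right (isClosed_iUnion_of_finite fun s => ?_)
    simp only [Set.ofPred_forall]
    exact isClosed_iInter fun v => isClosed_iInter fun _ =>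
      isClosed_eq (continuous_apply v) continuous_const
  exact isCompact_iff_compactSpace.1 hc

namespace OrderedComplex

variable {V : Type} [DecidableEq V]

theorem IsSeq.le_iff {K : OrderedComplex V} {n : ℕ} {e : Fin (n + 1) → V} (he : K.IsSeq e)
    (hinj : Function.Injective e) (i j : Fin (n + 1)) : K.le (e i) (e j) ↔ i ≤ j := by
  refine ⟨fun h => ?_, he.2 i j⟩
  by_contra hlt
  rw [not_le] at hlt
  have h3 : {e i, e j} ∈ K.faces := K.mem_faces_of_subset he.1
    (by intro v; simp only [Finset.mem_insert, Finset.mem_singleton]; rintro (rfl | rfl) <;> simp)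
    (by simp)
  exact hlt.ne' (hinj (K.le_antisymm _ _ h3 h (he.2 _ _ hlt.le)))

variable [Fintype V]

/-- `K.le` is uncontrolled between vertices without a common simplex, but `x` vanishes off the
simplex `e`, where `K.le` is the order of indices. -/
theorem cumSum_eq {K : OrderedComplex V} {n : ℕ} {e : Fin (n + 1) → V} (he : K.IsSeq e)
    (hinj : Function.Injective e) {x : V → ℕ} (hx : ∀ v, x v ≠ 0 → ∃ i, e i = v)
    (i : Fin (n + 1)) : K.cumSum x (e i) = ∑ j, if j ≤ i then x (e j) else 0 := by
  classical
  unfold cumSum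
  rw [← Finset.sum_subset (Finset.subset_univ (Finset.univ.image e)),
    Finset.sum_image fun _ _ _ _ h => hinj h]
  · exact Finset.sum_congr rfl fun j _ => by simp only [he.le_iff hinj]
  · intro v _ hv
    have : x v = 0 := by
      by_contra h
      obtain ⟨j, rfl⟩ := hx v h
      exact hv (Finset.mem_image_of_mem _ (Finset.mem_univ j))
    simp [this]

theorem cumSum_zero {K : OrderedComplex V} {n : ℕ} {e : Fin (n + 1) → V} (he : K.IsSeq e)
    (hinj : Function.Injective e) {x : V → ℕ} (hx : ∀ v, x v ≠ 0 → ∃ i, e i = v) :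
    K.cumSum x (e 0) = x (e 0) := by
  rw [cumSum_eq he hinj hx]
  simp

theorem cumSum_succ {K : OrderedComplex V} {n : ℕ} {e : Fin (n + 1) → V} (he : K.IsSeq e)
    (hinj : Function.Injective e) {x : V → ℕ} (hx : ∀ v, x v ≠ 0 → ∃ i, e i = v) (i : Fin n) :
    K.cumSum x (e i.succ) = K.cumSum x (e i.castSucc) + x (e i.succ) := by
  rw [cumSum_eq he hinj hx, cumSum_eq he hinj hx]
  have : ∀ j, (if j ≤ i.succ then x (e j) else 0) =
      (if j ≤ i.castSucc then x (e j) else 0) + if j = i.succ then x (e j) else 0 := by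
    intro j
    rcases lt_trichotomy j i.succ with hj | hj | hj
    · have : j ≤ i.castSucc := Fin.le_castSucc_iff.2 hj
      simp [hj.le, this, hj.ne]
    · subst hj
      simp [Fin.castSucc_lt_succ.not_ge]
    · have : ¬ j ≤ i.castSucc := fun h => (Fin.le_castSucc_iff.1 h).not_gt hj
      simp [hj.not_ge, this, hj.ne']
  rw [Finset.sum_congr rfl fun j _ => this j, Finset.sum_add_distrib]
  simp

/-- Coordinates are differences of consecutive partial sums. -/
theorem eq_of_cumSum_eq (K : OrderedComplex V) {F : Finset V} (hF : F ∈ K.faces) {x y : V → ℕ}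
    (hx : ∀ v, x v ≠ 0 → v ∈ F) (hy : ∀ v, y v ≠ 0 → v ∈ F)
    (h : ∀ v ∈ F, K.cumSum x v = K.cumSum y v) : x = y := by
  obtain ⟨n, e, he, hinj, him⟩ := K.exists_enum hF
  have hmem : ∀ v, v ∈ F ↔ ∃ i, e i = v := fun v => by simp [← him]
  have hx' := fun v hv => (hmem v).1 (hx v hv)
  have hy' := fun v hv => (hmem v).1 (hy v hv)
  have h' : ∀ i, K.cumSum x (e i) = K.cumSum y (e i) := fun i => h _ ((hmem _).2 ⟨i, rfl⟩)
  have key : ∀ i, x (e i) = y (e i) := by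
    intro i
    cases i using Fin.cases with
    | zero => rw [← cumSum_zero he hinj hx', h', cumSum_zero he hinj hy']
    | succ i =>
      have h1 := cumSum_succ he hinj hx' i
      have h2 := cumSum_succ he hinj hy' i
      rw [h', h'] at h1
      omega
  funext v
  by_cases hv : v ∈ F
  · obtain ⟨i, rfl⟩ := (hmem v).1 hv
    exact key i
  · rw [not_not.1 (mt (hx v) hv), not_not.1 (mt (hy v) hv)]

/-- Coordinates of vertices of a common simplex of the subdivision differ by at most one. -/
theorem coord_le_add_one (K : OrderedComplex V) {k : ℕ} {G : Finset (K.EsdVertex k)}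
    (hG : G ∈ (K.esd k).faces) {x y : K.EsdVertex k} (hx : x ∈ G) (hy : y ∈ G) (v : V) :
    x.1 v ≤ y.1 v + 1 := by
  by_cases hv : x.1 v = 0
  · omega
  obtain ⟨n, e, he, hinj, him⟩ := K.exists_enum hG.2.1
  have hmem : ∀ v, v ∈ K.carrier G ↔ ∃ i, e i = v := fun v => by simp [← him]
  have hsupp : ∀ x ∈ G, ∀ v, x.1 v ≠ 0 → ∃ i, e i = v := fun x hx v hv =>
    (hmem v).1 (mem_carrier.2 ⟨x, hx, hv⟩)
  have hm : ∀ i, e i ∈ K.carrier G := fun i => (hmem _).2 ⟨i, rfl⟩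
  obtain ⟨i, rfl⟩ := hsupp x hx v hv
  cases i using Fin.cases with
  | zero =>
    rw [← cumSum_zero he hinj (hsupp x hx), ← cumSum_zero he hinj (hsupp y hy)]
    rcases hG.2.2 x hx y hy with h | h
    · exact (h _ (hm 0)).1.trans (Nat.le_succ _)
    · exact (h _ (hm 0)).2
  | succ i =>
    -- The coordinate is a difference of two partial sums. From `x` to `y` both of these change by
    -- `0` or `1`, or both by `0` or `-1`, so the difference changes by at most one.
    have h1 := cumSum_succ he hinj (hsupp x hx) i
    have h2 := cumSum_succ he hinj (hsupp y hy) i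
    rcases hG.2.2 x hx y hy with h | h
    · have := h _ (hm i.castSucc)
      have := h _ (hm i.succ)
      omega
    · have := h _ (hm i.castSucc)
      have := h _ (hm i.succ)
      omega

theorem continuous_esdMap (K : OrderedComplex V) (k : ℕ) : Continuous (K.esdMap k) :=
  Continuous.subtype_mk (continuous_pi fun _ => continuous_finsetSum _ fun x _ =>
    ((continuous_apply x).comp continuous_subtype_val).mul continuous_const) _

/-- Consequently two points with the same image have the same carrier and can be compared by partial
sums on one simplex. -/
theorem carrier_support_eq (K : OrderedComplex V) {k : ℕ} (hk : 0 < k) (y : Realization (K.esd k)) :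
    K.carrier (Finset.univ.filter fun x => y.1 x ≠ 0) =
      Finset.univ.filter fun v => (K.esdMap k y).1 v ≠ 0 := by
  ext v
  have hnn : ∀ x : K.EsdVertex k, 0 ≤ y.1 x * ((x.1 v : ℝ) / k) := fun x =>
    mul_nonneg (y.2.1 x) (by positivity)
  have hv : (K.esdMap k y).1 v = ∑ x, y.1 x * ((x.1 v : ℝ) / k) := rfl
  rw [mem_carrier, Finset.mem_filter, hv, ne_eq,
    Finset.sum_eq_zero_iff_of_nonneg fun x _ => hnn x]
  simp only [Finset.mem_filter, Finset.mem_univ, true_and, true_imp_iff]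
  push Not
  exact exists_congr fun x => by simp [hk.ne']

open Classical in
/-- The weighted partial sums are determined by the image point. -/
theorem sum_mul_cumSum (K : OrderedComplex V) {k : ℕ} (hk : 0 < k) (y : Realization (K.esd k))
    (v : V) : ∑ x, y.1 x * (K.cumSum x.1 v : ℝ) =
      k * ∑ w, if K.le w v then (K.esdMap k y).1 w else 0 := by
  have hk' : (k : ℝ) ≠ 0 := by exact_mod_cast hk.ne'
  have h1 : ∀ x : K.EsdVertex k, y.1 x * (K.cumSum x.1 v : ℝ) =
      ∑ w, if K.le w v then k * (y.1 x * ((x.1 w : ℝ) / k)) else 0 := fun x => by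
    unfold cumSum
    push_cast
    rw [Finset.mul_sum]
    refine Finset.sum_congr rfl fun w _ => ?_
    split_ifs
    · field_simp
    · simp
  rw [Finset.sum_congr rfl fun x _ => h1 x, Finset.sum_comm, Finset.mul_sum]
  refine Finset.sum_congr rfl fun w _ => ?_
  split_ifs
  · rw [← Finset.mul_sum]
    rfl
  · simp

/-- The weight of the vertices whose partial sum at `v` is at least `a`. -/
theorem weight_le_cumSum (K : OrderedComplex V) {k : ℕ} (y : Realization (K.esd k)) {v : V}
    (hv : v ∈ K.carrier (Finset.univ.filter fun x => y.1 x ≠ 0)) (a : ℕ) :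
    (∑ x, if a ≤ K.cumSum x.1 v then y.1 x else 0) =
      max 0 (min 1 ((∑ x, y.1 x * (K.cumSum x.1 v : ℝ)) - a + 1)) := by
  set G := Finset.univ.filter fun x => y.1 x ≠ 0 with hG
  -- On the support, the partial sum at `v` is its minimum `b` or `b + 1`. Its mean is therefore `b
  -- + p`, where `p` is the weight of the value `b + 1`, and the formula can be checked for `a ≤ b`,
  -- `a = b + 1` and `a > b + 1`.
  obtain ⟨x₀, hx₀, hmin⟩ := Finset.exists_min_image G (fun x => K.cumSum x.1 v) y.2.2.2.1
  set b := K.cumSum x₀.1 v with hb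
  have hle : ∀ x, y.1 x ≠ 0 → b ≤ K.cumSum x.1 v ∧ K.cumSum x.1 v ≤ b + 1 := fun x hx => by
    have hx' : x ∈ G := by simpa [hG] using hx
    refine ⟨hmin x hx', ?_⟩
    rcases y.2.2.2.2.2 x₀ hx₀ x hx' with h | h
    · exact (h v hv).2
    · have := (h v hv).1
      omega
  have hsum := y.2.2.1
  have hz : ∀ f g : K.EsdVertex k → ℝ, (∀ x, y.1 x ≠ 0 → f x = g x) →
      ∑ x, y.1 x * f x = ∑ x, y.1 x * g x := fun f g h =>
    Finset.sum_congr rfl fun x _ => by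
      by_cases hx : y.1 x = 0
      · simp [hx]
      · rw [h x hx]
  set p := ∑ x, y.1 x * (if b + 1 ≤ K.cumSum x.1 v then (1 : ℝ) else 0) with hp
  have hp0 : 0 ≤ p := Finset.sum_nonneg fun x _ => mul_nonneg (y.2.1 x) (by split_ifs <;> simp)
  have hp1 : p ≤ 1 := by
    rw [← hsum]
    refine Finset.sum_le_sum fun x _ => ?_
    have := y.2.1 x
    split_ifs <;> simp [this]
  have hc : ∑ x, y.1 x * (K.cumSum x.1 v : ℝ) = b + p := by
    rw [hz (fun x => (K.cumSum x.1 v : ℝ))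
      (fun x => b + if b + 1 ≤ K.cumSum x.1 v then (1 : ℝ) else 0)]
    · simp only [mul_add, Finset.sum_add_distrib, ← Finset.sum_mul, hsum, one_mul, hp]
    · intro x hx
      obtain ⟨h1, h2⟩ := hle x hx
      split_ifs with h
      · have : K.cumSum x.1 v = b + 1 := _root_.le_antisymm h2 h
        rw [this]
        push_cast
        ring
      · have : K.cumSum x.1 v = b := by omega
        rw [this]
        ring
  have hl : (∑ x, if a ≤ K.cumSum x.1 v then y.1 x else 0) =
      ∑ x, y.1 x * if a ≤ K.cumSum x.1 v then (1 : ℝ) else 0 :=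
    Finset.sum_congr rfl fun x _ => by split_ifs <;> simp
  rw [hl, hc]
  rcases lt_trichotomy a (b + 1) with h | h | h
  · rw [hz _ (fun _ => 1) fun x hx => if_pos (by have := hle x hx; omega)]
    have : (a : ℝ) ≤ b := by exact_mod_cast Nat.lt_succ_iff.1 h
    rw [min_eq_left (by linarith)]
    simpa using hsum
  · subst h
    push_cast
    rw [min_eq_right (by linarith), max_eq_right (by linarith)]
    linarith
  · rw [hz _ (fun _ => 0) fun x hx => if_neg (by have := hle x hx; omega)]
    have : (b : ℝ) + 1 + 1 ≤ a := by exact_mod_cast h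
    rw [max_eq_left (min_le_of_right_le (by linarith))]
    simp

/-- Among the conditions `a v ≤ cumSum x v` one implies the others, on a simplex. -/
theorem exists_strongest (K : OrderedComplex V) {k : ℕ} {G : Finset (K.EsdVertex k)}
    (hG : G ∈ (K.esd k).faces) (a : V → ℕ) :
    ∃ v ∈ K.carrier G, ∀ x ∈ G, a v ≤ K.cumSum x.1 v →
      ∀ u ∈ K.carrier G, a u ≤ K.cumSum x.1 u := by
  classical
  -- The vertices of `G` form a chain. A condition violated by the largest vertex `x₀` in `B` is
  -- violated by all smaller ones, hence by all of `B`, so it implies the other conditions.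
  let B := G.filter fun x => ¬ ∀ u ∈ K.carrier G, a u ≤ K.cumSum x.1 u
  by_cases hB : B.Nonempty
  · obtain ⟨x₀, hx₀, hmax⟩ := Finset.exists_max_image B
      (fun x => ∑ u ∈ K.carrier G, K.cumSum x.1 u) hB
    obtain ⟨hx₀G, hx₀'⟩ := Finset.mem_filter.1 hx₀
    push Not at hx₀'
    obtain ⟨v, hv, hlt⟩ := hx₀'
    refine ⟨v, hv, fun x hx hav => ?_⟩
    by_contra hcon
    have h1 := hmax x (Finset.mem_filter.2 ⟨hx, hcon⟩)
    rcases hG.2.2 x hx x₀ hx₀G with h | h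
    · have := (h v hv).1
      omega
    · have h2 := (Finset.sum_eq_sum_iff_of_le fun u hu => (h u hu).1).1
        (_root_.le_antisymm (Finset.sum_le_sum fun u hu => (h u hu).1) h1) v hv
      omega
  · obtain ⟨v, hv⟩ := (K.isRelLowerSet_faces hG.2.1).1
    refine ⟨v, hv, fun x hx _ => ?_⟩
    by_contra hcon
    exact hB ⟨x, Finset.mem_filter.2 ⟨hx, hcon⟩⟩

/-- The image determines the mean of every partial sum, hence by `weight_le_cumSum` the weight of
every set given by one lower bound on a partial sum. By `exists_strongest` it also determines the
weights of intersections of such sets. Among these are the sets of vertices above a given vertex,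
and their weights determine all coefficients. -/
theorem esdMap_injective (K : OrderedComplex V) {k : ℕ} (hk : 0 < k) :
    Function.Injective (K.esdMap k) := by
  classical
  intro y y' h
  set F := Finset.univ.filter fun v => (K.esdMap k y).1 v ≠ 0 with hF
  have hFy : K.carrier (Finset.univ.filter fun x => y.1 x ≠ 0) = F := K.carrier_support_eq hk y
  have hFy' : K.carrier (Finset.univ.filter fun x => y'.1 x ≠ 0) = F := by
    rw [K.carrier_support_eq hk y', ← h]
  have hsupp : ∀ x : K.EsdVertex k, y.1 x ≠ 0 ∨ y'.1 x ≠ 0 → ∀ v, x.1 v ≠ 0 → v ∈ F := by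
    rintro x (hx | hx) v hv
    · rw [← hFy, mem_carrier]
      exact ⟨x, by simpa using hx, hv⟩
    · rw [← hFy', mem_carrier]
      exact ⟨x, by simpa using hx, hv⟩
  have hw : ∀ v ∈ F, ∀ a : ℕ, (∑ x, if a ≤ K.cumSum x.1 v then y.1 x else 0) =
      ∑ x, if a ≤ K.cumSum x.1 v then y'.1 x else 0 := by
    intro v hv a
    rw [K.weight_le_cumSum y (hFy.symm ▸ hv), K.weight_le_cumSum y' (hFy'.symm ▸ hv),
      K.sum_mul_cumSum hk, K.sum_mul_cumSum hk, h]
  have hle : ∀ (z z' : Realization (K.esd k)),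
      K.carrier (Finset.univ.filter fun x => z.1 x ≠ 0) = F →
      (∀ v ∈ F, ∀ a : ℕ, (∑ x, if a ≤ K.cumSum x.1 v then z'.1 x else 0) =
        ∑ x, if a ≤ K.cumSum x.1 v then z.1 x else 0) → ∀ a : V → ℕ,
      (∑ x, if ∀ v ∈ F, a v ≤ K.cumSum x.1 v then z'.1 x else 0) ≤
        ∑ x, if ∀ v ∈ F, a v ≤ K.cumSum x.1 v then z.1 x else 0 := by
    -- `v` is the strongest condition for the simplex of `z`. For `z'` the intersection weighs at
    -- most as much as this one condition, whose weight is the same for `z`, where it already is the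
    -- weight of the intersection.
    intro z z' hz hzz a
    obtain ⟨v, hv, hv'⟩ := K.exists_strongest z.2.2.2 a
    rw [hz] at hv hv'
    calc _ ≤ ∑ x, if a v ≤ K.cumSum x.1 v then z'.1 x else 0 := by
          refine Finset.sum_le_sum fun x _ => ?_
          have := z'.2.1 x
          split_ifs with h1 h2
          · exact le_rfl
          · exact absurd (h1 v hv) h2
          · exact this
          · exact le_rfl
      _ = ∑ x, if a v ≤ K.cumSum x.1 v then z.1 x else 0 := hzz v hv _
      _ ≤ _ := by
          refine Finset.sum_le_sum fun x _ => ?_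
          have := z.2.1 x
          split_ifs with h1 h2
          · exact le_rfl
          · by_contra hne
            exact h2 (hv' x (by simpa using fun h0 => hne h0.le) h1)
          · exact this
          · exact le_rfl
  have hww : ∀ a : V → ℕ, (∑ x, if ∀ v ∈ F, a v ≤ K.cumSum x.1 v then y.1 x else 0) =
      ∑ x, if ∀ v ∈ F, a v ≤ K.cumSum x.1 v then y'.1 x else 0 := fun a =>
    _root_.le_antisymm (hle y' y hFy' hw a) (hle y y' hFy (fun v hv a => (hw v hv a).symm) a)
  by_contra hne
  -- Choose `x₀` with the largest total of partial sums among the vertices where the weights differ.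
  -- The set of vertices above `x₀` then meets `D` in `x₀` alone, so its weights for `y` and `y'`
  -- would differ.
  let D := Finset.univ.filter fun x => y.1 x ≠ y'.1 x
  have hD : D.Nonempty := by
    by_contra hcon
    rw [Finset.not_nonempty_iff_eq_empty, Finset.filter_eq_empty_iff] at hcon
    exact hne (Subtype.ext (funext fun x => not_not.1 (hcon (Finset.mem_univ x))))
  have hDs : ∀ x, y.1 x ≠ y'.1 x → y.1 x ≠ 0 ∨ y'.1 x ≠ 0 := fun x hx => by
    by_contra hcon
    push Not at hcon
    exact hx (hcon.1.trans hcon.2.symm)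
  obtain ⟨x₀, hx₀, hmax⟩ := Finset.exists_max_image D (fun x => ∑ u ∈ F, K.cumSum x.1 u) hD
  have hx₀' : y.1 x₀ ≠ y'.1 x₀ := (Finset.mem_filter.1 hx₀).2
  have h1 := sub_eq_zero.2 (hww (K.cumSum x₀.1))
  rw [← Finset.sum_sub_distrib, Finset.sum_eq_single x₀] at h1
  · rw [if_pos fun _ _ => le_rfl, if_pos fun _ _ => le_rfl] at h1
    exact hx₀' (sub_eq_zero.1 h1)
  · intro x _ hx
    split_ifs with hc
    · rw [sub_eq_zero]
      by_contra hd
      have h2 := (Finset.sum_eq_sum_iff_of_le hc).1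
        (_root_.le_antisymm (Finset.sum_le_sum hc) (hmax x (by simpa [D] using hd)))
      exact hx (Subtype.ext (K.eq_of_cumSum_eq (K.esdMap k y).2.2.2
        (hsupp x (hDs x hd)) (hsupp x₀ (hDs x₀ hx₀')) fun v hv => (h2 v hv).symm))
    · simp
  · simp

end OrderedComplex

open MeasureTheory in
/-- The mean over the phase `t` of the rounded value `⌊c + t⌋` is `c`. -/
theorem integral_floor_add (c : ℝ) (hc : 0 ≤ c) :
    ∫ t in Set.Ico (0 : ℝ) 1, (⌊c + Int.fract t⌋₊ : ℝ) = c := by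
  set r := c - ⌊c⌋₊ with hr
  have hr0 : 0 ≤ r := sub_nonneg.2 (Nat.floor_le hc)
  have hr1 : r < 1 := by have := Nat.lt_floor_add_one c; linarith
  -- The floor jumps from `⌊c⌋₊` to `⌊c⌋₊ + 1` at `t = 1 - r`, so the larger value is taken on an
  -- interval of length `r`.
  have h1 : ∀ t ∈ Set.Ico (0 : ℝ) 1, (⌊c + Int.fract t⌋₊ : ℝ) =
      ⌊c⌋₊ + (Set.Ico (1 - r) 1).indicator (fun _ => (1 : ℝ)) t := by
    intro t ht
    rw [Int.fract_eq_self.2 ht]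
    by_cases h : 1 - r ≤ t
    · rw [Set.indicator_of_mem (show t ∈ Set.Ico (1 - r) 1 from ⟨h, ht.2⟩)]
      have : ⌊c + t⌋₊ = ⌊c⌋₊ + 1 := by
        rw [Nat.floor_eq_iff (by linarith [ht.1])]
        push_cast
        constructor <;> linarith [ht.2]
      rw [this]
      push_cast
      ring
    · rw [Set.indicator_of_notMem fun hm => h hm.1]
      have : ⌊c + t⌋₊ = ⌊c⌋₊ := by
        rw [Nat.floor_eq_iff (by linarith [ht.1])]
        constructor <;> linarith [ht.1]
      rw [this, add_zero]
  rw [setIntegral_congr_fun measurableSet_Ico h1, integral_add (by simp)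
    ((integrable_indicator_iff measurableSet_Ico).2 (by
      simpa using (measure_mono Set.inter_subset_left).trans_lt measure_Ico_lt_top)),
    integral_indicator measurableSet_Ico, Measure.restrict_restrict measurableSet_Ico,
    Set.inter_eq_left.2 (Set.Ico_subset_Ico_left (by linarith))]
  simp [hr0]
  linarith

/-! ### Surjectivity of the subdivision map by random rounding -/

namespace OrderedComplex

variable {V : Type} [DecidableEq V]

/-- The vector whose partial sums along the sequence `e` are `A 1, A 2, …`, if `A 0 = 0`. -/
def ofPartialSums {n : ℕ} (e : Fin (n + 1) → V) (A : ℕ → ℕ) (v : V) : ℕ :=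
  ∑ i, if e i = v then A (i.1 + 1) - A i.1 else 0

theorem ofPartialSums_apply {n : ℕ} {e : Fin (n + 1) → V} (hinj : Function.Injective e) (A : ℕ → ℕ)
    (i : Fin (n + 1)) : ofPartialSums e A (e i) = A (i.1 + 1) - A i.1 := by
  unfold ofPartialSums
  rw [Finset.sum_eq_single i, if_pos rfl]
  · intro j _ hj
    exact if_neg fun h => hj (hinj h)
  · simp

theorem exists_of_ofPartialSums_ne_zero {n : ℕ} {e : Fin (n + 1) → V} {A : ℕ → ℕ} {v : V}
    (h : ofPartialSums e A v ≠ 0) : ∃ i, e i = v := by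
  by_contra hcon
  push Not at hcon
  exact h (Finset.sum_eq_zero fun i _ => if_neg (hcon i))

variable [Fintype V]

theorem sum_ofPartialSums {n : ℕ} (e : Fin (n + 1) → V) {A : ℕ → ℕ} (hA : Monotone A)
    (hA0 : A 0 = 0) : ∑ v, ofPartialSums e A v = A (n + 1) := by
  unfold ofPartialSums
  rw [Finset.sum_comm]
  simp only [Finset.sum_ite_eq, Finset.mem_univ, if_true]
  rw [Fin.sum_univ_eq_sum_range (fun i => A (i + 1) - A i) (n + 1), Finset.sum_range_tsub hA, hA0,
    Nat.sub_zero]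

theorem cumSum_ofPartialSums {K : OrderedComplex V} {n : ℕ} {e : Fin (n + 1) → V} (he : K.IsSeq e)
    (hinj : Function.Injective e) {A : ℕ → ℕ} (hA : Monotone A) (hA0 : A 0 = 0) (i : Fin (n + 1)) :
    K.cumSum (ofPartialSums e A) (e i) = A (i.1 + 1) := by
  rw [cumSum_eq he hinj fun v hv => exists_of_ofPartialSums_ne_zero hv]
  simp only [ofPartialSums_apply hinj]
  have : ∀ j : Fin (n + 1), (if j ≤ i then A (j.1 + 1) - A j.1 else 0) =
      (fun l => if l ≤ i.1 then A (l + 1) - A l else 0) j.1 := fun j => by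
    simp only [Fin.le_def]
  rw [Finset.sum_congr rfl fun j _ => this j, Fin.sum_univ_eq_sum_range
    (fun l => if l ≤ i.1 then A (l + 1) - A l else 0) (n + 1), ← Finset.sum_subset (s₁ := Finset.range (i.1 + 1))]
  · rw [Finset.sum_congr rfl fun l hl =>
      if_pos (Nat.lt_succ_iff.1 (Finset.mem_range.1 hl)), Finset.sum_range_tsub hA, hA0,
      Nat.sub_zero]
  · intro l hl
    have := Finset.mem_range.1 hl
    have := i.2
    exact Finset.mem_range.2 (by omega)
  · intro l _ hl
    rw [Finset.mem_range] at hl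
    exact if_neg (by omega)

open MeasureTheory in
-- The partial sums `C i` of `k z` are rounded with a common phase `t`, which gives a vertex `X t`.
-- The law `ν` of `X`, for `t` uniform in `[0, 1)`, supplies the barycentric coordinates, and
-- `integral_floor_add` shows that the mean is right. Between two phases all rounded partial sums
-- move in the same direction by at most one, so the values of `X` span a simplex.
theorem esdMap_surjective (K : OrderedComplex V) {k : ℕ} (hk : 0 < k) :
    Function.Surjective (K.esdMap k) := by
  intro z
  obtain ⟨n, e, he, hinj, him⟩ := K.exists_enum z.2.2.2
  have hk' : (k : ℝ) ≠ 0 := by exact_mod_cast hk.ne'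
  have hz : ∀ v, z.1 v ≠ 0 → ∃ i, e i = v := fun v hv => by
    have : v ∈ Finset.univ.image e := him ▸ Finset.mem_filter.2 ⟨Finset.mem_univ _, hv⟩
    simpa using this
  let w : ℕ → ℝ := fun i => if h : i < n + 1 then k * z.1 (e ⟨i, h⟩) else 0
  have hw0 : ∀ i, 0 ≤ w i := fun i => by
    simp only [w]
    split_ifs
    · exact mul_nonneg (Nat.cast_nonneg _) (z.2.1 _)
    · exact le_rfl
  let C : ℕ → ℝ := fun i => ∑ j ∈ Finset.range i, w j
  have hC : Monotone C := fun i j hij =>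
    Finset.sum_le_sum_of_subset_of_nonneg (Finset.range_subset_range.2 hij) fun _ _ _ => hw0 _
  have hC0 : ∀ i, 0 ≤ C i := fun i => Finset.sum_nonneg fun j _ => hw0 j
  have hCn : C (n + 1) = k := by
    have h1 : C (n + 1) = ∑ i : Fin (n + 1), w i.1 := (Fin.sum_univ_eq_sum_range w (n + 1)).symm
    have h2 : ∀ i : Fin (n + 1), w i.1 = k * z.1 (e i) := fun i => dif_pos i.2
    have h3 : ∑ i, z.1 (e i) = 1 := by
      rw [← Finset.sum_image (s := Finset.univ) (f := z.1) (fun i _ j _ hij => hinj hij), him,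
        Finset.sum_filter_ne_zero]
      exact z.2.2.1
    rw [h1, Finset.sum_congr rfl fun i _ => h2 i, ← Finset.mul_sum, h3, mul_one]
  -- The fractional part turns every real number into a phase in `[0, 1)`. Thus `A t 0 = 0` and `A t
  -- (n + 1) = k` for all `t`, and `X` is defined on the whole line.
  let A : ℝ → ℕ → ℕ := fun t i => ⌊C i + Int.fract t⌋₊
  have hA : ∀ t, Monotone (A t) := fun t i j hij => Nat.floor_le_floor (by linarith [hC hij])
  have hA0 : ∀ t, A t 0 = 0 := fun t => by
    simp only [A, C, Finset.range_zero, Finset.sum_empty, zero_add]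
    exact Nat.floor_eq_zero.2 (Int.fract_lt_one t)
  have hAn : ∀ t, A t (n + 1) = k := fun t => by
    simp only [A, hCn]
    rw [Nat.floor_eq_iff (add_nonneg (Nat.cast_nonneg _) (Int.fract_nonneg t))]
    constructor <;> linarith [Int.fract_nonneg t, Int.fract_lt_one t]
  have hsum : ∀ t, ∑ v, ofPartialSums e (A t) v = k := fun t => by
    rw [sum_ofPartialSums e (hA t) (hA0 t), hAn]
  have hsub : ∀ t v, ofPartialSums e (A t) v ≠ 0 →
      v ∈ Finset.univ.filter fun v => z.1 v ≠ 0 := fun t v hv => by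
    obtain ⟨i, rfl⟩ := exists_of_ofPartialSums_ne_zero hv
    rw [← him]
    exact Finset.mem_image_of_mem _ (Finset.mem_univ i)
  let X : ℝ → K.EsdVertex k := fun t => ⟨ofPartialSums e (A t), hsum t,
    K.mem_faces_of_subset z.2.2.2 (fun v hv => hsub t v (Finset.mem_filter.1 hv).2) (by
      by_contra hcon
      rw [Finset.not_nonempty_iff_eq_empty, Finset.filter_eq_empty_iff] at hcon
      have := hsum t
      rw [Finset.sum_eq_zero fun v hv => not_not.1 (hcon hv)] at this
      omega)⟩
  let _ : MeasurableSpace (K.EsdVertex k) := ⊤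
  have : MeasurableSingletonClass (K.EsdVertex k) := ⟨fun _ => trivial⟩
  have hXm : Measurable X := by
    refine measurable_to_countable' fun x => ?_
    have : X ⁻¹' {x} = ⋂ v, {t | ofPartialSums e (A t) v = x.1 v} := by
      ext t
      simp only [Set.mem_preimage, Set.mem_singleton_iff, Set.mem_iInter, Set.mem_ofPred_eq]
      exact ⟨fun h v => by rw [← h], fun h => Subtype.ext (funext h)⟩
    rw [this]
    refine MeasurableSet.iInter fun v => ?_
    have hm : Measurable fun t => ofPartialSums e (A t) v := by
      refine Finset.measurable_sum _ fun i _ => ?_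
      split_ifs
      · exact (Nat.measurable_floor.comp (measurable_const.add measurable_fract)).sub
          (Nat.measurable_floor.comp (measurable_const.add measurable_fract))
      · exact measurable_const
    exact hm (measurableSet_singleton (x.1 v))
  let μ : Measure ℝ := volume.restrict (Set.Ico (0 : ℝ) 1)
  have : IsProbabilityMeasure μ := ⟨by simp [μ]⟩
  let ν : Measure (K.EsdVertex k) := μ.map X
  have : IsProbabilityMeasure ν := Measure.isProbabilityMeasure_map hXm.aemeasurable
  have hint : ∀ g : K.EsdVertex k → ℝ, ∑ x, ν.real {x} * g x = ∫ t, g (X t) ∂μ := fun g => by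
    rw [← integral_map hXm.aemeasurable (Measurable.aestronglyMeasurable (measurable_from_top)),
      integral_fintype (Integrable.of_finite)]
    simp [ν]
  have hone : ∑ x, ν.real {x} = 1 := by
    simpa only [mul_one, integral_const, probReal_univ, one_smul] using hint fun _ => 1
  have hval : ∀ v, ∑ x, ν.real {x} * ((x.1 v : ℝ) / k) = z.1 v := by
    intro v
    rw [hint fun x => (x.1 v : ℝ) / k]
    by_cases hv : z.1 v = 0
    · have : ∀ t, ofPartialSums e (A t) v = 0 := fun t => by
        by_contra h
        exact (Finset.mem_filter.1 (hsub t v h)).2 hv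
      simp [X, this, hv]
    · obtain ⟨i, rfl⟩ := hz v hv
      have h1 : ∀ t, (((X t).1 (e i) : ℝ) / k) =
          (A t (i.1 + 1) : ℝ) / k - (A t i.1 : ℝ) / k := fun t => by
        simp only [X, ofPartialSums_apply hinj]
        rw [Nat.cast_sub (hA t (Nat.le_succ _)), sub_div]
      have hi : ∀ j, Integrable (fun t => (A t j : ℝ) / k) μ := fun j => by
        refine Integrable.div_const ?_ _
        refine Integrable.of_bound (C := C j + 1) (Measurable.aestronglyMeasurable
          (measurable_from_top.comp
            (Nat.measurable_floor.comp (measurable_const.add measurable_fract))))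
          (Filter.Eventually.of_forall fun t => ?_)
        rw [Real.norm_of_nonneg (Nat.cast_nonneg _)]
        exact (Nat.floor_le (add_nonneg (hC0 j) (Int.fract_nonneg t))).trans
          (by linarith [Int.fract_lt_one t])
      have hAi : ∀ j, ∫ t, (A t j : ℝ) / k ∂μ = C j / k := fun j => by
        rw [integral_div, integral_floor_add _ (hC0 j)]
      rw [integral_congr_ae (Filter.Eventually.of_forall h1), integral_sub (hi _) (hi _), hAi, hAi,
        ← sub_div]
      have : C (i.1 + 1) - C i.1 = k * z.1 (e i) := by
        simp only [C, Finset.sum_range_succ, add_sub_cancel_left]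
        exact dif_pos i.2
      rw [this]
      field_simp
  -- A vertex of positive weight is a value of `X`, which reduces the simplex condition to a
  -- comparison of two phases.
  have hex : ∀ x, ν.real {x} ≠ 0 → ∃ t, X t = x := fun x hx => by
    by_contra hcon
    push Not at hcon
    refine hx ?_
    rw [map_measureReal_apply hXm (measurableSet_singleton x)]
    have : X ⁻¹' {x} = ∅ := Set.eq_empty_of_forall_notMem fun t ht => hcon t ht
    rw [this]
    simp
  let y : Realization (K.esd k) := ⟨fun x => ν.real {x}, fun x => measureReal_nonneg, hone, by
    have hcar : K.carrier (Finset.univ.filter fun x => ν.real {x} ≠ 0) ⊆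
        Finset.univ.filter fun v => z.1 v ≠ 0 := fun v hv => by
      obtain ⟨x, hx, hxv⟩ := mem_carrier.1 hv
      obtain ⟨t, rfl⟩ := hex x (Finset.mem_filter.1 hx).2
      exact hsub t v hxv
    have hne : (Finset.univ.filter fun x => ν.real {x} ≠ 0).Nonempty := by
      by_contra hcon
      rw [Finset.not_nonempty_iff_eq_empty, Finset.filter_eq_empty_iff] at hcon
      rw [Finset.sum_eq_zero fun x hx => not_not.1 (hcon hx)] at hone
      exact zero_ne_one hone
    refine ⟨hne, K.mem_faces_of_subset z.2.2.2 hcar ?_, ?_⟩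
    · obtain ⟨x, hx⟩ := hne
      obtain ⟨v, hv⟩ := (K.isRelLowerSet_faces x.2.2).1
      exact ⟨v, mem_carrier.2 ⟨x, hx, (Finset.mem_filter.1 hv).2⟩⟩
    · intro x hx x' hx'
      obtain ⟨t, rfl⟩ := hex x (Finset.mem_filter.1 hx).2
      obtain ⟨t', rfl⟩ := hex x' (Finset.mem_filter.1 hx').2
      have key : ∀ t t', Int.fract t ≤ Int.fract t' → ∀ v ∈ K.carrier
          (Finset.univ.filter fun x => ν.real {x} ≠ 0),
          K.cumSum (X t).1 v ≤ K.cumSum (X t').1 v ∧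
            K.cumSum (X t').1 v ≤ K.cumSum (X t).1 v + 1 := by
        intro t t' htt v hv
        obtain ⟨i, rfl⟩ := hz v (Finset.mem_filter.1 (hcar hv)).2
        simp only [X, cumSum_ofPartialSums he hinj (hA _) (hA0 _)]
        refine ⟨Nat.floor_le_floor (by linarith), ?_⟩
        rw [← Nat.floor_add_one (add_nonneg (hC0 _) (Int.fract_nonneg _))]
        exact Nat.floor_le_floor (by linarith [Int.fract_lt_one t', Int.fract_nonneg t])
      exact (_root_.le_total (Int.fract t) (Int.fract t')).imp (key t t') (key t' t)⟩
  exact ⟨y, Subtype.ext (funext hval)⟩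

theorem isHomeomorph_esdMap (K : OrderedComplex V) {k : ℕ} (hk : 0 < k) :
    IsHomeomorph (K.esdMap k) := by
  have := compactSpace_realization (K.esd k)
  exact isHomeomorph_iff_continuous_bijective.2
    ⟨K.continuous_esdMap k, K.esdMap_injective hk, K.esdMap_surjective hk⟩

end OrderedComplex

/-! ### Ancestors in a rooted tree -/

theorem SimpleGraph.Connected.exists_adj_dist_add_one {V : Type*} {G : SimpleGraph V}
    (hG : G.Connected) {r v : V} (h : v ≠ r) : ∃ u, G.Adj u v ∧ G.dist r u + 1 = G.dist r v := by
  obtain ⟨p, hp⟩ := hG.exists_walk_length_eq_dist v r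
  cases p with
  | nil => exact absurd rfl h
  | @cons _ u _ hadj p =>
    refine ⟨u, hadj.symm, ?_⟩
    rw [SimpleGraph.Walk.length_cons] at hp
    have h1 := SimpleGraph.dist_le p
    have h2 := hG.dist_triangle (u := v) (v := u) (w := r)
    rw [SimpleGraph.dist_eq_one_iff_adj.2 hadj] at h2
    rw [SimpleGraph.dist_comm, SimpleGraph.dist_comm (u := r)]
    omega

/-- Shortest walks from `r` to `u` and to `w`, prolonged to `v`, are again shortest and hence paths.
Paths in a tree are unique, so their penultimate vertices agree. -/
theorem SimpleGraph.IsTree.eq_of_adj_of_dist_add_one {V : Type*} {G : SimpleGraph V}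
    (hG : G.IsTree) {r u w v : V} (hu : G.Adj u v) (hw : G.Adj w v)
    (hu' : G.dist r u + 1 = G.dist r v) (hw' : G.dist r w + 1 = G.dist r v) : u = w := by
  classical
  obtain ⟨p, hp⟩ := hG.connected.exists_walk_length_eq_dist r u
  obtain ⟨q, hq⟩ := hG.connected.exists_walk_length_eq_dist r w
  have h1 : (p.concat hu).IsPath := SimpleGraph.Walk.isPath_of_length_eq_dist _ (by
    rw [SimpleGraph.Walk.length_concat]; omega)
  have h2 : (q.concat hw).IsPath := SimpleGraph.Walk.isPath_of_length_eq_dist _ (by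
    rw [SimpleGraph.Walk.length_concat]; omega)
  have h3 := (hG.existsUnique_path r v).unique h1 h2
  have h4 := congrArg SimpleGraph.Walk.penultimate h3
  simpa using h4

namespace Alg

theorem has_eq_true {l : List ℕ} {v : ℕ} : has l v = true ↔ v ∈ l := by
  simp [has]

variable {n : ℕ} {T : SimpleGraph (Fin n)} {LT : List (ℕ × ℕ)}

theorem mem_reach (hn : 0 < n) (hT : T.IsTree)
    (hLT : ∀ u v : Fin n, adj LT u v = true ↔ T.Adj u v) (i : ℕ) (v : Fin n) :
    v.1 ∈ reach n LT i ↔ T.dist ⟨0, hn⟩ v ≤ i := by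
  induction i generalizing v with
  | zero =>
    rw [Nat.le_zero, hT.connected.dist_eq_zero_iff]
    simp [reach, Fin.ext_iff, eq_comm]
  | succ i ih =>
    have hlt : ∀ u ∈ reach n LT i, u < n := fun u hu => by
      cases i with
      | zero =>
        have : u = 0 := by simpa [reach] using hu
        omega
      | succ i =>
        unfold reach at hu
        rw [Function.iterate_succ_apply'] at hu
        exact List.mem_range.1 (List.mem_filter.1 hu).1
    have hstep : v.1 ∈ reach n LT (i + 1) ↔
        ∃ u : Fin n, u.1 ∈ reach n LT i ∧ (u = v ∨ T.Adj u v) := by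
      have : reach n LT (i + 1) = nbhd n LT (reach n LT i) := by
        unfold reach
        rw [Function.iterate_succ_apply']
      rw [this]
      simp only [nbhd, List.mem_filter, List.mem_range, v.2, true_and, List.any_eq_true,
        Bool.or_eq_true, decide_eq_true_eq]
      constructor
      · rintro ⟨u, hu, h⟩
        refine ⟨⟨u, hlt u hu⟩, hu, h.imp (fun h => Fin.ext h) fun h => (hLT ⟨u, hlt u hu⟩ v).1 h⟩
      · rintro ⟨u, hu, h⟩
        exact ⟨u.1, hu, h.imp (fun h => congrArg Fin.val h) (hLT u v).2⟩
    rw [hstep]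
    constructor
    · rintro ⟨u, hu, rfl | h⟩
      · exact ((ih u).1 hu).trans (Nat.le_succ i)
      · have h1 := (ih u).1 hu
        have h2 := hT.connected.dist_triangle (u := ⟨0, hn⟩) (v := u) (w := v)
        rw [SimpleGraph.dist_eq_one_iff_adj.2 h] at h2
        omega
    · intro h
      by_cases hv : v = ⟨0, hn⟩
      · refine ⟨v, (ih v).2 ?_, Or.inl rfl⟩
        rw [hv, SimpleGraph.dist_self]
        exact Nat.zero_le _
      · obtain ⟨u, hu, hu'⟩ := hT.connected.exists_adj_dist_add_one hv
        exact ⟨u, (ih u).2 (by omega), Or.inr hu⟩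

theorem length_filter_range_lt (n D : ℕ) :
    ((List.range n).filter fun i => decide (i < D)).length = min n D := by
  induction n with
  | zero => simp
  | succ n ih =>
    rw [List.range_succ, List.filter_append, List.length_append, ih]
    by_cases h : n < D
    · simp [h]; omega
    · simp [h]; omega

theorem depth_eq (hn : 0 < n) (hT : T.IsTree)
    (hLT : ∀ u v : Fin n, adj LT u v = true ↔ T.Adj u v) (v : Fin n) :
    depth n LT v = T.dist ⟨0, hn⟩ v := by
  have h : ∀ i, (!has (reach n LT i) v.1) = decide (i < T.dist ⟨0, hn⟩ v) := fun i => by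
    rw [Bool.eq_iff_iff, Bool.not_eq_true', Bool.eq_false_iff, ne_eq, has_eq_true,
      mem_reach hn hT hLT, decide_eq_true_eq, not_le]
  unfold depth
  rw [List.filter_congr fun i _ => h i, length_filter_range_lt]
  -- Counting only `n` levels loses nothing: a path has fewer edges than the graph has vertices.
  refine min_eq_right ?_
  obtain ⟨p, hp, hl⟩ := (hT.connected ⟨0, hn⟩ v).exists_path_of_dist
  rw [← hl]
  simpa using hp.length_lt.le

theorem headD_mem {α : Type} {l : List α} (hl : l ≠ []) (d : α) : l.headD d ∈ l := by
  cases l with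
  | nil => exact absurd rfl hl
  | cons a l => simp

theorem par_lt (hn : 0 < n) (LT : List (ℕ × ℕ)) (v : ℕ) : par n LT v < n := by
  unfold par
  by_cases h : ((List.range n).filter fun u => adj LT u v &&
      decide (depth n LT u + 1 = depth n LT v)) = []
  · rw [h]
    exact hn
  · exact List.mem_range.1 (List.mem_filter.1 (headD_mem h 0)).1

theorem par_spec (hn : 0 < n) (hT : T.IsTree)
    (hLT : ∀ u v : Fin n, adj LT u v = true ↔ T.Adj u v) {v : Fin n} (hv : v ≠ ⟨0, hn⟩) :
    T.Adj ⟨par n LT v, par_lt hn LT v⟩ v ∧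
      T.dist ⟨0, hn⟩ ⟨par n LT v, par_lt hn LT v⟩ + 1 = T.dist ⟨0, hn⟩ v := by
  have hmem : ∀ u : Fin n, u.1 ∈ ((List.range n).filter fun u => adj LT u v.1 &&
      decide (depth n LT u + 1 = depth n LT v.1)) ↔
      T.Adj u v ∧ T.dist ⟨0, hn⟩ u + 1 = T.dist ⟨0, hn⟩ v := fun u => by
    rw [List.mem_filter, Bool.and_eq_true, decide_eq_true_eq, depth_eq hn hT hLT,
      depth_eq hn hT hLT, hLT]
    simp
  obtain ⟨u, hu⟩ := hT.connected.exists_adj_dist_add_one hv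
  have := headD_mem (List.ne_nil_of_mem ((hmem u).2 hu)) 0
  exact (hmem ⟨par n LT v, par_lt hn LT v⟩).1 this

theorem par_root (hn : 0 < n) (hT : T.IsTree)
    (hLT : ∀ u v : Fin n, adj LT u v = true ↔ T.Adj u v) : par n LT 0 = 0 := by
  have h : ((List.range n).filter fun u => adj LT u 0 &&
      decide (depth n LT u + 1 = depth n LT 0)) = [] := by
    rw [List.filter_eq_nil_iff]
    intro u _
    have := depth_eq hn hT hLT ⟨0, hn⟩
    rw [SimpleGraph.dist_self] at this
    simp [this]
  unfold par
  rw [h]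
  rfl

/-- The parent of a vertex. -/
def parent (hn : 0 < n) (LT : List (ℕ × ℕ)) (v : Fin n) : Fin n := ⟨par n LT v, par_lt hn LT v⟩

theorem iterate_parent (hn : 0 < n) (LT : List (ℕ × ℕ)) (i : ℕ) (v : Fin n) :
    ((parent hn LT)^[i] v).1 = (par n LT)^[i] v.1 := by
  induction i generalizing v with
  | zero => rfl
  | succ i ih => rw [Function.iterate_succ_apply, Function.iterate_succ_apply, ih]; rfl

theorem parent_eq_or_adj (hn : 0 < n) (hT : T.IsTree)
    (hLT : ∀ u v : Fin n, adj LT u v = true ↔ T.Adj u v) (v : Fin n) :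
    v = parent hn LT v ∨ T.Adj v (parent hn LT v) := by
  by_cases hv : v = ⟨0, hn⟩
  · left
    rw [hv]
    exact Fin.ext (par_root hn hT hLT).symm
  · exact Or.inr (par_spec hn hT hLT hv).1.symm

theorem anc_eq (hn : 0 < n) (hT : T.IsTree)
    (hLT : ∀ u v : Fin n, adj LT u v = true ↔ T.Adj u v) (h : ℕ) (v : Fin n) :
    anc n LT h v = ((parent hn LT)^[T.dist ⟨0, hn⟩ v - h] v).1 := by
  rw [iterate_parent, anc, depth_eq hn hT hLT]

/-- At level `n` nothing is truncated, since `depth` counts elements of `List.range n`. -/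
theorem anc_top (n : ℕ) (LT : List (ℕ × ℕ)) (v : ℕ) : anc n LT n v = v := by
  have : depth n LT v - n = 0 := by
    have := List.length_filter_le (fun i => !has (reach n LT i) v) (List.range n)
    rw [List.length_range] at this
    unfold depth
    omega
  rw [anc, this]
  rfl

/-- At level `0` the choice of a lift is irrelevant, which takes care of supports that `f` sends to
the base-point. -/
theorem anc_zero (hn : 0 < n) (hT : T.IsTree)
    (hLT : ∀ u v : Fin n, adj LT u v = true ↔ T.Adj u v) (v : Fin n) : anc n LT 0 v = 0 := by
  have key : ∀ i (v : Fin n), T.dist ⟨0, hn⟩ v = i → (parent hn LT)^[i] v = ⟨0, hn⟩ := by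
    intro i
    induction i with
    | zero =>
      intro v hv
      rw [hT.connected.dist_eq_zero_iff] at hv
      exact hv.symm
    | succ i ih =>
      intro v hv
      have hne : v ≠ ⟨0, hn⟩ := by
        rintro rfl
        rw [SimpleGraph.dist_self] at hv
        omega
      rw [Function.iterate_succ_apply]
      refine ih _ ?_
      have := (par_spec hn hT hLT hne).2
      unfold parent
      omega
  rw [anc_eq hn hT hLT, Nat.sub_zero, key _ v rfl]

/-- On an edge of the tree and for two consecutive levels, the ancestors lie in one edge. -/
theorem anc_mem_edge (hn : 0 < n) (hT : T.IsTree)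
    (hLT : ∀ u v : Fin n, adj LT u v = true ↔ T.Adj u v) {v w : Fin n} (hvw : v = w ∨ T.Adj v w)
    (h : ℕ) : ∃ a b : Fin n, (a = b ∨ T.Adj a b) ∧ ∀ u, u = v ∨ u = w → ∀ h', h ≤ h' →
      h' ≤ h + 1 → anc n LT h' u = a ∨ anc n LT h' u = b := by
  -- The depths of the ends of an edge differ by one, so by symmetry `w` may be taken to be `v` or
  -- the parent of `v`.
  suffices key : ∀ v w : Fin n, (v = w ∨ (w = parent hn LT v ∧
      T.dist ⟨0, hn⟩ v = T.dist ⟨0, hn⟩ w + 1)) →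
      ∃ a b : Fin n, (a = b ∨ T.Adj a b) ∧ ∀ u, u = v ∨ u = w → ∀ h', h ≤ h' →
      h' ≤ h + 1 → anc n LT h' u = a ∨ anc n LT h' u = b by
    have hpar : ∀ v w : Fin n, T.Adj v w → T.dist ⟨0, hn⟩ v = T.dist ⟨0, hn⟩ w + 1 →
        w = parent hn LT v := fun v w hadj hd => by
      have hne : v ≠ ⟨0, hn⟩ := by
        rintro rfl
        rw [SimpleGraph.dist_self] at hd
        omega
      obtain ⟨h1, h2⟩ := par_spec hn hT hLT hne
      exact hT.eq_of_adj_of_dist_add_one hadj.symm h1 hd.symm h2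
    rcases hvw with rfl | hadj
    · exact key v v (Or.inl rfl)
    · rcases hT.dist_eq_dist_add_one_of_adj ⟨0, hn⟩ hadj with hd | hd
      · exact key v w (Or.inr ⟨hpar v w hadj hd, hd⟩)
      · obtain ⟨a, b, hab, H⟩ := key w v (Or.inr ⟨hpar w v hadj.symm hd, hd⟩)
        exact ⟨a, b, hab, fun u hu => H u hu.symm⟩
  intro v w hvw
  set D := T.dist ⟨0, hn⟩ v with hD
  -- The edge joins the ancestor of `v` at level `h + 1` to its parent. All ancestors in question
  -- are iterated parents of `v` with exponent `D - (h + 1)` or one more, also where the subtraction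
  -- is truncated.
  refine ⟨(parent hn LT)^[D - (h + 1)] v, parent hn LT ((parent hn LT)^[D - (h + 1)] v),
    parent_eq_or_adj hn hT hLT _, fun u hu h' h1 h2 => ?_⟩
  rw [← Function.iterate_succ_apply' (parent hn LT)]
  have hj : ∃ j, (j = D - (h + 1) ∨ j = D - (h + 1) + 1) ∧
      anc n LT h' u = ((parent hn LT)^[j] v).1 := by
    have hv : anc n LT h' v = ((parent hn LT)^[D - h'] v).1 := anc_eq hn hT hLT h' v
    rcases hu with rfl | rfl
    · exact ⟨_, by omega, hv⟩
    · rcases hvw with rfl | ⟨hw, hd⟩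
      · exact ⟨_, by omega, hv⟩
      · refine ⟨T.dist ⟨0, hn⟩ u - h' + 1, by omega, ?_⟩
        rw [anc_eq hn hT hLT, Function.iterate_succ_apply, ← hw]
  obtain ⟨j, rfl | rfl, hj⟩ := hj
  · exact Or.inl hj
  · exact Or.inr hj

end Alg

/-! ### Correctness of the approximating map -/

namespace Alg

theorem all_range {m : ℕ} {p : ℕ → Bool} :
    (List.range m).all p = true ↔ ∀ v : Fin m, p v.1 = true := by
  simp only [List.all_eq_true, List.mem_range]
  exact ⟨fun h v => h v.1 v.2, fun h v hv => h ⟨v, hv⟩⟩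

theorem coord_ofFn {m : ℕ} (x : Fin m → ℕ) (v : Fin m) : coord (List.ofFn x) v.1 = x v := by
  simp [coord]

theorem amax_spec {m : ℕ} (hm : 0 < m) (x : Fin m → ℕ) :
    ∃ j : Fin m, amax m (List.ofFn x) = j.1 ∧ ∀ w, x w ≤ x j := by
  have hmem : ∀ v : Fin m, v.1 ∈ ((List.range m).filter fun v => (List.range m).all fun w =>
      decide (coord (List.ofFn x) w ≤ coord (List.ofFn x) v)) ↔ ∀ w, x w ≤ x v := fun v => by
    simp only [List.mem_filter, List.mem_range, v.2, true_and, all_range, coord_ofFn,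
      decide_eq_true_eq]
  obtain ⟨v, -, hv⟩ := Finset.exists_max_image (Finset.univ : Finset (Fin m)) x
    ⟨⟨0, hm⟩, Finset.mem_univ _⟩
  have h := headD_mem (List.ne_nil_of_mem ((hmem v).2 fun w => hv w (Finset.mem_univ w))) 0
  have hlt := List.mem_range.1 (List.mem_filter.1 h).1
  exact ⟨⟨_, hlt⟩, rfl, (hmem ⟨_, hlt⟩).1 h⟩

/-- Lowering by one maps the nonzero levels of `P` injectively into those of `Q`; only the level `0`
can be lost. -/
theorem length_filter_range_le {n : ℕ} {P Q : ℕ → Bool} (h : ∀ t, P (t + 1) = true → Q t = true) :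
    ((List.range n).filter P).length ≤ ((List.range n).filter Q).length + 1 := by
  have key : ∀ n, ((List.range (n + 1)).filter P).length ≤
      ((List.range n).filter Q).length + 1 := fun n => by
    induction n with
    | zero => exact (List.length_filter_le _ _).trans (by simp)
    | succ n ih =>
      have h1 : ((List.range (n + 1 + 1)).filter P).length =
          ((List.range (n + 1)).filter P).length + ([n + 1].filter P).length := by
        rw [List.range_succ (n := n + 1), List.filter_append, List.length_append]
      have h2 : ((List.range (n + 1)).filter Q).length =
          ((List.range n).filter Q).length + ([n].filter Q).length := by
        rw [List.range_succ, List.filter_append, List.length_append]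
      have : ([n + 1].filter P).length ≤ ([n].filter Q).length := by
        by_cases hP : P (n + 1) = true
        · simp [hP, h n hP]
        · simp [hP]
      omega
  cases n with
  | zero => simp
  | succ n =>
    refine (key n).trans (Nat.succ_le_succ ?_)
    rw [List.range_succ, List.filter_append, List.length_append]
    exact Nat.le_add_right _ _

end Alg

/-! ### Heights and lifts of vertices of the subdivision -/

namespace OrderedComplex

variable {n m : ℕ} {K : OrderedComplex (Fin n)} {T : SimpleGraph (Fin n)}
  {S : OrderedComplex (Fin m)} {f : S.ss ⟶ K.collapse T}

/-- The code of the table of the values of `f`. -/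
def codeMap (L : List (List (Fin m) × Option (List (Fin n)))) :
    List (List ℕ × Option (List ℕ)) :=
  L.map fun q => (q.1.map Fin.val, q.2.map (List.map Fin.val))

/-- By naturality one representative `τ` on a large simplex represents `f` on all of its faces. -/
theorem app_comp {r l : ℕ} {σ : Fin (r + 1) → Fin m} {hσ : S.IsSeq σ} {τ : Fin (r + 1) → Fin n}
    {hτ : K.IsSeq τ}
    (h : f.app (Opposite.op (SimplexCategory.mk r)) ⟨σ, hσ⟩ = Quot.mk _ ⟨τ, hτ⟩)
    (g : Fin (l + 1) →o Fin (r + 1)) {ρ : Fin (l + 1) → Fin m} (hρ : S.IsSeq ρ)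
    (hg : ∀ i, σ (g i) = ρ i) :
    f.app (Opposite.op (SimplexCategory.mk l)) ⟨ρ, hρ⟩ = Quot.mk _ ⟨τ ∘ g, hτ.comp g⟩ := by
  obtain rfl : ρ = σ ∘ g := funext fun i => (hg i).symm
  let g' : SimplexCategory.mk l ⟶ SimplexCategory.mk r := SimplexCategory.Hom.mk g
  have h1 := ConcreteCategory.congr_hom (f.naturality g'.op)
    (⟨σ, hσ⟩ : S.ss.obj (Opposite.op (SimplexCategory.mk r)))
  exact h1.trans (congrArg ((K.collapse T).map g'.op) h)

open Classical in
theorem repr_eq {r : ℕ} {σ : Fin (r + 1) → Fin m} {hσ : S.IsSeq σ} {τ : Fin (r + 1) → Fin n}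
    {hτ : K.IsSeq τ}
    (h : f.app (Opposite.op (SimplexCategory.mk r)) ⟨σ, hσ⟩ = Quot.mk _ ⟨τ, hτ⟩) :
    K.repr T (f.app (Opposite.op (SimplexCategory.mk r)) ⟨σ, hσ⟩) =
      if InTree T τ then none else some (List.ofFn τ) := by
  rw [h]
  rfl

theorem isSome_repr {r : ℕ} {σ : Fin (r + 1) → Fin m} {hσ : S.IsSeq σ} {τ : Fin (r + 1) → Fin n}
    {hτ : K.IsSeq τ}
    (h : f.app (Opposite.op (SimplexCategory.mk r)) ⟨σ, hσ⟩ = Quot.mk _ ⟨τ, hτ⟩) :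
    (K.repr T (f.app (Opposite.op (SimplexCategory.mk r)) ⟨σ, hσ⟩)).isSome = true ↔
      ¬ InTree T τ := by
  classical
  rw [repr_eq h]
  split_ifs with hT <;> simp [hT]

/-- The condition for keeping the level `t` of the tree at `x`: near a simplex that `f` does not
map to the base point. -/
def KeepsLevel (f : S.ss ⟶ K.collapse T) (x : Fin m → ℕ) (t : ℕ) : Prop :=
  ∃ (r : ℕ) (ρ : Fin (r + 1) → Fin m) (hρ : S.IsSeq ρ), Function.Injective ρ ∧
    (K.repr T (f.app (Opposite.op (SimplexCategory.mk r)) ⟨ρ, hρ⟩)).isSome = true ∧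
    ∀ i w, x w + (2 * t + 2) ≤ x (ρ i) + (2 * n + 2)

open Classical in
theorem height_eq {Lf : List (List (Fin m) × Option (List (Fin n)))} (hf : ListsMap K T S f Lf)
    (x : Fin m → ℕ) : Alg.height n m (codeMap Lf) (List.ofFn x) =
      ((List.range n).filter fun t => decide (KeepsLevel f x t)).length := by
  unfold Alg.height
  congr 1
  refine List.filter_congr fun t _ => ?_
  rw [Bool.eq_iff_iff, decide_eq_true_eq, List.any_eq_true]
  constructor
  · rintro ⟨q, hq, h⟩
    obtain ⟨q', hq', rfl⟩ := List.mem_map.1 hq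
    obtain ⟨r, ρ, hρ, hinj, rfl⟩ := (hf q').1 hq'
    rw [Bool.and_eq_true, Option.isSome_map, List.all_eq_true] at h
    refine ⟨r, ρ, hρ, hinj, h.1, fun i w => ?_⟩
    have h1 := Alg.all_range.1 (h.2 (ρ i).1 (List.mem_map_of_mem (List.mem_ofFn.2 ⟨i, rfl⟩))) w
    rwa [decide_eq_true_eq, Alg.coord_ofFn, Alg.coord_ofFn] at h1
  · rintro ⟨r, ρ, hρ, hinj, hs, h⟩
    refine ⟨_, List.mem_map_of_mem ((hf _).2 ⟨r, ρ, hρ, hinj, rfl⟩), ?_⟩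
    rw [Bool.and_eq_true, Option.isSome_map, List.all_eq_true]
    refine ⟨hs, fun v hv => Alg.all_range.2 fun w => ?_⟩
    obtain ⟨v', hv', rfl⟩ := List.mem_map.1 hv
    obtain ⟨i, rfl⟩ := List.mem_ofFn.1 hv'
    rw [decide_eq_true_eq, Alg.coord_ofFn, Alg.coord_ofFn]
    exact h i w

/-- The difference of two coordinates changes by at most `2` from `x` to `y`, which is exactly the
spacing of consecutive levels. -/
theorem height_le {Lf : List (List (Fin m) × Option (List (Fin n)))} (hf : ListsMap K T S f Lf)
    {x y : Fin m → ℕ} (hxy : ∀ v, x v ≤ y v + 1) (hyx : ∀ v, y v ≤ x v + 1) :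
    Alg.height n m (codeMap Lf) (List.ofFn x) ≤ Alg.height n m (codeMap Lf) (List.ofFn y) + 1 := by
  classical
  rw [height_eq hf, height_eq hf]
  refine Alg.length_filter_range_le fun t ht => ?_
  rw [decide_eq_true_eq] at ht ⊢
  obtain ⟨r, ρ, hρ, hinj, hs, h⟩ := ht
  refine ⟨r, ρ, hρ, hinj, hs, fun i w => ?_⟩
  have := h i w
  have := hxy (ρ i)
  have := hyx w
  omega

/-- Even the last level `t = n - 1` tolerates coordinates that are `2` below the maximum. -/
theorem height_eq_top {Lf : List (List (Fin m) × Option (List (Fin n)))}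
    (hf : ListsMap K T S f Lf) {x : Fin m → ℕ} {r : ℕ} {ρ : Fin (r + 1) → Fin m} {hρ : S.IsSeq ρ}
    (hinj : Function.Injective ρ)
    (hs : (K.repr T (f.app (Opposite.op (SimplexCategory.mk r)) ⟨ρ, hρ⟩)).isSome = true)
    (h : ∀ i w, x w ≤ x (ρ i) + 2) : Alg.height n m (codeMap Lf) (List.ofFn x) = n := by
  classical
  rw [height_eq hf, List.filter_eq_self.2, List.length_range]
  intro t ht
  rw [List.mem_range] at ht
  rw [decide_eq_true_eq]
  refine ⟨r, ρ, hρ, hinj, hs, fun i w => ?_⟩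
  have := h i w
  omega

/-- A simplex that keeps some level has coordinates at most `2 * n` below `x w`, hence positive
ones. It is thus a face of the support of `x` and does not qualify. -/
theorem height_eq_zero {Lf : List (List (Fin m) × Option (List (Fin n)))}
    (hf : ListsMap K T S f Lf) {x : Fin m → ℕ} {w : Fin m} (hw : 2 * n + 2 ≤ x w)
    (h : ∀ (r : ℕ) (ρ : Fin (r + 1) → Fin m) (hρ : S.IsSeq ρ), Function.Injective ρ →
      (∀ i, x (ρ i) ≠ 0) →
      (K.repr T (f.app (Opposite.op (SimplexCategory.mk r)) ⟨ρ, hρ⟩)).isSome = false) :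
    Alg.height n m (codeMap Lf) (List.ofFn x) = 0 := by
  classical
  rw [height_eq hf, List.length_eq_zero_iff, List.filter_eq_nil_iff]
  intro t _
  rw [decide_eq_true_eq]
  rintro ⟨r, ρ, hρ, hinj, hs, h'⟩
  rw [h r ρ hρ hinj fun i => ?_] at hs
  · cases hs
  · have := h' i w
    omega

theorem isSupp_iff {x : Fin m → ℕ} {r : ℕ} {ρ : Fin (r + 1) → Fin m} :
    Alg.isSupp m (List.ofFn x) ((List.ofFn ρ).map Fin.val) = true ↔
      ∀ v, x v ≠ 0 ↔ ∃ i, ρ i = v := by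
  have hhas : ∀ v : Fin m, Alg.has ((List.ofFn ρ).map Fin.val) v.1 = true ↔ ∃ i, ρ i = v :=
    fun v => by
      rw [Alg.has_eq_true, List.mem_map]
      constructor
      · rintro ⟨v', hv', h⟩
        obtain ⟨i, rfl⟩ := List.mem_ofFn.1 hv'
        exact ⟨i, Fin.ext h⟩
      · rintro ⟨i, rfl⟩
        exact ⟨_, List.mem_ofFn.2 ⟨i, rfl⟩, rfl⟩
  unfold Alg.isSupp
  rw [Alg.all_range]
  refine forall_congr' fun v => ?_
  rw [Bool.or_eq_true, Bool.and_eq_true, Bool.and_eq_true, Bool.not_eq_true', Bool.not_eq_true',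
    decide_eq_true_eq, decide_eq_false_iff_not, Alg.coord_ofFn, hhas, Bool.eq_false_iff, ne_eq,
    hhas]
  tauto

/-- All candidates for the lift of the vertex `j` of the support of `x`. -/
theorem lift_mem {Lf : List (List (Fin m) × Option (List (Fin n)))} (hf : ListsMap K T S f Lf)
    (x : Fin m → ℕ) (j : Fin m) (c : ℕ) :
    (c ∈ (codeMap Lf).flatMap fun q =>
      if q.2.isSome && Alg.isSupp m (List.ofFn x) q.1 then
        ((List.range q.1.length).filter fun i => decide (q.1.getD i 0 = j.1)).map fun i =>
          (q.2.getD []).getD i 0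
      else []) ↔
    ∃ (r : ℕ) (ρ : Fin (r + 1) → Fin m) (hρ : S.IsSeq ρ) (l : List (Fin n)),
      Function.Injective ρ ∧ (∀ v, x v ≠ 0 ↔ ∃ i, ρ i = v) ∧
      K.repr T (f.app (Opposite.op (SimplexCategory.mk r)) ⟨ρ, hρ⟩) = some l ∧
      ∃ i, ρ i = j ∧ c = (l.map Fin.val).getD i.1 0 := by
  rw [List.mem_flatMap]
  constructor
  · rintro ⟨q, hq, hc⟩
    obtain ⟨q', hq', rfl⟩ := List.mem_map.1 hq
    obtain ⟨r, ρ, hρ, hinj, rfl⟩ := (hf q').1 hq'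
    split_ifs at hc with hcond
    · rw [Bool.and_eq_true, Option.isSome_map, isSupp_iff] at hcond
      obtain ⟨l, hl⟩ := Option.isSome_iff_exists.1 hcond.1
      change K.repr T (f.app (Opposite.op (SimplexCategory.mk r)) ⟨ρ, hρ⟩) = some l at hl
      obtain ⟨i, hi, rfl⟩ := List.mem_map.1 hc
      rw [List.mem_filter, List.mem_range, List.length_map, List.length_ofFn,
        decide_eq_true_eq] at hi
      refine ⟨r, ρ, hρ, l, hinj, hcond.2, hl, ⟨i, hi.1⟩, ?_, ?_⟩
      · have := hi.2
        simp only [List.getD_eq_getElem?_getD, List.getElem?_map, List.getElem?_ofFn, hi.1,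
          dif_pos, Option.map_some, Option.getD_some] at this
        exact Fin.ext this
      · simp only [hl, Option.map_some, Option.getD_some]
    · simp at hc
  · rintro ⟨r, ρ, hρ, l, hinj, hx, hl, i, rfl, rfl⟩
    refine ⟨_, List.mem_map_of_mem ((hf _).2 ⟨r, ρ, hρ, hinj, rfl⟩), ?_⟩
    rw [if_pos (by rw [Bool.and_eq_true, Option.isSome_map, isSupp_iff, hl]; exact ⟨rfl, hx⟩)]
    refine List.mem_map.2 ⟨i.1, ?_, ?_⟩
    · rw [List.mem_filter, List.mem_range, List.length_map, List.length_ofFn, decide_eq_true_eq]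
      refine ⟨i.2, ?_⟩
      simp [List.getD_eq_getElem?_getD, -List.ofFn_succ, Nat.lt_succ_iff.1 i.2]
    · simp only [hl, Option.map_some, Option.getD_some]

theorem lift_lt (hn : 0 < n) {Lf : List (List (Fin m) × Option (List (Fin n)))}
    (hf : ListsMap K T S f Lf) (x : Fin m → ℕ) (j : Fin m) :
    Alg.lift m (codeMap Lf) (List.ofFn x) j.1 < n := by
  unfold Alg.lift
  by_cases h : ((codeMap Lf).flatMap fun q =>
      if q.2.isSome && Alg.isSupp m (List.ofFn x) q.1 then
        ((List.range q.1.length).filter fun i => decide (q.1.getD i 0 = j.1)).map fun i =>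
          (q.2.getD []).getD i 0
      else []) = []
  · rw [h]
    exact hn
  · obtain ⟨r, ρ, hρ, l, -, -, -, i, -, hc⟩ := (lift_mem hf x j _).1 (Alg.headD_mem h 0)
    rw [hc, List.getD_eq_getElem?_getD, List.getElem?_map]
    cases l[i.1]? with
    | none => exact hn
    | some v => exact v.2

/-- Every candidate comes from a simplex that enumerates the support of `x`, a face of `σ`, on which
`f` is the class of a face of `τ`. Outside the tree a class has only one lift, so all candidates
agree with `τ`. -/
theorem lift_eq {Lf : List (List (Fin m) × Option (List (Fin n)))} (hf : ListsMap K T S f Lf)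
    {x : Fin m → ℕ} {r : ℕ} {σ : Fin (r + 1) → Fin m} {hσ : S.IsSeq σ}
    (hinj : Function.Injective σ) {τ : Fin (r + 1) → Fin n} {hτ : K.IsSeq τ}
    (h : f.app (Opposite.op (SimplexCategory.mk r)) ⟨σ, hσ⟩ = Quot.mk _ ⟨τ, hτ⟩)
    (hx : ∀ v, x v ≠ 0 → ∃ i, σ i = v) {l : ℕ} {ρ : Fin (l + 1) → Fin m} {hρ : S.IsSeq ρ}
    (hρi : Function.Injective ρ) (hρx : ∀ v, x v ≠ 0 ↔ ∃ i, ρ i = v)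
    (hs : (K.repr T (f.app (Opposite.op (SimplexCategory.mk l)) ⟨ρ, hρ⟩)).isSome = true)
    {i : Fin (r + 1)} (hi : x (σ i) ≠ 0) :
    Alg.lift m (codeMap Lf) (List.ofFn x) (σ i).1 = (τ i).1 := by
  classical
  obtain ⟨i', hi'⟩ := (hρx _).1 hi
  obtain ⟨L, hL⟩ := Option.isSome_iff_exists.1 hs
  have hne := List.ne_nil_of_mem ((lift_mem hf x (σ i) _).2
    ⟨l, ρ, hρ, L, hρi, hρx, hL, i', hi', rfl⟩)
  obtain ⟨l', ρ', hρ', L', hρi', hρx', hL', j, hj, hc⟩ :=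
    (lift_mem hf x (σ i) _).1 (Alg.headD_mem hne 0)
  unfold Alg.lift
  rw [hc]
  obtain ⟨g, hg⟩ := hρ'.exists_factor hσ hinj fun i => hx _ ((hρx' _).2 ⟨i, rfl⟩)
  rw [repr_eq (app_comp h g hρ' hg)] at hL'
  split_ifs at hL'
  rw [← Option.some.inj hL']
  have hgj : g j = i := hinj ((hg j).trans hj)
  simp [List.getD_eq_getElem?_getD, hgj, -List.ofFn_succ, Nat.lt_succ_iff.1 j.2]

end OrderedComplex

theorem InTree.comp {V : Type} {T : SimpleGraph V} {r l : ℕ} {τ : Fin (r + 1) → V}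
    (h : InTree T τ) (g : Fin (l + 1) → Fin (r + 1)) : InTree T (τ ∘ g) := by
  obtain ⟨v, w, hvw, h⟩ := h
  exact ⟨v, w, hvw, fun i => h (g i)⟩

namespace OrderedComplex

variable {n m d : ℕ} {K : OrderedComplex (Fin n)} {T : SimpleGraph (Fin n)}
  {S : OrderedComplex (Fin m)} {f : S.ss ⟶ K.collapse T}
  {LT : List (ℕ × ℕ)} {Lf : List (List (Fin m) × Option (List (Fin n)))}

/-- Some coordinate of a vertex of the subdivision is large. -/
theorem exists_le_coord (hS : S.DimLE d) (x : S.EsdVertex (Alg.parts d n)) :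
    ∃ w, 2 * n + 2 ≤ x.1 w := by
  -- Otherwise at most `d + 1` nonzero coordinates, each at most `2 * n + 1`, would have to add up
  -- to `(d + 1) * (2 * n + 2)`.
  by_contra hcon
  push Not at hcon
  have h1 : ∑ v, x.1 v = ∑ v ∈ Finset.univ.filter (fun v => x.1 v ≠ 0), x.1 v :=
    (Finset.sum_filter_ne_zero _).symm
  have h2 := Finset.sum_le_card_nsmul (Finset.univ.filter fun v => x.1 v ≠ 0) x.1 (2 * n + 1)
    fun v _ => Nat.lt_succ_iff.1 (hcon v)
  have h3 := Nat.mul_le_mul_right (2 * n + 1) (hS _ x.2.2)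
  have h5 : Alg.parts d n = (d + 1) * (2 * n + 2) := rfl
  rw [← h1, x.2.1, smul_eq_mul] at h2
  have h4 : (d + 1) * (2 * n + 2) = (d + 1) * (2 * n + 1) + (d + 1) := by ring
  omega

/-- This makes the values on a simplex comparable: all are expressed by the same `τ`, although the
table is read at different supports. If `f` sends the support of `x` to the base-point, there is
nothing to read, but the height is `0` and both sides are the root. -/
theorem val_eq (hn : 0 < n) (hT : T.IsTree)
    (hLT : ∀ u v : Fin n, Alg.adj LT u v = true ↔ T.Adj u v) (hS : S.DimLE d)
    (hf : ListsMap K T S f Lf) (x : S.EsdVertex (Alg.parts d n)) {j : Fin m}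
    (hj : Alg.amax m (List.ofFn x.1) = j.1) (hj0 : x.1 j ≠ 0) {r : ℕ} {σ : Fin (r + 1) → Fin m}
    {hσ : S.IsSeq σ} (hinj : Function.Injective σ) {τ : Fin (r + 1) → Fin n} {hτ : K.IsSeq τ}
    (h : f.app (Opposite.op (SimplexCategory.mk r)) ⟨σ, hσ⟩ = Quot.mk _ ⟨τ, hτ⟩)
    (hx : ∀ v, x.1 v ≠ 0 → ∃ i, σ i = v) {i : Fin (r + 1)} (hi : σ i = j) :
    Alg.val n m LT (codeMap Lf) (List.ofFn x.1) =
      Alg.anc n LT (Alg.height n m (codeMap Lf) (List.ofFn x.1)) (τ i).1 := by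
  obtain ⟨l, ρ, hρ, hρi, him⟩ := S.exists_enum x.2.2
  have hρx : ∀ v, x.1 v ≠ 0 ↔ ∃ i, ρ i = v := fun v => by
    have := Finset.ext_iff.1 him v
    simp only [Finset.mem_image, Finset.mem_univ, true_and, Finset.mem_filter] at this
    exact this.symm
  obtain ⟨τ', hτ'⟩ := Quot.exists_rep (f.app (Opposite.op (SimplexCategory.mk l)) ⟨ρ, hρ⟩)
  unfold Alg.val
  rw [hj]
  by_cases hs : (K.repr T (f.app (Opposite.op (SimplexCategory.mk l)) ⟨ρ, hρ⟩)).isSome = true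
  · subst hi
    rw [lift_eq hf hinj h hx hρi hρx hs hj0]
  · obtain ⟨w, hw⟩ := exists_le_coord hS x
    have h0 : Alg.height n m (codeMap Lf) (List.ofFn x.1) = 0 := by
      refine height_eq_zero hf hw fun r' ρ' hρ' _ hne => ?_
      obtain ⟨g, hg⟩ := hρ'.exists_factor hρ hρi fun i => (hρx _).1 (hne i)
      rw [Bool.eq_false_iff]
      rw [ne_eq, isSome_repr (app_comp hτ'.symm g hρ' hg), not_not]
      rw [isSome_repr hτ'.symm, not_not] at hs
      exact hs.comp g
    rw [h0, Alg.anc_zero hn hT hLT]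
    exact Alg.anc_zero hn hT hLT ⟨_, lift_lt hn hf x.1 j⟩

/-- The two cases are whether or not `f` sends the simplex spanned by the values of `j` on `G` to
the base-point. If it does, the heights on `G` are nearly constant and `anc_mem_edge` applies; if
not, all heights are `n` and the lift is used unchanged. -/
theorem isApprox_val (hn : 0 < n) (hT : T.IsTree)
    (hLT : ∀ u v : Fin n, Alg.adj LT u v = true ↔ T.Adj u v) (hS : S.DimLE d)
    (hf : ListsMap K T S f Lf) {j : S.EsdVertex (Alg.parts d n) → Fin m}
    (hj : ∀ x : S.EsdVertex (Alg.parts d n), Alg.amax m (List.ofFn x.1) = (j x).1)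
    (hj0 : ∀ x : S.EsdVertex (Alg.parts d n), x.1 (j x) ≠ 0)
    (hmax : ∀ x : S.EsdVertex (Alg.parts d n), ∀ w, x.1 w ≤ x.1 (j x))
    {f' : S.EsdVertex (Alg.parts d n) → Fin n}
    (hf' : ∀ x : S.EsdVertex (Alg.parts d n),
      (f' x).1 = Alg.val n m LT (codeMap Lf) (List.ofFn x.1))
    {G : Finset (S.EsdVertex (Alg.parts d n))} (hG : G ∈ (S.esd (Alg.parts d n)).faces) :
    IsApprox f j f' G := by
  obtain ⟨r, σ, hσ, hσi, hσF⟩ := S.exists_enum hG.2.1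
  obtain ⟨⟨τ, hτ⟩, hστ⟩ := Quot.exists_rep (f.app (Opposite.op (SimplexCategory.mk r)) ⟨σ, hσ⟩)
  have hmem : ∀ x ∈ G, ∀ v, x.1 v ≠ 0 → ∃ i, σ i = v := fun x hx v hv => by
    have : v ∈ S.carrier G := mem_carrier.2 ⟨x, hx, hv⟩
    rw [← hσF] at this
    simpa using this
  have hA : G.image j ∈ S.faces := S.mem_faces_of_subset hG.2.1 (fun v hv => by
    obtain ⟨x, hx, rfl⟩ := Finset.mem_image.1 hv
    exact mem_carrier.2 ⟨x, hx, hj0 x⟩) (hG.1.image j)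
  obtain ⟨l, ρ, hρ, hρi, hρA⟩ := S.exists_enum hA
  have hρj : ∀ x ∈ G, ∃ i, ρ i = j x := fun x hx => by
    have := Finset.mem_image_of_mem j hx
    rw [← hρA] at this
    simpa using this
  have hjρ : ∀ i, ∃ x ∈ G, j x = ρ i := fun i => by
    have : ρ i ∈ G.image j := hρA ▸ Finset.mem_image_of_mem _ (Finset.mem_univ i)
    simpa using this
  obtain ⟨g, hg⟩ := hρ.exists_factor hσ hσi fun i => by
    obtain ⟨x, hx, hxi⟩ := hjρ i
    rw [← hxi]
    exact hmem x hx _ (hj0 x)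
  have hρτ := app_comp hστ.symm g hρ hg
  have hval : ∀ x ∈ G, ∀ i, σ i = j x → (f' x).1 =
      Alg.anc n LT (Alg.height n m (codeMap Lf) (List.ofFn x.1)) (τ i).1 := fun x hx i hi =>
    (hf' x).trans (val_eq hn hT hLT hS hf x (hj x) (hj0 x) hσi hστ.symm (hmem x hx) hi)
  by_cases hin : InTree T (τ ∘ g)
  · refine ⟨l, ρ, hρ, τ ∘ g, hτ.comp g, hρτ, Or.inr ⟨hin, hρj, ?_⟩⟩
    obtain ⟨v, w, hvw, hτvw⟩ := hin
    -- With `x₀` of least height, every height on `G` is that of `x₀` or one more.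
    obtain ⟨x₀, hx₀, hmin⟩ := Finset.exists_min_image G
      (fun x => Alg.height n m (codeMap Lf) (List.ofFn x.1)) hG.1
    obtain ⟨a, b, hab, H⟩ := Alg.anc_mem_edge hn hT hLT hvw
      (Alg.height n m (codeMap Lf) (List.ofFn x₀.1))
    refine ⟨a, b, hab, fun x hx => ?_⟩
    obtain ⟨i, hi⟩ := hρj x hx
    have h1 := hval x hx (g i) ((hg i).trans hi)
    have h2 := H (τ (g i)) (hτvw i) _ (hmin x hx)
      (height_le hf (coord_le_add_one S hG hx hx₀) (coord_le_add_one S hG hx₀ hx))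
    rw [← h1] at h2
    exact h2.imp Fin.ext Fin.ext
  · refine ⟨r, σ, hσ, τ, hτ, hστ.symm, Or.inl fun x hx => ?_⟩
    obtain ⟨i, hi⟩ := hmem x hx _ (hj0 x)
    refine ⟨i, hi, Fin.ext ?_⟩
    -- `ρ i` is where some `y` in `G` is maximal. Passing from `x` to `y` and back costs one each
    -- way, so `x` at `ρ i` is at most `2` below its maximum.
    have htop : Alg.height n m (codeMap Lf) (List.ofFn x.1) = n := by
      refine height_eq_top hf hρi ((isSome_repr hρτ).2 hin) fun i w => ?_
      obtain ⟨y, hy, hyi⟩ := hjρ i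
      rw [← hyi]
      have h1 := coord_le_add_one S hG hx hy w
      have h2 := hmax y w
      have h3 := coord_le_add_one S hG hy hx (j y)
      omega
    rw [hval x hx i hi, htop, Alg.anc_top]

/-- The values that the algorithm computes define an approximation of `f`. -/
theorem exists_isApprox (hn : 0 < n) (hT : T.IsTree)
    (hLT : ∀ u v : Fin n, Alg.adj LT u v = true ↔ T.Adj u v) (hS : S.DimLE d)
    (hf : ListsMap K T S f Lf) :
    ∃ (j : S.EsdVertex (Alg.parts d n) → Fin m) (f' : S.EsdVertex (Alg.parts d n) → Fin n),
      (∀ x : S.EsdVertex (Alg.parts d n), x.1 (j x) ≠ 0) ∧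
      (∀ x : S.EsdVertex (Alg.parts d n), (f' x).1 = Alg.val n m LT (codeMap Lf) (List.ofFn x.1)) ∧
      ∀ G ∈ (S.esd (Alg.parts d n)).faces, IsApprox f j f' G := by
  have hm : ∀ _ : S.EsdVertex (Alg.parts d n), 0 < m := fun x => by
    obtain ⟨v, -⟩ := (S.isRelLowerSet_faces x.2.2).1
    exact v.pos
  choose j hj hmax using fun x : S.EsdVertex (Alg.parts d n) => Alg.amax_spec (hm x) x.1
  have hj0 : ∀ x : S.EsdVertex (Alg.parts d n), x.1 (j x) ≠ 0 := fun x => by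
    obtain ⟨w, hw⟩ := exists_le_coord hS x
    have := hmax x w
    omega
  have hlt : ∀ x : S.EsdVertex (Alg.parts d n),
      Alg.val n m LT (codeMap Lf) (List.ofFn x.1) < n := fun x => by
    have h := Alg.anc_eq hn hT hLT (Alg.height n m (codeMap Lf) (List.ofFn x.1))
      ⟨_, lift_lt hn hf x.1 (j x)⟩
    rw [Alg.val, hj, h]
    exact Fin.is_lt _
  exact ⟨j, fun x => ⟨_, hlt x⟩, hj0, fun x => rfl, fun G hG =>
    isApprox_val hn hT hLT hS hf hj hj0 hmax (fun x => rfl) hG⟩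

end OrderedComplex

/-! ### Correctness of the enumeration of the subdivision -/

namespace Alg

theorem mem_tuples {α : Type} {r : ℕ} {l t : List α} :
    t ∈ tuples r l ↔ t.length ≤ r ∧ ∀ x ∈ t, x ∈ l := by
  induction r generalizing t with
  | zero =>
    simp only [tuples, List.mem_singleton, Nat.le_zero, List.length_eq_zero_iff]
    exact ⟨fun h => ⟨h, by simp [h]⟩, fun h => h.1⟩
  | succ r ih =>
    simp only [tuples, List.mem_cons, List.mem_flatMap, List.mem_map, ih]
    cases t with
    | nil => simp
    | cons x t => simp [and_left_comm]

theorem sum_map_filter {α : Type} (p : List α) (c : α → Bool) (f : α → ℕ) :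
    ((p.filter c).map f).sum = (p.map fun q => if c q then f q else 0).sum := by
  induction p with
  | nil => rfl
  | cons a p ih => by_cases h : c a = true <;> simp [h, ih]

theorem eq_ofFn_coord {m : ℕ} {x : List ℕ} (hx : x.length = m) :
    List.ofFn (fun v : Fin m => coord x v.1) = x := by
  subst hx
  refine List.ext_getElem (by simp) fun i h1 h2 => ?_
  simp [coord]

theorem vec_eq {m : ℕ} (x : Fin m → ℕ) :
    vec m (((Finset.univ.filter fun v => x v ≠ 0).toList).map fun v => (v.1, x v)) =
      List.ofFn x := by
  refine List.ext_getElem (by simp [vec]) fun i h1 h2 => ?_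
  have hi : i < m := by simpa using h2
  simp only [vec, sum_map_filter, List.getElem_map, List.getElem_range, List.map_map,
    List.getElem_ofFn, Function.comp_def, Finset.sum_map_toList, decide_eq_true_eq]
  rw [Finset.sum_eq_single (⟨i, hi⟩ : Fin m)]
  · simp
  · intro b _ hb
    simp [Fin.ext_iff.not.1 hb]
  · intro h
    simpa using h

theorem inCarrier_iff {m : ℕ} {F : List (Fin m → ℕ)} {v : Fin m} :
    inCarrier (F.map List.ofFn) v.1 = true ↔ ∃ x ∈ F, x v ≠ 0 := by
  simp [inCarrier, coord_ofFn]

theorem has_iff {m : ℕ} {l : List (Fin m)} {v : Fin m} :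
    has (l.map Fin.val) v.1 = true ↔ v ∈ l := by
  rw [has_eq_true, List.mem_map]
  exact ⟨fun ⟨w, hw, h⟩ => Fin.ext h ▸ hw, fun h => ⟨v, h, rfl⟩⟩

theorem same_iff {m : ℕ} {x y : Fin m → ℕ} :
    same m (List.ofFn x) (List.ofFn y) = true ↔ x = y := by
  simp only [same, all_range, coord_ofFn, funext_iff, decide_eq_true_eq]

theorem nodup_iff {m : ℕ} {F : List (Fin m → ℕ)} :
    nodup m (F.map List.ofFn) = true ↔ F.Nodup := by
  have hget : ∀ i : Fin F.length, (F.map List.ofFn).getD i.1 [] = List.ofFn (F.get i) :=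
    fun i => by simp
  rw [nodup, List.length_map]
  simp only [all_range, hget, Bool.or_eq_true, Bool.not_eq_true', ← Bool.not_eq_true, same_iff,
    decide_eq_true_eq, List.nodup_iff_injective_get, Fin.val_inj]
  exact ⟨fun h i j hij => (h i j).resolve_right (not_not.2 hij),
    fun h i j => or_iff_not_imp_right.2 fun hij => h (not_not.1 hij)⟩

end Alg

namespace OrderedComplex

variable {m : ℕ} {S : OrderedComplex (Fin m)} {LS : List (List (Fin m))}

theorem carried_iff (hLS : S.ListsSimplices LS) {F : List (Fin m → ℕ)} :
    Alg.carried m (LS.map (List.map Fin.val)) (F.map List.ofFn) = true ↔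
      ∃ s ∈ S.faces, ∀ x ∈ F, ∀ v, x v ≠ 0 → v ∈ s := by
  have h : Alg.carried m (LS.map (List.map Fin.val)) (F.map List.ofFn) = true ↔
      ∃ l ∈ LS, ∀ x ∈ F, ∀ v, x v ≠ 0 → v ∈ l := by
    simp only [Alg.carried, List.any_eq_true, List.mem_map, exists_exists_and_eq_and,
      Alg.all_range, Bool.or_eq_true, Bool.not_eq_true', ← Bool.not_eq_true, Alg.inCarrier_iff,
      Alg.has_iff]
    refine exists_congr fun l => and_congr_right fun _ => ⟨fun h x hx v hv => ?_, fun h v => ?_⟩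
    · exact (h v).resolve_left (not_not.2 ⟨x, hx, hv⟩)
    · exact or_iff_not_imp_left.2 fun hv => by
        obtain ⟨x, hx, hxv⟩ := not_not.1 hv
        exact h x hx v hxv
  rw [h]
  constructor
  · rintro ⟨l, hl, h⟩
    obtain ⟨r, σ, hσ, -, rfl⟩ := (hLS l).1 hl
    exact ⟨_, hσ.1, fun x hx v hv => by
      obtain ⟨i, hi⟩ := List.mem_ofFn.1 (h x hx v hv)
      exact Finset.mem_image.2 ⟨i, Finset.mem_univ _, hi⟩⟩
  · rintro ⟨s, hs, h⟩
    obtain ⟨r, σ, hσ, hi, rfl⟩ := S.exists_enum hs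
    exact ⟨_, (hLS _).2 ⟨r, σ, hσ, hi, rfl⟩, fun x hx v hv => by
      obtain ⟨i, -, hi⟩ := Finset.mem_image.1 (h x hx v hv)
      exact List.mem_ofFn.2 ⟨i, hi⟩⟩

/-- The order on a simplex can be read off its edges, which are listed in increasing order. A common
simplex is required because `S.le` is arbitrary elsewhere. -/
theorem leq_iff (hLS : S.ListsSimplices LS) {w v : Fin m} (h : {w, v} ∈ S.faces) :
    Alg.leq (LS.map (List.map Fin.val)) w.1 v.1 = true ↔ S.le w v := by
  have key : Alg.leq (LS.map (List.map Fin.val)) w.1 v.1 = true ↔ w = v ∨ [w, v] ∈ LS := by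
    simp only [Alg.leq, Bool.or_eq_true, decide_eq_true_eq, List.any_eq_true, List.mem_map,
      exists_exists_and_eq_and, Bool.and_eq_true, List.length_map, Fin.val_inj]
    refine or_congr_right ⟨?_, fun h => ⟨_, h, rfl, rfl, rfl⟩⟩
    rintro ⟨l, hl, h2, hw, hv⟩
    obtain ⟨a, b, rfl⟩ := List.length_eq_two.1 h2
    obtain rfl : a = w := Fin.ext hw
    obtain rfl : b = v := Fin.ext hv
    exact hl
  rw [key, hLS]
  constructor
  · rintro (rfl | ⟨r, σ, hσ, -, h2⟩)
    · exact (S.le_total w w h).elim id id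
    · have hr := congrArg List.length h2
      simp only [List.length_cons, List.length_nil, List.length_ofFn] at hr
      obtain rfl : r = 1 := by omega
      simp only [List.ofFn_succ, List.ofFn_zero, List.cons.injEq, and_true] at h2
      rw [h2.1, h2.2]
      exact hσ.2 _ _ (Fin.zero_le _)
  · intro hle
    refine or_iff_not_imp_left.2 fun hne => ⟨1, ![w, v], ⟨?_, ?_⟩, ?_, by simp⟩
    · convert h using 1
      ext u
      simp [Fin.exists_fin_two, eq_comm]
    · have hww := fun u hu => (S.le_total u u (S.mem_faces_of_subset h hu (by simp))).elim id id
      have h1 : S.le w w := hww w (by simp)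
      have h2 : S.le v v := hww v (by simp)
      rw [Fin.forall_fin_two, Fin.forall_fin_two, Fin.forall_fin_two]
      exact ⟨⟨fun _ => h1, fun _ => hle⟩, fun h => absurd h (by simp), fun _ => h2⟩
    · simp [Function.Injective, Fin.forall_fin_two, hne, Ne.symm hne]

theorem psum_eq (hLS : S.ListsSimplices LS) {x : Fin m → ℕ} {v : Fin m}
    (hx : ∀ w, x w ≠ 0 → {w, v} ∈ S.faces) :
    Alg.psum m (LS.map (List.map Fin.val)) (List.ofFn x) v.1 = S.cumSum x v := by
  classical
  have h : Alg.psum m (LS.map (List.map Fin.val)) (List.ofFn x) v.1 =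
      ∑ w ∈ Finset.range m, if Alg.leq (LS.map (List.map Fin.val)) w v.1 = true then
        Alg.coord (List.ofFn x) w else 0 := rfl
  rw [h, Finset.sum_range, cumSum]
  refine Finset.sum_congr rfl fun w _ => ?_
  rw [Alg.coord_ofFn]
  by_cases h0 : x w = 0
  · simp [h0]
  · simp only [leq_iff hLS (hx w h0)]

theorem below_iff (hLS : S.ListsSimplices LS) {F : List (Fin m → ℕ)} {x y : Fin m → ℕ}
    (hx : x ∈ F) (hy : y ∈ F) {s : Finset (Fin m)} (hs : s ∈ S.faces)
    (hF : ∀ v, v ∈ s ↔ ∃ x ∈ F, x v ≠ 0) :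
    Alg.below m (LS.map (List.map Fin.val)) (F.map List.ofFn) (List.ofFn x) (List.ofFn y) = true ↔
      ∀ v ∈ s, S.cumSum x v ≤ S.cumSum y v ∧ S.cumSum y v ≤ S.cumSum x v + 1 := by
  simp only [Alg.below, Alg.all_range, Bool.or_eq_true, Bool.not_eq_true', ← Bool.not_eq_true,
    Alg.inCarrier_iff, Bool.and_eq_true, decide_eq_true_eq, ← hF]
  refine forall_congr' fun v => ?_
  rw [← imp_iff_not_or]
  refine imp_congr_right fun hv => ?_
  have hp : ∀ z ∈ F, Alg.psum m (LS.map (List.map Fin.val)) (List.ofFn z) v.1 = S.cumSum z v :=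
    fun z hz => psum_eq hLS fun w hw => S.mem_faces_of_subset hs (by
      rw [Finset.insert_subset_iff, Finset.singleton_subset_iff]
      exact ⟨(hF w).2 ⟨z, hz, hw⟩, hv⟩) (by simp)
  rw [hp x hx, hp y hy]

variable {k : ℕ}

/-- The codes of a list of vertices of the subdivision. -/
def codes (l : List (S.EsdVertex k)) : List (List ℕ) := l.map fun x => List.ofFn x.1

theorem isFace_iff (hLS : S.ListsSimplices LS) {l : List (S.EsdVertex k)} :
    Alg.isFace m (LS.map (List.map Fin.val)) (codes l) = true ↔
      l.Nodup ∧ l.toFinset ∈ (S.esd k).faces := by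
  have hF : codes l = (l.map Subtype.val).map List.ofFn := by simp [codes]
  have hcar : ∀ v, v ∈ S.carrier l.toFinset ↔ ∃ x ∈ l.map Subtype.val, x v ≠ 0 := fun v => by
    simp [mem_carrier]
  have hne : (!(codes l).isEmpty) = true ↔ l.toFinset.Nonempty := by
    cases l <;> simp [codes]
  have hcd : l.toFinset.Nonempty → (Alg.carried m (LS.map (List.map Fin.val)) (codes l) = true ↔
      S.carrier l.toFinset ∈ S.faces) := fun hl => by
    rw [hF, carried_iff hLS]
    constructor
    · rintro ⟨s, hs, h⟩
      refine S.mem_faces_of_subset hs (fun v hv => ?_) ?_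
      · obtain ⟨x, hx, hv⟩ := (hcar v).1 hv
        exact h x hx v hv
      · obtain ⟨x, hx⟩ := hl
        obtain ⟨v, hv⟩ := (S.isRelLowerSet_faces x.2.2).1
        exact ⟨v, mem_carrier.2 ⟨x, hx, (Finset.mem_filter.1 hv).2⟩⟩
    · exact fun h => ⟨_, h, fun x hx v hv => (hcar v).2 ⟨x, hx, hv⟩⟩
  have hnd : Alg.nodup m (codes l) = true ↔ l.Nodup := by
    rw [hF, Alg.nodup_iff, List.nodup_map_iff Subtype.val_injective]
  rw [Alg.isFace, Bool.and_eq_true, Bool.and_eq_true, Bool.and_eq_true, hne, hnd,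
    and_comm (b := l.Nodup), and_assoc]
  refine and_congr_right fun _ => and_congr_right fun hl => ?_
  rw [hcd hl]
  refine and_congr_right fun hc => ?_
  have hb : ∀ x ∈ l, ∀ y ∈ l, (Alg.below m (LS.map (List.map Fin.val)) (codes l) (List.ofFn x.1)
      (List.ofFn y.1) = true ↔ ∀ v ∈ S.carrier l.toFinset,
        S.cumSum x.1 v ≤ S.cumSum y.1 v ∧ S.cumSum y.1 v ≤ S.cumSum x.1 v + 1) := fun x hx y hy => by
    rw [hF]
    exact below_iff hLS (List.mem_map_of_mem hx) (List.mem_map_of_mem hy) hc hcar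
  simp only [List.all_eq_true, codes, List.forall_mem_map, List.mem_toFinset, Bool.or_eq_true]
  exact forall₂_congr fun x hx => forall₂_congr fun y hy => or_congr (hb x hx y hy) (hb y hy x hx)

theorem mem_verts {d : ℕ} (hLS : S.ListsSimplices LS) (hS : S.DimLE d) (hk : 0 < k) {t : List ℕ} :
    t ∈ Alg.verts d m (LS.map (List.map Fin.val)) k ↔
      ∃ x : S.EsdVertex k, List.ofFn x.1 = t := by
  have hsum : ∀ x : Fin m → ℕ, (List.ofFn x).sum = ∑ v, x v := fun x => List.sum_ofFn
  have hc : ∀ x : Fin m → ℕ, Alg.carried m (LS.map (List.map Fin.val)) [List.ofFn x] = true ↔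
      ∃ s ∈ S.faces, ∀ v, x v ≠ 0 → v ∈ s := fun x => by
    have := carried_iff hLS (F := [x])
    simpa using this
  rw [Alg.verts, List.mem_filter, Bool.and_eq_true, decide_eq_true_eq]
  constructor
  · rintro ⟨ht, h1, h2⟩
    obtain ⟨p, -, rfl⟩ := List.mem_map.1 ht
    have h0 := Alg.eq_ofFn_coord (m := m) (x := Alg.vec m p) (by simp [Alg.vec])
    rw [← h0] at h1 h2
    rw [hsum] at h1
    obtain ⟨s, hs, h2⟩ := (hc _).1 h2
    refine ⟨⟨_, h1, S.mem_faces_of_subset hs (fun v hv => h2 v (Finset.mem_filter.1 hv).2) ?_⟩, h0⟩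
    by_contra hcon
    rw [Finset.not_nonempty_iff_eq_empty, Finset.filter_eq_empty_iff] at hcon
    rw [Finset.sum_eq_zero fun v hv => not_not.1 (hcon hv)] at h1
    omega
  · rintro ⟨x, rfl⟩
    refine ⟨List.mem_map.2 ⟨_, Alg.mem_tuples.2 ⟨?_, ?_⟩, Alg.vec_eq x.1⟩, ?_, ?_⟩
    · rw [List.length_map, Finset.length_toList]
      exact hS _ x.2.2
    · intro q hq
      obtain ⟨v, -, rfl⟩ := List.mem_map.1 hq
      have h := Finset.single_le_sum (f := x.1) (fun _ _ => Nat.zero_le _) (Finset.mem_univ v)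
      have := x.2.1
      exact List.mem_flatMap.2 ⟨v.1, List.mem_range.2 v.2,
        List.mem_map.2 ⟨x.1 v, List.mem_range.2 (by omega), rfl⟩⟩
    · rw [hsum, x.2.1]
    · exact (hc _).2 ⟨_, x.2.2, fun v hv => by simpa using hv⟩

/-- The vertices of a simplex form a chain for the order of partial sums, so the total of the
partial sums is injective on `F`. It varies by at most one for each vertex of the carrier. The bound
is not sharp, as the last partial sum is always `k`, but it suffices for the enumeration. -/
theorem card_le_of_mem_esd {V : Type} [DecidableEq V] [Fintype V] (K : OrderedComplex V)
    {k : ℕ} {F : Finset (K.EsdVertex k)} (hF : F ∈ (K.esd k).faces) :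
    F.card ≤ (K.carrier F).card + 1 := by
  obtain ⟨x₀, hx₀, hmin⟩ := Finset.exists_min_image F
    (fun x => ∑ v ∈ K.carrier F, K.cumSum x.1 v) hF.1
  have h : F.card ≤ (Finset.Icc (∑ v ∈ K.carrier F, K.cumSum x₀.1 v)
      ((∑ v ∈ K.carrier F, K.cumSum x₀.1 v) + (K.carrier F).card)).card := by
    refine Finset.card_le_card_of_injOn (fun x => ∑ v ∈ K.carrier F, K.cumSum x.1 v) ?_ ?_
    · intro x hx
      refine Finset.mem_coe.2 (Finset.mem_Icc.2 ⟨hmin x hx, ?_⟩)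
      rw [Finset.card_eq_sum_ones, ← Finset.sum_add_distrib]
      refine Finset.sum_le_sum fun v hv => ?_
      rcases hF.2.2 x₀ hx₀ x hx with h | h
      · exact (h v hv).2
      · exact (h v hv).1.trans (Nat.le_succ _)
    · intro x hx y hy hxy
      have hmem : ∀ z ∈ F, ∀ v, z.1 v ≠ 0 → v ∈ K.carrier F :=
        fun z hz v hv => mem_carrier.2 ⟨z, hz, hv⟩
      refine Subtype.ext (K.eq_of_cumSum_eq hF.2.1 (hmem x hx) (hmem y hy) ?_)
      rcases hF.2.2 x hx y hy with h | h
      · exact (Finset.sum_eq_sum_iff_of_le fun v hv => (h v hv).1).1 hxy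
      · exact fun v hv =>
          ((Finset.sum_eq_sum_iff_of_le fun v hv => (h v hv).1).1 hxy.symm v hv).symm
  rw [Nat.card_Icc] at h
  omega

end OrderedComplex

/-! ### The simplicial approximation -/

theorem Enc.enc_map {α β : Type} [Enc β] {g : α → β} {c : α → Data} (h : ∀ a, enc (g a) = c a)
    (l : List α) : enc (l.map g) = Data.ofList c l := by
  induction l with
  | nil => rfl
  | cons a l ih => exact congrArg₂ Data.cons (h a) ih

theorem Enc.enc_option_map {α β : Type} [Enc β] {g : α → β} {c : α → Data}
    (h : ∀ a, enc (g a) = c a) (o : Option α) : enc (o.map g) = Data.ofOption c o := by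
  cases o with
  | none => rfl
  | some a => exact congrArg (fun b => Data.cons b Data.nil) (h a)

theorem Alg.adj_iff {n : ℕ} {T : SimpleGraph (Fin n)} {LT : List (Fin n × Fin n)}
    (hLT : OrderedComplex.ListsEdges T LT) (u v : Fin n) :
    Alg.adj (LT.map fun e => (e.1.1, e.2.1)) u v = true ↔ T.Adj u v := by
  simp only [hLT u v, Alg.adj, List.any_eq_true, List.mem_map, exists_exists_and_eq_and,
    Bool.or_eq_true, Bool.and_eq_true, decide_eq_true_eq, Fin.val_inj]
  constructor
  · rintro ⟨⟨a, b⟩, h, ⟨rfl, rfl⟩ | ⟨rfl, rfl⟩⟩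
    · exact Or.inl h
    · exact Or.inr h
  · rintro (h | h)
    · exact ⟨_, h, Or.inl ⟨rfl, rfl⟩⟩
    · exact ⟨_, h, Or.inr ⟨rfl, rfl⟩⟩

namespace OrderedComplex

variable {n m d : ℕ} {K : OrderedComplex (Fin n)} {T : SimpleGraph (Fin n)}
  {S : OrderedComplex (Fin m)} {f : S.ss ⟶ K.collapse T}

/-- The input of the algorithm, as a list of natural numbers. -/
def input (LK : List (List (Fin n))) (LT : List (Fin n × Fin n)) (LS : List (List (Fin m)))
    (Lf : List (List (Fin m) × Option (List (Fin n)))) : Alg.Input :=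
  ((n, LK.map (List.map Fin.val)), LT.map fun e => (e.1.1, e.2.1),
    (m, LS.map (List.map Fin.val)), codeMap Lf)

theorem enc_input (LK : List (List (Fin n))) (LT : List (Fin n × Fin n)) (LS : List (List (Fin m)))
    (Lf : List (List (Fin m) × Option (List (Fin n)))) :
    enc (input LK LT LS Lf) =
      .cons (.cons (.ofNat n) (.ofList (.ofList .ofFin) LK))
      (.cons (.ofList (.ofPair .ofFin .ofFin) LT)
        (.cons (.cons (.ofNat m) (.ofList (.ofList .ofFin) LS))
          (.ofList (.ofPair (.ofList .ofFin) (.ofOption (.ofList .ofFin))) Lf))) := by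
  have h : ∀ {r : ℕ} (l : List (Fin r)), enc (l.map Fin.val) = Data.ofList .ofFin l :=
    fun l => Enc.enc_map (fun _ => rfl) l
  exact congrArg₂ Data.cons (congrArg _ (Enc.enc_map h LK))
    (congrArg₂ Data.cons (Enc.enc_map (fun _ => rfl) LT)
      (congrArg₂ Data.cons (congrArg _ (Enc.enc_map h LS))
        (Enc.enc_map (fun q => congrArg₂ Data.cons (h q.1) (Enc.enc_option_map h q.2)) Lf)))

theorem encodesOutput_main {LK : List (List (Fin n))} {LT : List (Fin n × Fin n)}
    {LS : List (List (Fin m))} {Lf : List (List (Fin m) × Option (List (Fin n)))}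
    (hLS : S.ListsSimplices LS) (hS : S.DimLE d) {f' : S.EsdVertex (Alg.parts d n) → Fin n}
    (hf' : ∀ x : S.EsdVertex (Alg.parts d n), (f' x).1 =
      Alg.val n m (LT.map fun e => (e.1.1, e.2.1)) (codeMap Lf) (List.ofFn x.1)) :
    EncodesOutput S (Alg.parts d n) f' (enc (Alg.main d (input LK LT LS Lf))) := by
  have hk : 0 < Alg.parts d n := Nat.mul_pos (Nat.succ_pos d) (Nat.succ_pos _)
  have hcode : Function.Injective fun x : S.EsdVertex (Alg.parts d n) => List.ofFn x.1 :=
    fun x y h => Subtype.ext (List.ofFn_injective h)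
  set E := Alg.verts d m (LS.map (List.map Fin.val)) (Alg.parts d n) with hE
  have hmem : ∀ t, t ∈ E ↔ ∃ x : S.EsdVertex (Alg.parts d n), List.ofFn x.1 = t :=
    fun t => mem_verts hLS hS hk
  -- Computed lists with entries in `E` are codes of lists of vertices, so the output of the
  -- algorithm can be decoded.
  have hlift : ∀ L : List (List ℕ), (∀ t ∈ L, t ∈ E) →
      ∃ l : List (S.EsdVertex (Alg.parts d n)), codes l = L := fun L hL => by
    have : L ∈ Set.range (List.map fun x : S.EsdVertex (Alg.parts d n) => List.ofFn x.1) := by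
      rw [Set.range_list_map]
      exact fun t ht => (hmem t).1 (hL t ht)
    exact this
  obtain ⟨LV, hLV⟩ := hlift E fun _ h => h
  set FL := (Alg.tuples (d + 2) E).filter (Alg.isFace m (LS.map (List.map Fin.val))) with hFL
  obtain ⟨LE, hLE⟩ : ∃ LE : List (List (S.EsdVertex (Alg.parts d n))), LE.map codes = FL := by
    have : FL ∈ Set.range (List.map (codes (S := S) (k := Alg.parts d n))) := by
      rw [Set.range_list_map]
      exact fun t ht => hlift t (Alg.mem_tuples.1 (List.mem_filter.1 ht).1).2
    exact this
  have hfaces : ∀ l ∈ LE, l.Nodup ∧ l.toFinset ∈ (S.esd (Alg.parts d n)).faces := fun l hl => by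
    have h := List.mem_map_of_mem (f := codes) hl
    rw [hLE] at h
    exact (isFace_iff hLS).1 (List.mem_filter.1 h).2
  refine ⟨LE, LV.map fun x => (x, f' x), fun l hl => (hfaces l hl).1, fun F => ⟨fun hF => ?_, ?_⟩,
    fun x v => ?_, ?_⟩
  · have h : codes F.toList ∈ FL := by
      refine List.mem_filter.2 ⟨Alg.mem_tuples.2 ⟨?_, ?_⟩, (isFace_iff hLS).2 ⟨F.nodup_toList, ?_⟩⟩
      · rw [codes, List.length_map, Finset.length_toList]
        have := S.card_le_of_mem_esd hF
        have := hS _ hF.2.1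
        omega
      · intro t ht
        obtain ⟨x, -, rfl⟩ := List.mem_map.1 ht
        exact (hmem _).2 ⟨x, rfl⟩
      · rwa [Finset.toList_toFinset]
    rw [← hLE] at h
    obtain ⟨l, hl, h⟩ := List.mem_map.1 h
    obtain rfl : l = F.toList := List.map_injective_iff.2 hcode h
    exact ⟨_, hl, F.toList_toFinset⟩
  · rintro ⟨l, hl, rfl⟩
    exact (hfaces l hl).2
  · have hx : x ∈ LV := by
      have h := (hmem _).2 ⟨x, rfl⟩
      rw [← hLV] at h
      exact (List.mem_map_of_injective hcode).1 h
    rw [List.mem_map]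
    constructor
    · rintro ⟨y, -, h⟩
      obtain ⟨rfl, rfl⟩ := Prod.ext_iff.1 h
      rfl
    · rintro rfl
      exact ⟨x, hx, rfl⟩
  · have h1 : enc FL = Data.ofList (Data.ofList EsdVertex.code) LE := by
      rw [← hLE]
      exact Enc.enc_map (fun l => Enc.enc_map (fun x => rfl) l) LE
    have h2 : enc (E.map fun x =>
        (x, Alg.val n m (LT.map fun e => (e.1.1, e.2.1)) (codeMap Lf) x)) =
        Data.ofList (Data.ofPair EsdVertex.code Data.ofFin) (LV.map fun x => (x, f' x)) := by
      rw [← hLV, codes, List.map_map]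
      have h3 : ∀ l : List (S.EsdVertex (Alg.parts d n)),
          enc (l.map fun x => (List.ofFn x.1, (f' x).1)) =
          Data.ofList (Data.ofPair EsdVertex.code Data.ofFin) (l.map fun x => (x, f' x)) := by
        intro l
        induction l with
        | nil => rfl
        | cons x l ih => exact congrArg _ ih
      rw [← h3]
      refine congrArg enc (List.map_congr_left fun x _ => ?_)
      rw [hf']
      rfl
    exact congrArg (Data.cons (Data.ofNat (Alg.parts d n))) (congrArg₂ Data.cons h1 h2)

end OrderedComplex

theorem lemmal (d : ℕ) (hd : 0 < d) :
    ∃ (P : Prog) (q : Polynomial ℕ),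
      ∀ (n m : ℕ) (K : OrderedComplex (Fin n)) (T : SimpleGraph (Fin n)) (_ : K.IsSpanningTree T)
        (S : OrderedComplex (Fin m)) (_ : S.DimLE d) (f : S.ss ⟶ K.collapse T)
        (a : Data) (_ : OrderedComplex.EncodesInput K T S f a),
        ∃ (k : ℕ) (f' : S.EsdVertex k → Fin n)
          (hf' : IsSimplicialMap (S.esd k) K.toAbstractSimplicialComplex f'),
          1 ≤ k ∧
          IsHomeomorph (S.esdMap k) ∧
          AreHomotopic
            (fun y : Realization (S.esd k) => SSet.toTop.map (K.proj T) (K.toSS (Realization.map hf' y)))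
            (fun y : Realization (S.esd k) => SSet.toTop.map f (S.toSS (S.esdMap k y))) ∧
          ∃ b : Data, OrderedComplex.EncodesOutput S k f' b ∧
            P.ComputesWithin a b (q.eval a.size) := by
  obtain ⟨P, q, hP⟩ := PolyTime.main d
  refine ⟨P 0, q, fun n m K T hT S hS f a ha => ?_⟩
  obtain ⟨LK, LT, LS, Lf, -, hLT, hLS, hLf, rfl⟩ := ha
  -- A tree has a vertex, so the root `0` exists.
  have hn : 0 < n := by
    obtain ⟨v⟩ := hT.1.1.nonempty
    exact v.pos
  have hk : 0 < Alg.parts d n := Nat.mul_pos (Nat.succ_pos d) (Nat.succ_pos _)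
  obtain ⟨j, f', hj, hval, happ⟩ :=
    OrderedComplex.exists_isApprox hn hT.1 (Alg.adj_iff hLT) hS hLf
  refine ⟨Alg.parts d n, f', OrderedComplex.isSimplicialMap_of_isApprox hT happ, hk,
    OrderedComplex.isHomeomorph_esdMap S hk, OrderedComplex.areHomotopic_of_isApprox hj _ happ,
    enc (Alg.main d (OrderedComplex.input LK LT LS Lf)),
    OrderedComplex.encodesOutput_main hLS hS hval, ?_⟩
  rw [← OrderedComplex.enc_input]
  obtain ⟨t, ht, h⟩ := hP (OrderedComplex.input LK LT LS Lf) 0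
    (Function.update (fun _ => Data.nil) 0 (enc (OrderedComplex.input LK LT LS Lf)))
    (Function.update_self ..) fun j hj => Function.update_of_ne hj.ne' ..
  exact ⟨t, _, ht, h, Function.update_self ..⟩
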